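/- **Setting.** Let $1\le r$, let $\mathcal M=\mathrm{St}(n,r)=\{X\in\mathbb R^{n\times r}:X^\top X=I_r\}$ with tangent spaces $T_X=\{u:X^\top u+u^\top X=0\}$ and orthogonal projections $\mathcal P_{X}(Y)=Y-\tfrac12X(X^\top Y+Y^\top X)$, let $\|\cdot\|$ be the Frobenius and $\|\cdot\|_2$ the spectral norm, and let $\mathcal R_X(v)=(X+v)(I_r+v^\top v)^{-1/2}$ be the polar retraction. For a differentiable function $\phi$ on $\mathbb R^{n\times r}$ put $\mathrm{grad}\,\phi(X)=\mathcal P_X(\nabla\phi(X))$. For $\mathbf X=(X_1,\dots,X_N)\in\mathcal M^N$ let $\hat X\in\arg\min_{Y\in\mathcal M}\sum_i\|Y-X_i\|^2$ be the induced arithmetic mean, and $\|\mathbf X-\hat{\mathbf X}\|^2=\sum_i\|X_i-\hat X\|^2$. *Network.* $N$ agents are joined by a connected undirected graph with edge set $\mathcal E$; $W\in\mathbb R^{N\times N}$ is symmetric, $W\mathbf 1=\mathbf 1$, $W_{ij}>0$ if $i=j$ or $ij\in\mathcal E$, and $W_{ij}=0$ otherwise. $\sigma_2$ is the second largest singular value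 of $W$, that is, $\sigma_2=\|W-\frac1N\mathbf 1\mathbf 1^\top\|_2$. The number $t\ge1$ of communication rounds per iteration satisfies $t\ge\lceil\log_{\sigma_2}(1/(2\sqrt N))\rceil$ (no further condition if $\sigma_2=0$). $L_t=1-\lambda_{\min}(W^t)$. *Costs and oracle.* $f=\frac1N\sum_if_i$ with $f_i(X)=\mathbb E\,F_i(X,\xi_i)$, where each $f_i$ is $L$-smooth on $\mathbb R^{n\times r}$, $L>0$. The samples $G_i(X,\xi_i)\in T_X$ are measurable in $(X,\xi_i)$ and satisfy, for all $X\in\mathcal M$, $\mathbb E\,G_i(X,\xi_i)=\mathrm{grad}f_i(X)$, $\mathbb E\|G_i(X,\xi_i)-\mathrm{grad}f_i(X)\|^2\le\sigma^2$ and, almost surely, $\|G_i(X,\xi_i)\|\le A_1$. Let $A_2\ge\max_{i,X\in\mathcal M}\|\nabla f_i(X)\|$, $A=\max\{A_1,A_2\}$, $L_n=\max_{i,X\in\mathcal M}\|\nabla f_i(X)\|_2$, $L_G=L+2L_n$. Let $M>0$ be such that $\|\mathcal R_X(v)-(X+v)\|\le M\|v\|^2$ for all $X\in\mathcal M$, $v\in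 T_X$. *Algorithm.* The variables $\xi_{i,k}^{[j]}$ have the law of $\xi_i$; for fixed $i,k$ they are independent over $j$, and the families $(\xi_{i,k}^{[j]})_{i,j}$, $k\ge0$, are independent. With sample sizes $N_k$ put $F_{i,k}(X)=\frac1{N_k}\sum_{j=1}^{N_k}G_i(X,\xi_{i,k}^{[j]})$. From a deterministic $\mathbf X_0$ and $Y_{i,0}=F_{i,0}(X_{i,0})$ the iterates are $$X_{i,k+1}=\mathcal R_{X_{i,k}}\Big(\alpha\,\mathcal P_{X_{i,k}}\big[\textstyle\sum_jW^t_{ij}X_{j,k}\big]-\beta\,\mathcal P_{X_{i,k}}Y_{i,k}\Big),\qquad Y_{i,k+1}=\textstyle\sum_jW^t_{ij}Y_{j,k}+F_{i,k+1}(X_{i,k+1})-F_{i,k}(X_{i,k}).$$ *Local region, constants and step sizes.* Let $\delta_1\le\frac{\delta_2}{5\sqrt r}$, $\delta_2\le\frac16$, and let $\mathbf X_0$ lie in $\mathcal S=\{\mathbf X\in\mathcal M^N:\|\mathbf X-\hat{\mathbf X}\|^2\le N\delta_1^2,\ \max_i\|X_i-\hat X\|\le\delta_2\}$. Put $\Phi=\inf_{\mathbf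 X\in\mathcal S}\big(2-\max_i\|X_i-\hat X\|^2\big)$, $\rho_t=\sqrt{1-(\alpha L_t\Phi-\alpha^2L_t^2)}$, $\Gamma_0=\frac2{(1-\rho_t)^2}$, $\Gamma_2=\frac2{(1-\sigma_2^t)^2}$, $D_1=(\delta_1^2+5)L_G+2MA$, $D_3=\frac{1+4L_G^2\beta^2}{2L_G}$, $D_4=\frac{4r\delta_1^2}{\beta^2L_G}$, $D_2=3L_G+2\alpha A+13L_G\frac{\delta_2^2}r\alpha^2+D_4$, $C_1=D_2\Gamma_0+D_4\Gamma_0+D_1$, $\tilde D_3=D_3+\frac{5\beta}8$, $\bar\beta=\min\{\frac{1-\rho_t}{10A+L_G}\delta_1,\frac{\alpha\delta_1}{5(10A+L_G)}\}$. Assume $$0<\alpha\le\min\Big\{1,\tfrac1M,\tfrac{\Phi}{L_t}\Big\},\qquad 0<\beta\le\min\Big\{\bar\beta,\tfrac1{9L_G},\tfrac1{4[\alpha\delta_1L_G(16\Gamma_0+\Gamma_2)+2C_1]}\Big\}.$$ A random $\mathbf X$ is called *$\epsilon$-stationary* if $\frac1N\mathbb E\|\mathbf X-\hat{\mathbf X}\|^2\le\epsilon$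 and $\mathbb E\|\mathrm{grad}f(\hat X)\|^2\le\epsilon$. Running the iterations $0,\dots,K$ costs $K+1$ iterations, $N\sum_{k=0}^KN_k$ sampled gradients and $2t|\mathcal E|(K+1)$ communications. Below, $[x]$ is $x$ rounded to an integer, down or up. **Statement.** For every $\epsilon\in(0,\frac12]$ there is a $K$ such that one of $\mathbf X_0,\dots,\mathbf X_K$ is $\epsilon$-stationary (in the last row: satisfies the relaxed condition stated below), with the following bounds: | $N_k$ | iterations | sampled gradients | communications | |---|---|---|---| | $[q^{-k}]$, $0<q<1$ | $\le c_1/\epsilon$ | $\mathcal O\big(e^{\frac{c_1}{\epsilon}\ln(1/q)}\big)$ | $\mathcal O\big(\frac{t\lvert\mathcal E\rvert}{\epsilon}\big)$ | | $k+1$ | $\mathcal O\big(\frac1\epsilon\ln\frac1\epsilon\big)$ | $\mathcal O\big(\frac1{\epsilon^2}\ln^2\frac1\epsilon\big)$ | $\mathcal O\big(\frac{t\lvert\mathcal E\rvert}{\epsilon}\ln\frac1\epsilon\big)$ | | $[(k+1)^a]$, $0<a<1$ | $\mathcal O(\epsilon^{-1/a})$ | $\mathcal O(\epsilon^{-(1+1/a)})$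 | $\mathcal O(t\lvert\mathcal E\rvert\,\epsilon^{-1/a})$ | | $[(k+1)^a]$, $a>1$ | $\mathcal O(\frac1\epsilon)$ | $\mathcal O(\epsilon^{-(a+1)})$ | $\mathcal O\big(\frac{t\lvert\mathcal E\rvert}{\epsilon}\big)$ | | constant $Q\ge1$ | $\mathcal O(\frac1\epsilon)$ | $\mathcal O(\frac Q\epsilon)$ | $\mathcal O\big(\frac{t\lvert\mathcal E\rvert}{\epsilon}\big)$ | The constants $c_1$ and those in $\mathcal O(\cdot)$ do not depend on $\epsilon$ nor on the rounding; in the first, third and fourth rows they may depend on $q$ or $a$, and in the last row they do not depend on $Q$. In the last row the condition reached is $$\mathbb E\|\mathrm{grad}f(\hat X_k)\|^2\le\epsilon+C,\qquad \tfrac1N\mathbb E\|\mathbf X_k-\hat{\mathbf X}_k\|^2\le\epsilon+C',$$ $$C=\frac{\sigma^2(16+\Gamma_0\alpha^2\delta_1^2)(4\beta\Gamma_2+\tilde D_3)}{\beta Q},\qquad C'=\frac{8\beta\Gamma_0\sigma^2(4\beta\Gamma_2+D_3+\frac\beta2)}{Q}.$$ -/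

import Mathlib

open MeasureTheory ProbabilityTheory
open scoped Matrix

noncomputable section

namespace StiefelTracking

/-! ### The Stiefel manifold -/

/-- Real `n × r` matrices. -/
abbrev Mat (n r : ℕ) : Type := Matrix (Fin n) (Fin r) ℝ

/-- The Stiefel manifold `St(n,r) = {X : Xᵀ X = I_r}`. -/
def stiefel (n r : ℕ) : Set (Mat n r) := {X | Xᵀ * X = 1}

/-- The tangent space `T_X = {u : Xᵀ u + uᵀ X = 0}` of the Stiefel manifold at `X`. -/
def tangent {n r : ℕ} (X : Mat n r) : Set (Mat n r) := {u | Xᵀ * u + uᵀ * X = 0}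

/-- The orthogonal projection onto the tangent space at `X`:
`P(Y) = Y - (1/2) X (Xᵀ Y + Yᵀ X)`. -/
def projT {n r : ℕ} (X Y : Mat n r) : Mat n r := Y - (1 / 2 : ℝ) • (X * (Xᵀ * Y + Yᵀ * X))

/-- The polar retraction `R_X(v) = (X + v) (I_r + vᵀ v)^(-1/2)`; the inverse square root is
taken with the functional calculus of symmetric matrices. -/
def polarRetraction {n r : ℕ} (X v : Mat n r) : Mat n r :=
  (X + v) * cfc (fun x : ℝ => (√x)⁻¹) (1 + vᵀ * v)

/-- The spectral norm (operator norm for the Euclidean norms) of a matrix. -/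
def specNorm {n r : ℕ} (Z : Mat n r) : ℝ := ‖(Matrix.toEuclideanLin Z).toContinuousLinearMap‖

section Frobenius

/- From here to the end of the section `‖Z‖` is the Frobenius norm of a matrix `Z`. -/
attribute [local instance] Matrix.frobeniusNormedAddCommGroup Matrix.frobeniusNormedSpace

/-- `M > 0` is a second-order constant of the polar retraction:
`‖R_X(v) - (X + v)‖ ≤ M ‖v‖²` for all `X` in the manifold and all tangent vectors `v`. -/
def IsRetractionConst (n r : ℕ) (M : ℝ) : Prop :=
  0 < M ∧ ∀ X ∈ stiefel n r, ∀ v ∈ tangent X, ‖polarRetraction X v - (X + v)‖ ≤ M * ‖v‖ ^ 2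

/-! ### Functions of a matrix variable -/

/-- The Euclidean gradient: the matrix of the partial derivatives. -/
def egrad {n r : ℕ} (φ : Mat n r → ℝ) (X : Mat n r) : Mat n r :=
  Matrix.of fun a b => fderiv ℝ φ X (Matrix.single a b 1)

/-- The Riemannian gradient on the Stiefel manifold: the tangential part of the Euclidean
gradient. -/
def rgrad {n r : ℕ} (φ : Mat n r → ℝ) (X : Mat n r) : Mat n r := projT X (egrad φ X)

/-- `φ` is `L`-smooth in Euclidean space. -/
def LSmooth {n r : ℕ} (L : ℝ) (φ : Mat n r → ℝ) : Prop :=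
  Differentiable ℝ φ ∧ ∀ X Y, ‖egrad φ X - egrad φ Y‖ ≤ L * ‖X - Y‖

/-- The average `f = (1/N) ∑ f_i` of the local costs. -/
def avgCost {n r N : ℕ} (f : Fin N → Mat n r → ℝ) (X : Mat n r) : ℝ :=
  (N : ℝ)⁻¹ * ∑ i, f i X

/-- `L_n`: the maximum over the agents and over the manifold of the spectral norm of the
Euclidean gradient of the local costs. -/
def maxGradNorm {n r N : ℕ} (f : Fin N → Mat n r → ℝ) : ℝ :=
  sSup {x | ∃ i, ∃ X ∈ stiefel n r, x = specNorm (egrad (f i) X)}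

/-- The local cost `f_i(X) = E[F_i(X, ξ_i)]`, where `ξ_i` has the law `P i`. -/
def localCost {n r N : ℕ} {Ξ : Fin N → Type*} [∀ i, MeasurableSpace (Ξ i)]
    (P : ∀ i, Measure (Ξ i)) (F : ∀ i, Mat n r → Ξ i → ℝ) (i : Fin N) (X : Mat n r) : ℝ :=
  ∫ s, F i X s ∂(P i)

/-- The stochastic first-order oracle: `G i X s` is a noisy sample of the Riemannian gradient of
`f i` at `X`. It is measurable, tangent, uniformly bounded by `A₁`, unbiased, and has variance
at most `σ ^ 2`. -/
structure IsGradientOracle {n r N : ℕ} {Ξ : Fin N → Type*} [∀ i, MeasurableSpace (Ξ i)]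
    (P : ∀ i, Measure (Ξ i)) (f : Fin N → Mat n r → ℝ) (G : ∀ i, Mat n r → Ξ i → Mat n r)
    (A₁ σ : ℝ) : Prop where
  measurable : ∀ i a b, Measurable fun p : (Fin n → Fin r → ℝ) × Ξ i =>
    G i (Matrix.of p.1) p.2 a b
  tangent : ∀ i, ∀ᵐ s ∂(P i), ∀ X ∈ stiefel n r, G i X s ∈ tangent X
  bounded : ∀ i, ∀ᵐ s ∂(P i), ∀ X ∈ stiefel n r, ‖G i X s‖ ≤ A₁
  unbiased : ∀ i, ∀ X ∈ stiefel n r, ∀ a b, ∫ s, G i X s a b ∂(P i) = rgrad (f i) X a b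
  variance : ∀ i, ∀ X ∈ stiefel n r, ∫ s, ‖G i X s - rgrad (f i) X‖ ^ 2 ∂(P i) ≤ σ ^ 2

/-- `A₂` bounds the Frobenius norm of the Euclidean gradients of the local costs on the
manifold. -/
def GradBoundedBy {n r N : ℕ} (f : Fin N → Mat n r → ℝ) (A₂ : ℝ) : Prop :=
  ∀ i, ∀ X ∈ stiefel n r, ‖egrad (f i) X‖ ≤ A₂

/-! ### The induced arithmetic mean and the local region -/

/-- `Y` is an induced arithmetic mean of `X_1, …, X_N`: it minimizes `∑ ‖Y - X_i‖²` over the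
Stiefel manifold. -/
def IsIAM {n r N : ℕ} (X : Fin N → Mat n r) (Y : Mat n r) : Prop :=
  Y ∈ stiefel n r ∧ ∀ Z ∈ stiefel n r, ∑ i, ‖Y - X i‖ ^ 2 ≤ ∑ i, ‖Z - X i‖ ^ 2

/-- The induced arithmetic mean of `X_1, …, X_N` (some minimizer). -/
def iam {n r N : ℕ} (X : Fin N → Mat n r) : Mat n r := Classical.epsilon (IsIAM X)

/-- The squared consensus error `‖𝐗 - 𝐗̂‖² = ∑ ‖X_i - X̂‖²`. -/
def consensusSq {n r N : ℕ} (X : Fin N → Mat n r) : ℝ := ∑ i, ‖X i - iam X‖ ^ 2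

/-- The local region `S = S₁ ∩ S₂`. -/
def localRegion (n r N : ℕ) (δ₁ δ₂ : ℝ) : Set (Fin N → Mat n r) :=
  {X | (∀ i, X i ∈ stiefel n r) ∧ consensusSq X ≤ N * δ₁ ^ 2 ∧ ∀ i, ‖X i - iam X‖ ≤ δ₂}

/-- `Φ = 2 - max_i ‖X_i - X̂‖²`, in its worst case over the local region, so that one constant
serves all iterates. -/
def regionPhi (n r N : ℕ) (δ₁ δ₂ : ℝ) : ℝ :=
  sInf ((fun X : Fin N → Mat n r => 2 - ⨆ i, ‖X i - iam X‖ ^ 2) '' localRegion n r N δ₁ δ₂)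

/-! ### The network -/

/-- The mixing matrix `W` of an undirected connected graph: positive on the diagonal and on the
edges, zero elsewhere, symmetric, and (doubly) stochastic. -/
structure IsMixingMatrix {N : ℕ} (𝒢 : SimpleGraph (Fin N)) (W : Matrix (Fin N) (Fin N) ℝ) :
    Prop where
  connected : 𝒢.Connected
  pos : ∀ i j, 𝒢.Adj i j ∨ i = j → 0 < W i j
  zero : ∀ i j, ¬ (𝒢.Adj i j ∨ i = j) → W i j = 0
  symm : Wᵀ = W
  row_sum : ∀ i, ∑ j, W i j = 1

/-- `σ₂`, the spectral norm of `W - (1/N) 1 1ᵀ`, which is the second largest singular value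
of `W`. -/
def sigma2 {N : ℕ} (W : Matrix (Fin N) (Fin N) ℝ) : ℝ :=
  specNorm (W - Matrix.of fun _ _ => (N : ℝ)⁻¹)

/-- `L_t = 1 - λ_min(W^t)`. -/
def mixL {N : ℕ} (W : Matrix (Fin N) (Fin N) ℝ) (t : ℕ) : ℝ := 1 - sInf (spectrum ℝ (W ^ t))

/-! ### The algorithm -/

/-- The averaged gradient sample of every agent at iteration `k`, at the points `X`, with sample
size `m k`; `s i k j` is the `j`-th sample of agent `i` at iteration `k`. -/
def batchGrad {n r N : ℕ} {Ξ : Fin N → Type*} (G : ∀ i, Mat n r → Ξ i → Mat n r) (m : ℕ → ℕ)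
    (s : ∀ i, ℕ → ℕ → Ξ i) (k : ℕ) (X : Fin N → Mat n r) (i : Fin N) : Mat n r :=
  (m k : ℝ)⁻¹ • ∑ j ∈ Finset.range (m k), G i (X i) (s i k j)

/-- The iterates `(𝐗_k, 𝐘_k)` of the distributed Riemannian stochastic gradient tracking
algorithm, for given samples `s`. -/
def iterates {n r N : ℕ} {Ξ : Fin N → Type*} (W : Matrix (Fin N) (Fin N) ℝ) (t : ℕ)
    (α β : ℝ) (G : ∀ i, Mat n r → Ξ i → Mat n r) (X₀ : Fin N → Mat n r) (m : ℕ → ℕ)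
    (s : ∀ i, ℕ → ℕ → Ξ i) : ℕ → (Fin N → Mat n r) × (Fin N → Mat n r)
  | 0 => (X₀, batchGrad G m s 0 X₀)
  | k + 1 =>
    let X := (iterates W t α β G X₀ m s k).1
    let Y := (iterates W t α β G X₀ m s k).2
    let X' : Fin N → Mat n r := fun i =>
      polarRetraction (X i)
        (α • projT (X i) (∑ j, (W ^ t) i j • X j) - β • projT (X i) (Y i))
    (X', fun i => ∑ j, (W ^ t) i j • Y j + batchGrad G m s (k + 1) X' i - batchGrad G m s k X i)

/-- The samples `ξ i k j` (agent `i`, iteration `k`, index `j`) on the probability space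
`(Ω, μ)`: they have the law `P i`, those of one agent at one iteration are independent, and the
families used at different iterations are independent. -/
structure IsSampling {Ω : Type*} [MeasurableSpace Ω] (μ : Measure Ω) {N : ℕ} {Ξ : Fin N → Type*}
    [∀ i, MeasurableSpace (Ξ i)] (P : ∀ i, Measure (Ξ i)) (ξ : ∀ i, ℕ → ℕ → Ω → Ξ i) :
    Prop where
  measurable : ∀ i k j, Measurable (ξ i k j)
  law : ∀ i k j, μ.map (ξ i k j) = P i
  indep_batch : ∀ i k, iIndepFun (fun j => ξ i k j) μ
  indep_iter : iIndepFun (fun k ω (i : Fin N) (j : ℕ) => ξ i k j ω) μ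

/-- The random iterate `𝐗_k`. -/
def randomIterate {Ω : Type*} {n r N : ℕ} {Ξ : Fin N → Type*} (W : Matrix (Fin N) (Fin N) ℝ)
    (t : ℕ) (α β : ℝ) (G : ∀ i, Mat n r → Ξ i → Mat n r) (X₀ : Fin N → Mat n r)
    (ξ : ∀ i, ℕ → ℕ → Ω → Ξ i) (m : ℕ → ℕ) (k : ℕ) (ω : Ω) : Fin N → Mat n r :=
  (iterates W t α β G X₀ m (fun i k j => ξ i k j ω) k).1

/-- Approximate stationarity in expectation of a random `𝐗 = (X_1, …, X_N)`:
`(1/N) E‖𝐗 - 𝐗̂‖² ≤ ε₁` and `E‖grad f(X̂)‖² ≤ ε₂`, the expectations being those of integrable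
variables. An `ε`-stationary point is the case `ε₁ = ε₂ = ε`. -/
def IsStationary {Ω : Type*} [MeasurableSpace Ω] (μ : Measure Ω) {n r N : ℕ}
    (f : Mat n r → ℝ) (X : Ω → Fin N → Mat n r) (ε₁ ε₂ : ℝ) : Prop :=
  Integrable (fun ω => consensusSq (X ω)) μ ∧
  Integrable (fun ω => ‖rgrad f (iam (X ω))‖ ^ 2) μ ∧
  (N : ℝ)⁻¹ * ∫ ω, consensusSq (X ω) ∂μ ≤ ε₁ ∧
  ∫ ω, ‖rgrad f (iam (X ω))‖ ^ 2 ∂μ ≤ ε₂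

end Frobenius

/-! ### The constants of the step-size conditions -/

/-- The numbers on which the constants depend: `LG` is `L_G`, `Lt` is `L_t`, `σ₂` is the second
largest singular value of `W`. -/
structure Params where
  (r t : ℕ)
  (LG A M σ₂ Lt Φ δ₁ δ₂ α β : ℝ)

namespace Params

variable (p : Params)

def rho : ℝ := √(1 - (p.α * p.Lt * p.Φ - p.α ^ 2 * p.Lt ^ 2))

def Γ₀ : ℝ := 2 / (1 - p.rho) ^ 2

def Γ₂ : ℝ := 2 / (1 - p.σ₂ ^ p.t) ^ 2

def D₁ : ℝ := (p.δ₁ ^ 2 + 5) * p.LG + 2 * p.M * p.A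

def D₃ : ℝ := (1 + 4 * p.LG ^ 2 * p.β ^ 2) / (2 * p.LG)

def D₄ : ℝ := 4 * p.r * p.δ₁ ^ 2 / (p.β ^ 2 * p.LG)

def Ctilde : ℝ := p.δ₂ ^ 2 / p.r

def D₂ : ℝ := 3 * p.LG + 2 * p.α * p.A + 13 * p.LG * p.Ctilde * p.α ^ 2 + p.D₄

def C₁ : ℝ := p.D₂ * p.Γ₀ + p.D₄ * p.Γ₀ + p.D₁

def D₃tilde : ℝ := p.D₃ + 5 * p.β / 8

def betaBar : ℝ :=
  min ((1 - p.rho) / (10 * p.A + p.LG) * p.δ₁) (p.α * p.δ₁ / (5 * (10 * p.A + p.LG)))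

/-- The conditions on the step sizes `α` and `β`. -/
structure StepSizes : Prop where
  α_pos : 0 < p.α
  α_le : p.α ≤ min 1 (min (1 / p.M) (p.Φ / p.Lt))
  β_pos : 0 < p.β
  β_le : p.β ≤ min p.betaBar (min (1 / (9 * p.LG))
    (1 / (4 * (p.α * p.δ₁ * p.LG * (16 * p.Γ₀ + p.Γ₂) + 2 * p.C₁))))

/-- The noise floor `C` of the expected squared gradient norm for the constant sample
size `Q`. -/
def gradFloor (σ : ℝ) (Q : ℕ) : ℝ :=
  σ ^ 2 * (16 + p.Γ₀ * p.α ^ 2 * p.δ₁ ^ 2) * (4 * p.β * p.Γ₂ + p.D₃tilde) / (p.β * Q)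

/-- The noise floor of the mean squared consensus error for the constant sample size `Q`. -/
def consensusFloor (σ : ℝ) (Q : ℕ) : ℝ :=
  8 * p.β * p.Γ₀ * σ ^ 2 * (4 * p.β * p.Γ₂ + p.D₃ + p.β / 2) / Q

end Params

/-! ### Complexities -/

/-- `m` is the integer `[x]`, rounding down or up. -/
def IsRounding (x : ℝ) (m : ℕ) : Prop := m = ⌊x⌋₊ ∨ m = ⌈x⌉₊

/-- The number of gradients sampled by the `N` agents in the iterations `0, …, K`. -/
def oracleCalls (N : ℕ) (m : ℕ → ℕ) (K : ℕ) : ℕ := N * ∑ k ∈ Finset.range (K + 1), m k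

/-- The number of communications in the iterations `0, …, K`: in every iteration `2 t` exchanges
over every edge (`t` for `𝐗` and `t` for `𝐘`). -/
def communications {N : ℕ} (𝒢 : SimpleGraph (Fin N)) (t K : ℕ) : ℕ :=
  2 * t * 𝒢.edgeSet.ncard * (K + 1)

/-- For some `K`, one of the iterates `X 0, …, X K` is stationary with tolerance `ε₁` for the
consensus error and `ε₂` for the gradient, the number `K + 1` of iterations is at most `I`, the
number of sampled gradients is at most `O`, and the number of communications is at most `C`. -/
def ReachesWithin {Ω : Type*} [MeasurableSpace Ω] (μ : Measure Ω) {n r N : ℕ}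
    (f : Mat n r → ℝ) (X : ℕ → Ω → Fin N → Mat n r) (𝒢 : SimpleGraph (Fin N)) (t : ℕ)
    (m : ℕ → ℕ) (ε₁ ε₂ I O C : ℝ) : Prop :=
  ∃ K : ℕ, (∃ k ≤ K, IsStationary μ f (X k) ε₁ ε₂) ∧ (K : ℝ) + 1 ≤ I ∧
    (oracleCalls N m K : ℝ) ≤ O ∧ (communications 𝒢 t K : ℝ) ≤ C

end StiefelTracking

end

noncomputable section

namespace StiefelTracking

/-! ### Inverse square roots through the functional calculus -/

section FunctionalCalculus

open scoped MatrixOrder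

/-! Everything reduces to deterministic recursions along a single trajectory. Let `e` be the root
mean square consensus error, `y` the size of the trackers, `V` their disagreement, `g` the norm of
grad f at the induced mean and `ν` the root mean square error of the averaged samples. Almost surely
e' ≤ (1 - 0.3α) e + β y, V' ≤ V/2 + (change of the gradient estimates), and f at the induced mean
decreases by 0.7 β g², up to β ν² and multiples δ₁ β y², δ₁ α² e² / β. Since f is bounded on the
compact manifold, these inequalities can be summed and the feedback loop between e, V, y, g closed
(`exists_progress_bound`): ∑ g² ≤ C + 13 ∑ ν² and ∑ e² ≤ C + 1000 (β/α)² ∑ ν², where C does not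
depend on the sample sizes.

The geometry rests on one fact (`polar_lipschitz`): orthonormal polar factors depend Lipschitz
continuously on the matrix, with constant 1/c when the symmetric factors are at least c. The polar
retraction is a polar factor of X + v with symmetric factor at least 1, hence nonexpansive.
First-order optimality writes the Euclidean mean of the agents as X̂ H with H symmetric and H - 1
quadratic in the consensus error, so the induced mean follows the Euclidean mean. Double
stochasticity keeps the mean of the trackers equal to that of the samples. The condition on t makes
√N σ₂^t ≤ 1/2, so mixing controls every agent separately by root mean square quantities, and the
local region is invariant (`IsLocal.nextPoint`).

The smallness that closes the loop is hidden in the step size conditions (`StepSizes.tame`): they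
force β (10A + L_G) ≤ α δ₁ / 5 and δ₁ ≤ α / 640.

The point reached at iteration k is independent of the samples of iteration k, so E ν_k² ≤ σ² / N_k
(`lintegral_batch_le`), which gives `exists_expectation_bound`. Averaging over k finds one index
that is good for both criteria (`exists_le_of_sum_le`). It remains to compare ∑ 1/N_k with ε (K + 1)
for each schedule; for constant N_k = Q the noise term is at most half of the stated floor. -/

/-- The inverse square root of a symmetric matrix `B ≥ 1` and its inverse. -/
lemma exists_sqrt_factor {r : ℕ} {B : Matrix (Fin r) (Fin r) ℝ} (hB : (B - 1).PosSemidef) :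
    ∃ K : Matrix (Fin r) (Fin r) ℝ, Kᵀ = K ∧ (K - 1).PosSemidef ∧
      (cfc (fun x : ℝ => (√x)⁻¹) B)ᵀ = cfc (fun x : ℝ => (√x)⁻¹) B ∧
      cfc (fun x : ℝ => (√x)⁻¹) B * K = 1 ∧
      cfc (fun x : ℝ => (√x)⁻¹) B * B * cfc (fun x : ℝ => (√x)⁻¹) B = 1 := by
  have h1 : (1 : Matrix (Fin r) (Fin r) ℝ) ≤ B := Matrix.le_iff.2 hB
  have hsa : IsSelfAdjoint B := by
    have := hB.1.add Matrix.isHermitian_one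
    rw [sub_add_cancel] at this
    exact this
  have hspec : ∀ x ∈ spectrum ℝ B, 1 ≤ x :=
    (algebraMap_le_iff_le_spectrum (r := (1 : ℝ)) (a := B) hsa).1 (by simpa using h1)
  have hpos : ∀ x ∈ spectrum ℝ B, 0 < √x := fun x hx =>
    Real.sqrt_pos.2 (zero_lt_one.trans_le (hspec x hx))
  have hc1 : ContinuousOn (fun x : ℝ => (√x)⁻¹) (spectrum ℝ B) :=
    Real.continuous_sqrt.continuousOn.inv₀ fun x hx => (hpos x hx).ne'
  have hc2 : ContinuousOn (fun x : ℝ => √x) (spectrum ℝ B) := Real.continuous_sqrt.continuousOn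
  have hsym : ∀ f : ℝ → ℝ, (cfc f B)ᵀ = cfc f B := fun f => by
    have : IsSelfAdjoint (cfc f B) := cfc_predicate f B
    rw [← Matrix.conjTranspose_eq_transpose_of_trivial]; exact this
  have hmul : cfc (fun x : ℝ => (√x)⁻¹) B * cfc (fun x : ℝ => √x) B = 1 := by
    rw [← cfc_mul _ _ B hc1 hc2, cfc_congr (g := fun _ => (1 : ℝ)), cfc_const_one ℝ B hsa]
    intro x hx
    exact inv_mul_cancel₀ (hpos x hx).ne'
  have hmul' : cfc (fun x : ℝ => √x) B * cfc (fun x : ℝ => (√x)⁻¹) B = 1 := by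
    rw [← cfc_mul _ _ B hc2 hc1, cfc_congr (g := fun _ => (1 : ℝ)), cfc_const_one ℝ B hsa]
    intro x hx
    exact mul_inv_cancel₀ (hpos x hx).ne'
  have hsq : cfc (fun x : ℝ => √x) B * cfc (fun x : ℝ => √x) B = B := by
    rw [← cfc_mul _ _ B hc2 hc2, cfc_congr (g := fun x => x), cfc_id' ℝ B hsa]
    intro x hx
    exact Real.mul_self_sqrt (zero_le_one.trans (hspec x hx))
  refine ⟨cfc (fun x : ℝ => √x) B, hsym _, ?_, hsym _, hmul, ?_⟩
  · exact Matrix.le_iff.1 (one_le_cfc _ _ (fun x hx => Real.one_le_sqrt.2 (hspec x hx)) hc2 hsa)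
  · nth_rw 2 [← hsq]
    rw [← mul_assoc, hmul, one_mul, hmul']

end FunctionalCalculus

/-! ### Frobenius geometry of the Stiefel manifold, tangent projections, polar factors -/

section Geometry

attribute [local instance] Matrix.frobeniusNormedAddCommGroup Matrix.frobeniusNormedSpace

lemma frobenius_sq {n r : ℕ} (A : Mat n r) : ‖A‖ ^ 2 = ∑ a, ∑ b, A a b ^ 2 := by
  have h0 : 0 ≤ ∑ a, ∑ b, A a b ^ 2 :=
    Finset.sum_nonneg fun a _ => Finset.sum_nonneg fun b _ => sq_nonneg _
  rw [Matrix.frobenius_norm_def, ← Real.sqrt_eq_rpow]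
  simp only [Real.rpow_ofNat, Real.norm_eq_abs, sq_abs]
  exact Real.sq_sqrt h0

lemma trace_transpose_mul {n r : ℕ} (A B : Mat n r) :
    (Aᵀ * B).trace = ∑ a, ∑ b, A a b * B a b := by
  simp only [Matrix.trace, Matrix.diag, Matrix.mul_apply, Matrix.transpose_apply]
  exact Finset.sum_comm

/-- The Frobenius inner product `⟪A, B⟫ = tr(Aᵀ B)`. -/
abbrev frobeniusInnerProductSpace (n r : ℕ) : InnerProductSpace ℝ (Mat n r) :=
  { Matrix.frobeniusNormedSpace with
    inner := fun A B => (Aᵀ * B).trace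
    norm_sq_eq_re_inner := fun A => by
      rw [frobenius_sq, trace_transpose_mul]
      simp [sq]
    conj_inner_symm := fun A B => by
      simp only [trace_transpose_mul, conj_trivial]
      simp only [mul_comm]
    add_left := fun A B C => by
      simp [Matrix.add_mul]
    smul_left := fun A B c => by
      simp }

attribute [local instance] frobeniusInnerProductSpace

variable {n r : ℕ}

lemma inner_def (A B : Mat n r) : inner ℝ A B = (Aᵀ * B).trace := rfl

lemma inner_eq_sum (A B : Mat n r) : inner ℝ A B = ∑ a, ∑ b, A a b * B a b :=
  trace_transpose_mul A B

lemma abs_apply_le_norm (A : Mat n r) (a : Fin n) (b : Fin r) : |A a b| ≤ ‖A‖ := by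
  refine abs_le_of_sq_le_sq ?_ (norm_nonneg _)
  rw [frobenius_sq]
  calc A a b ^ 2 ≤ ∑ b, A a b ^ 2 :=
        Finset.single_le_sum (f := fun b => A a b ^ 2) (fun _ _ => sq_nonneg _) (Finset.mem_univ b)
    _ ≤ _ := Finset.single_le_sum (f := fun a => ∑ b, A a b ^ 2)
        (fun _ _ => Finset.sum_nonneg fun _ _ => sq_nonneg _) (Finset.mem_univ a)

lemma norm_mul_left_of_mem {m : ℕ} {X : Mat n r} (hX : X ∈ stiefel n r) (A : Mat r m) :
    ‖X * A‖ = ‖A‖ := by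
  have h : ‖X * A‖ ^ 2 = ‖A‖ ^ 2 := by
    rw [← real_inner_self_eq_norm_sq, ← real_inner_self_eq_norm_sq, inner_def, inner_def,
      Matrix.transpose_mul, Matrix.mul_assoc, ← Matrix.mul_assoc Xᵀ, show Xᵀ * X = 1 from hX,
      Matrix.one_mul]
  exact (sq_eq_sq₀ (norm_nonneg _) (norm_nonneg _)).1 h

/-- Pythagoras: X Xᵀ B is the orthogonal projection of B onto the column space of X, and its norm is
that of Xᵀ B. -/
lemma norm_transpose_mul_le {m : ℕ} {X : Mat n r} (hX : X ∈ stiefel n r) (B : Mat n m) :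
    ‖Xᵀ * B‖ ≤ ‖B‖ := by
  have h : ‖B - X * (Xᵀ * B)‖ ^ 2 = ‖B‖ ^ 2 - ‖Xᵀ * B‖ ^ 2 := by
    rw [norm_sub_sq_real, norm_mul_left_of_mem hX]
    have : inner ℝ B (X * (Xᵀ * B)) = ‖Xᵀ * B‖ ^ 2 := by
      rw [← real_inner_self_eq_norm_sq, inner_def, inner_def, Matrix.transpose_mul,
        Matrix.transpose_transpose, ← Matrix.mul_assoc]
    rw [this]; ring
  have := sq_nonneg ‖B - X * (Xᵀ * B)‖
  exact abs_le_of_sq_le_sq' (by linarith) (norm_nonneg _) |>.2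

lemma norm_transpose_mul_le' {m : ℕ} {X : Mat n r} (hX : X ∈ stiefel n r) (B : Mat n m) :
    ‖Bᵀ * X‖ ≤ ‖B‖ := by
  rw [← Matrix.frobenius_norm_transpose, Matrix.transpose_mul, Matrix.transpose_transpose]
  exact norm_transpose_mul_le hX B

/-- The symmetric part of `Xᵀ Y`. -/
def symPart (X Y : Mat n r) : Matrix (Fin r) (Fin r) ℝ := (1 / 2 : ℝ) • (Xᵀ * Y + Yᵀ * X)

lemma symPart_transpose (X Y : Mat n r) : (symPart X Y)ᵀ = symPart X Y := by
  simp [symPart, add_comm]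

lemma projT_eq (X Y : Mat n r) : projT X Y = Y - X * symPart X Y := by
  rw [projT, symPart, Matrix.mul_smul]

lemma symPart_add (X Y Z : Mat n r) : symPart X (Y + Z) = symPart X Y + symPart X Z := by
  simp only [symPart, ← smul_add, Matrix.transpose_add, Matrix.mul_add, Matrix.add_mul]
  congr 1; abel

lemma symPart_smul (X Y : Mat n r) (c : ℝ) : symPart X (c • Y) = c • symPart X Y := by
  simp only [symPart, Matrix.transpose_smul, Matrix.mul_smul, Matrix.smul_mul, ← smul_add]
  rw [smul_comm]

lemma symPart_self {X : Mat n r} (hX : X ∈ stiefel n r) : symPart X X = 1 := by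
  rw [symPart, show Xᵀ * X = 1 from hX, ← two_smul ℝ, smul_smul]; norm_num

lemma norm_symPart_le {X : Mat n r} (hX : X ∈ stiefel n r) (Y : Mat n r) :
    ‖symPart X Y‖ ≤ ‖Y‖ := by
  rw [symPart, norm_smul]
  have h1 := norm_add_le (Xᵀ * Y) (Yᵀ * X)
  have h2 := norm_transpose_mul_le hX Y
  have h3 := norm_transpose_mul_le' hX Y
  norm_num
  linarith

lemma norm_symPart_le_of_mul (X Y : Mat n r) : ‖symPart X Y‖ ≤ ‖X‖ * ‖Y‖ := by
  rw [symPart, norm_smul]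
  have h1 := norm_add_le (Xᵀ * Y) (Yᵀ * X)
  have h2 := Matrix.frobenius_norm_mul Xᵀ Y
  have h3 := Matrix.frobenius_norm_mul Yᵀ X
  rw [Matrix.frobenius_norm_transpose] at h2 h3
  norm_num
  linarith

lemma projT_add (X Y Z : Mat n r) : projT X (Y + Z) = projT X Y + projT X Z := by
  simp only [projT_eq, symPart_add, Matrix.mul_add]; abel

lemma projT_smul (X Y : Mat n r) (c : ℝ) : projT X (c • Y) = c • projT X Y := by
  simp only [projT_eq, symPart_smul, Matrix.mul_smul, smul_sub]

/-- The projection onto the tangent space at `X` as a linear map. -/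
def projTLin (X : Mat n r) : Mat n r →ₗ[ℝ] Mat n r where
  toFun := projT X
  map_add' := projT_add X
  map_smul' c Y := projT_smul X Y c

lemma projT_sub (X Y Z : Mat n r) : projT X (Y - Z) = projT X Y - projT X Z :=
  (projTLin X).map_sub Y Z

lemma projT_sum {ι : Type*} (s : Finset ι) (X : Mat n r) (Y : ι → Mat n r) :
    projT X (∑ i ∈ s, Y i) = ∑ i ∈ s, projT X (Y i) := map_sum (projTLin X) Y s

lemma projT_self {X : Mat n r} (hX : X ∈ stiefel n r) : projT X X = 0 := by
  rw [projT_eq, symPart_self hX, Matrix.mul_one, sub_self]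

lemma mem_tangent_iff {X u : Mat n r} : u ∈ tangent X ↔ symPart X u = 0 := by
  rw [symPart, smul_eq_zero_iff_right (by norm_num)]; rfl

lemma symPart_mul_sym {X : Mat n r} (hX : X ∈ stiefel n r) {S : Matrix (Fin r) (Fin r) ℝ}
    (hS : Sᵀ = S) : symPart X (X * S) = S := by
  rw [symPart, ← Matrix.mul_assoc, Matrix.transpose_mul, Matrix.mul_assoc Sᵀ,
    show Xᵀ * X = 1 from hX, Matrix.one_mul, Matrix.mul_one, hS, ← two_smul ℝ, smul_smul]
  norm_num

lemma projT_mem_tangent {X : Mat n r} (hX : X ∈ stiefel n r) (Y : Mat n r) :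
    projT X Y ∈ tangent X := by
  rw [mem_tangent_iff, projT_eq, sub_eq_add_neg, symPart_add, ← neg_one_smul ℝ, symPart_smul,
    symPart_mul_sym hX (symPart_transpose X Y)]
  simp

lemma tangent_smul {X u : Mat n r} (hu : u ∈ tangent X) (c : ℝ) : c • u ∈ tangent X := by
  rw [mem_tangent_iff] at *; rw [symPart_smul, hu, smul_zero]

lemma tangent_add {X u v : Mat n r} (hu : u ∈ tangent X) (hv : v ∈ tangent X) :
    u + v ∈ tangent X := by
  rw [mem_tangent_iff] at *; rw [symPart_add, hu, hv, add_zero]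

lemma tangent_sub {X u v : Mat n r} (hu : u ∈ tangent X) (hv : v ∈ tangent X) :
    u - v ∈ tangent X := by
  rw [sub_eq_add_neg, ← neg_one_smul ℝ v]; exact tangent_add hu (tangent_smul hv _)

/-- Pairing with a normal direction only sees the symmetric part. -/
lemma inner_mul_sym (X Y : Mat n r) {S : Matrix (Fin r) (Fin r) ℝ} (hS : Sᵀ = S) :
    inner ℝ Y (X * S) = (symPart X Y * S).trace := by
  have h2 : (Xᵀ * Y * S).trace = (Yᵀ * X * S).trace := by
    rw [← Matrix.trace_transpose, Matrix.transpose_mul, Matrix.transpose_mul,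
      Matrix.transpose_transpose, hS, Matrix.trace_mul_comm]
  rw [inner_def, symPart, Matrix.smul_mul, Matrix.trace_smul, Matrix.add_mul, Matrix.trace_add,
    h2, ← Matrix.mul_assoc, smul_eq_mul]
  ring

lemma inner_tangent_mul_sym {X u : Mat n r} (hu : u ∈ tangent X)
    {S : Matrix (Fin r) (Fin r) ℝ} (hS : Sᵀ = S) : inner ℝ u (X * S) = 0 := by
  rw [inner_mul_sym X u hS, mem_tangent_iff.1 hu]; simp

lemma inner_projT_of_tangent {X u : Mat n r} (hu : u ∈ tangent X) (Y : Mat n r) :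
    inner ℝ u (projT X Y) = inner ℝ u Y := by
  rw [projT_eq, inner_sub_right, inner_tangent_mul_sym hu (symPart_transpose X Y), sub_zero]

lemma norm_projT_le {X : Mat n r} (hX : X ∈ stiefel n r) (Y : Mat n r) :
    ‖projT X Y‖ ≤ ‖Y‖ := by
  have h := inner_projT_of_tangent (projT_mem_tangent hX Y) Y
  rw [real_inner_self_eq_norm_sq] at h
  have h2 := real_inner_le_norm (projT X Y) Y
  rcases (norm_nonneg (projT X Y)).eq_or_lt with h0 | h0
  · rw [← h0]; exact norm_nonneg _
  · nlinarith

/-- Dependence of the projection on the base point. -/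
lemma norm_projT_sub_projT_le {X Z : Mat n r} (hX : X ∈ stiefel n r) (hZ : Z ∈ stiefel n r)
    (Y : Mat n r) : ‖projT X Y - projT Z Y‖ ≤ 2 * ‖X - Z‖ * ‖Y‖ := by
  have h : projT X Y - projT Z Y = -((X - Z) * symPart X Y + Z * symPart (X - Z) Y) := by
    have : symPart (X - Z) Y = symPart X Y - symPart Z Y := by
      simp only [symPart, Matrix.transpose_sub, Matrix.sub_mul, Matrix.mul_sub, ← smul_sub]
      congr 1; abel
    rw [projT_eq, projT_eq, this, Matrix.sub_mul, Matrix.mul_sub]; abel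
  rw [h, norm_neg]
  have h1 := norm_add_le ((X - Z) * symPart X Y) (Z * symPart (X - Z) Y)
  have h2 := Matrix.frobenius_norm_mul (X - Z) (symPart X Y)
  have h3 := norm_symPart_le hX Y
  have h4 := norm_symPart_le_of_mul (X - Z) Y
  rw [norm_mul_left_of_mem hZ] at h1
  have := mul_le_mul_of_nonneg_left h3 (norm_nonneg (X - Z))
  linarith

/-! ### Polar factors -/

/-- `H` is symmetric with `H ≥ c`, in the form in which it is used. -/
def SymGE (n : ℕ) {r : ℕ} (c : ℝ) (H : Matrix (Fin r) (Fin r) ℝ) : Prop :=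
  Hᵀ = H ∧ ∀ D : Mat n r, c * ‖D‖ ^ 2 ≤ inner ℝ D (D * H)

/-- The two diagonal terms both equal tr H because R and S have orthonormal columns, and the two
cross terms agree because H is symmetric. -/
lemma inner_polar_aux {R S : Mat n r} (hR : R ∈ stiefel n r) (hS : S ∈ stiefel n r)
    {H : Matrix (Fin r) (Fin r) ℝ} (hH : Hᵀ = H) :
    inner ℝ (R - S) ((R - S) * H) = 2 * inner ℝ (R - S) (R * H) := by
  have h1 : inner ℝ (R * H) (R - S) = inner ℝ (R - S) (R * H) := real_inner_comm _ _
  have e1 : inner ℝ S (S * H) = inner ℝ R (R * H) := by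
    rw [inner_mul_sym _ _ hH, inner_mul_sym _ _ hH, symPart_self hR, symPart_self hS]
  have e2 : inner ℝ R (S * H) = inner ℝ S (R * H) := by
    rw [inner_mul_sym _ _ hH, inner_mul_sym _ _ hH]
    simp [symPart, add_comm]
  rw [Matrix.sub_mul, inner_sub_right, inner_sub_left, inner_sub_left, e1, e2]
  ring

/-- By `inner_polar_aux` for H and for K, the pairing of R - S with R H - S K is the average of the
two quadratic forms of R - S in H and K, hence at least c ‖R - S‖²; Cauchy–Schwarz concludes. With c
= 1 this is nonexpansiveness. -/
lemma polar_lipschitz {R S : Mat n r} (hR : R ∈ stiefel n r) (hS : S ∈ stiefel n r)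
    {H K : Matrix (Fin r) (Fin r) ℝ} {c : ℝ} (hH : SymGE n c H) (hK : SymGE n c K) :
    c * ‖R - S‖ ≤ ‖R * H - S * K‖ := by
  have h1 := inner_polar_aux hR hS hH.1
  have h2 := inner_polar_aux hS hR hK.1
  have h3 : inner ℝ (R - S) ((R - S) * K) = inner ℝ (S - R) ((S - R) * K) := by
    rw [← neg_sub S R, Matrix.neg_mul, inner_neg_neg]
  have h4 : inner ℝ (S - R) (S * K) = - inner ℝ (R - S) (S * K) := by
    rw [← neg_sub R S, inner_neg_left]
  have h5 := hH.2 (R - S)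
  have h6 := hK.2 (R - S)
  have h7 : c * ‖R - S‖ ^ 2 ≤ inner ℝ (R - S) (R * H - S * K) := by
    rw [inner_sub_right]; linarith
  have h8 := real_inner_le_norm (R - S) (R * H - S * K)
  rcases (norm_nonneg (R - S)).eq_or_lt with h0 | h0
  · rw [← h0, mul_zero]; exact norm_nonneg _
  · nlinarith

lemma symGE_one : SymGE n 1 (1 : Matrix (Fin r) (Fin r) ℝ) :=
  ⟨by simp, fun D => by rw [Matrix.mul_one, real_inner_self_eq_norm_sq, one_mul]⟩

/-- A small perturbation of the identity. -/
lemma symGE_of_norm_sub_one_le {H : Matrix (Fin r) (Fin r) ℝ} (hH : Hᵀ = H) {η : ℝ}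
    (h : ‖H - 1‖ ≤ η) : SymGE n (1 - η) H := by
  refine ⟨hH, fun D => ?_⟩
  have h1 : inner ℝ D (D * H) = ‖D‖ ^ 2 + inner ℝ D (D * (H - 1)) := by
    rw [Matrix.mul_sub, Matrix.mul_one, inner_sub_right, real_inner_self_eq_norm_sq]; ring
  have h2 := abs_le.1 (abs_real_inner_le_norm D (D * (H - 1)))
  have h3 := Matrix.frobenius_norm_mul D (H - 1)
  have h4 := mul_le_mul_of_nonneg_left h (norm_nonneg D)
  have h5 : ‖D‖ * ‖D * (H - 1)‖ ≤ ‖D‖ * (‖D‖ * η) :=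
    mul_le_mul_of_nonneg_left (h3.trans h4) (norm_nonneg D)
  rw [h1]; nlinarith [h2.1]

/-- The polar retraction is a polar factor of `X + v`. -/
lemma polarRetraction_spec {X v : Mat n r} (hX : X ∈ stiefel n r) (hv : v ∈ tangent X) :
    polarRetraction X v ∈ stiefel n r ∧ ∃ H : Matrix (Fin r) (Fin r) ℝ,
      SymGE n 1 H ∧ X + v = polarRetraction X v * H := by
  have hB : ((1 + vᵀ * v) - 1).PosSemidef := by
    rw [add_sub_cancel_left, ← Matrix.conjTranspose_eq_transpose_of_trivial]
    exact Matrix.posSemidef_conjTranspose_mul_self v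
  -- Tangency cancels the cross terms, so the Gram matrix of X + v is exactly the matrix whose
  -- inverse square root enters the retraction.
  have hZ : (X + v)ᵀ * (X + v) = 1 + vᵀ * v := by
    have h1 : Xᵀ * X = 1 := hX
    have h2 : Xᵀ * v + vᵀ * X = 0 := hv
    rw [Matrix.transpose_add, Matrix.add_mul, Matrix.mul_add, Matrix.mul_add, h1,
      eq_neg_of_add_eq_zero_left h2]
    abel
  obtain ⟨K, hK, hK1, hC, hCK, hCBC⟩ := exists_sqrt_factor hB
  refine ⟨?_, K, ⟨hK, fun D => ?_⟩, ?_⟩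
  · change (polarRetraction X v)ᵀ * polarRetraction X v = 1
    rw [polarRetraction, Matrix.transpose_mul, hC, Matrix.mul_assoc, ← Matrix.mul_assoc _ (X + v),
      hZ, ← Matrix.mul_assoc, hCBC]
  -- D (K - 1) Dᵀ is positive semidefinite, and its trace is the quadratic form of D in K minus
  -- ‖D‖².
  · have h := (hK1.mul_mul_conjTranspose_same D).trace_nonneg
    rw [Matrix.conjTranspose_eq_transpose_of_trivial, Matrix.trace_mul_comm, Matrix.mul_sub,
      Matrix.mul_sub, Matrix.trace_sub, Matrix.mul_one, ← inner_def, ← inner_def,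
      real_inner_self_eq_norm_sq] at h
    linarith
  · rw [polarRetraction, Matrix.mul_assoc, hCK, Matrix.mul_one]

lemma polarRetraction_mem {X v : Mat n r} (hX : X ∈ stiefel n r) (hv : v ∈ tangent X) :
    polarRetraction X v ∈ stiefel n r := (polarRetraction_spec hX hv).1

/-- The polar retraction does not increase the distance to points of the manifold. -/
lemma norm_polarRetraction_sub_le {X v Q : Mat n r} (hX : X ∈ stiefel n r) (hv : v ∈ tangent X)
    (hQ : Q ∈ stiefel n r) : ‖polarRetraction X v - Q‖ ≤ ‖X + v - Q‖ := by
  obtain ⟨hR, H, hH, hZ⟩ := polarRetraction_spec hX hv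
  have := polar_lipschitz hR hQ hH symGE_one
  rwa [one_mul, Matrix.mul_one, ← hZ] at this

/-- The polar retraction is a nonexpansive function of `X + v`. -/
lemma norm_polarRetraction_sub_polarRetraction_le {X v Z w : Mat n r} (hX : X ∈ stiefel n r)
    (hv : v ∈ tangent X) (hZ : Z ∈ stiefel n r) (hw : w ∈ tangent Z) :
    ‖polarRetraction X v - polarRetraction Z w‖ ≤ ‖(X + v) - (Z + w)‖ := by
  obtain ⟨hR, H, hH, h1⟩ := polarRetraction_spec hX hv
  obtain ⟨hS, K, hK, h2⟩ := polarRetraction_spec hZ hw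
  have := polar_lipschitz hR hS hH hK
  rwa [one_mul, ← h1, ← h2] at this

end Geometry

/-! ### Root mean squares of families -/

section RootMeanSquare

variable {N : ℕ} {E : Type*} [SeminormedAddCommGroup E]

/-- The root mean square `√((1/N) ∑ ‖U_i‖²)` of a family. -/
def rms (U : Fin N → E) : ℝ := √((N : ℝ)⁻¹ * ∑ i, ‖U i‖ ^ 2)

lemma rms_nonneg (U : Fin N → E) : 0 ≤ rms U := Real.sqrt_nonneg _

lemma rms_sq (U : Fin N → E) : rms U ^ 2 = (N : ℝ)⁻¹ * ∑ i, ‖U i‖ ^ 2 :=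
  Real.sq_sqrt (mul_nonneg (by positivity) (Finset.sum_nonneg fun _ _ => sq_nonneg _))

lemma rms_eq_norm (U : Fin N → E) : rms U = √((N : ℝ)⁻¹) * ‖WithLp.toLp 2 U‖ := by
  rw [rms, Real.sqrt_mul (by positivity), PiLp.norm_eq_of_L2]

lemma rms_add_le (U V : Fin N → E) : rms (fun i => U i + V i) ≤ rms U + rms V := by
  rw [rms_eq_norm, rms_eq_norm, rms_eq_norm, ← mul_add]
  exact mul_le_mul_of_nonneg_left (norm_add_le (WithLp.toLp 2 U) (WithLp.toLp 2 V))
    (Real.sqrt_nonneg _)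

lemma rms_neg (U : Fin N → E) : rms (fun i => -U i) = rms U := by simp [rms]

lemma rms_sub_le (U V : Fin N → E) : rms (fun i => U i - V i) ≤ rms U + rms V := by
  simpa only [sub_eq_add_neg, rms_neg] using rms_add_le U fun i => -V i

lemma rms_mono {E' : Type*} [SeminormedAddCommGroup E'] {U : Fin N → E} {V : Fin N → E'}
    (h : ∀ i, ‖U i‖ ≤ ‖V i‖) : rms U ≤ rms V :=
  Real.sqrt_le_sqrt (mul_le_mul_of_nonneg_left
    (Finset.sum_le_sum fun i _ => pow_le_pow_left₀ (norm_nonneg _) (h i) 2) (by positivity))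

lemma rms_norm (U : Fin N → E) : rms (fun i => ‖U i‖) = rms U := by simp [rms]

lemma rms_mul_left (c : ℝ) (hc : 0 ≤ c) (U : Fin N → ℝ) :
    rms (fun i => c * U i) = c * rms U := by
  simp only [rms, norm_mul, mul_pow, ← Finset.mul_sum]
  rw [← mul_assoc, mul_comm _ (‖c‖ ^ 2), mul_assoc, Real.sqrt_mul (sq_nonneg _),
    Real.sqrt_sq (norm_nonneg _), Real.norm_of_nonneg hc]

lemma rms_const [NeZero N] (x : E) : rms (fun _ : Fin N => x) = ‖x‖ := by
  have : (N : ℝ) ≠ 0 := Nat.cast_ne_zero.2 (NeZero.ne N)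
  simp [rms, ← mul_assoc, inv_mul_cancel₀ this]

lemma rms_le_of_forall [NeZero N] {U : Fin N → E} {c : ℝ} (hc : 0 ≤ c) (h : ∀ i, ‖U i‖ ≤ c) :
    rms U ≤ c :=
  calc rms U ≤ rms (fun _ : Fin N => c) := rms_mono fun i => by
        rw [Real.norm_of_nonneg hc]; exact h i
    _ = c := by rw [rms_const, Real.norm_of_nonneg hc]

lemma mean_mul_le (a b : Fin N → ℝ) :
    (N : ℝ)⁻¹ * ∑ i, a i * b i ≤ rms a * rms b := by
  have h := Finset.sum_mul_sq_le_sq_mul_sq Finset.univ a b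
  have h1 : ((N : ℝ)⁻¹ * ∑ i, a i * b i) ^ 2 ≤ (rms a * rms b) ^ 2 := by
    rw [mul_pow, mul_pow, rms_sq, rms_sq]
    simp only [Real.norm_eq_abs, sq_abs]
    have := mul_le_mul_of_nonneg_left h (sq_nonneg (N : ℝ)⁻¹)
    nlinarith
  exact (abs_le_of_sq_le_sq' h1 (mul_nonneg (rms_nonneg _) (rms_nonneg _))).2

lemma mean_norm_le_rms [NeZero N] (U : Fin N → E) : (N : ℝ)⁻¹ * ∑ i, ‖U i‖ ≤ rms U := by
  have h := mean_mul_le (fun i => ‖U i‖) (fun _ : Fin N => (1 : ℝ))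
  simpa [rms_norm, rms_const] using h

variable [NormedSpace ℝ E]

/-- The mean `(1/N) ∑ U_i` of a family. -/
def mean (U : Fin N → E) : E := (N : ℝ)⁻¹ • ∑ i, U i

lemma rms_smul (c : ℝ) (U : Fin N → E) : rms (fun i => c • U i) = |c| * rms U := by
  rw [← rms_norm]
  simp only [norm_smul, Real.norm_eq_abs]
  rw [rms_mul_left _ (abs_nonneg c), rms_norm]

lemma norm_mean_le (U : Fin N → E) : ‖mean U‖ ≤ (N : ℝ)⁻¹ * ∑ i, ‖U i‖ := by
  rw [mean, norm_smul, Real.norm_of_nonneg (by positivity)]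
  exact mul_le_mul_of_nonneg_left (norm_sum_le _ _) (by positivity)

lemma norm_mean_le_rms [NeZero N] (U : Fin N → E) : ‖mean U‖ ≤ rms U :=
  (norm_mean_le U).trans (mean_norm_le_rms U)

lemma mean_add (U V : Fin N → E) : mean (fun i => U i + V i) = mean U + mean V := by
  simp [mean, Finset.sum_add_distrib]

lemma mean_sub (U V : Fin N → E) : mean (fun i => U i - V i) = mean U - mean V := by
  simp [mean, Finset.sum_sub_distrib, smul_sub]

lemma mean_smul (c : ℝ) (U : Fin N → E) : mean (fun i => c • U i) = c • mean U := by
  simp [mean, ← Finset.smul_sum, smul_comm c]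

lemma mean_const [NeZero N] (x : E) : mean (fun _ : Fin N => x) = x := by
  have : (N : ℝ) ≠ 0 := Nat.cast_ne_zero.2 (NeZero.ne N)
  simp only [mean, Finset.sum_const, Finset.card_univ, Fintype.card_fin]
  rw [← Nat.cast_smul_eq_nsmul ℝ, smul_smul, inv_mul_cancel₀ this, one_smul]

end RootMeanSquare

/-- The mean squared deviation splits off the mean. -/
lemma rms_sq_eq_mean_add {N : ℕ} [NeZero N] {E : Type*} [NormedAddCommGroup E]
    [InnerProductSpace ℝ E] (U : Fin N → E) :
    rms U ^ 2 = ‖mean U‖ ^ 2 + rms (fun i => U i - mean U) ^ 2 := by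
  have hN : (N : ℝ) ≠ 0 := Nat.cast_ne_zero.2 (NeZero.ne N)
  have h1 : ∀ i, ‖U i - mean U‖ ^ 2 = ‖U i‖ ^ 2 - 2 * inner ℝ (U i) (mean U) + ‖mean U‖ ^ 2 :=
    fun i => norm_sub_sq_real _ _
  have h2 : ∑ i, U i = (N : ℝ) • mean U := by
    rw [mean, smul_smul, mul_inv_cancel₀ hN, one_smul]
  rw [rms_sq, rms_sq]
  simp only [h1, Finset.sum_add_distrib, Finset.sum_sub_distrib, ← Finset.mul_sum]
  rw [← sum_inner, h2, inner_smul_left, real_inner_self_eq_norm_sq]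
  simp
  field_simp
  ring

section Mean

attribute [local instance] Matrix.frobeniusNormedAddCommGroup Matrix.frobeniusNormedSpace
  frobeniusInnerProductSpace

variable {n r N : ℕ}

lemma mean_apply (U : Fin N → Mat n r) (a : Fin n) (b : Fin r) :
    mean U a b = (N : ℝ)⁻¹ * ∑ i, U i a b := by
  simp [mean, Matrix.sum_apply]

lemma mean_projT (X : Mat n r) (U : Fin N → Mat n r) :
    mean (fun i => projT X (U i)) = projT X (mean U) := by
  simp only [mean, projT_smul, projT_sum]

lemma mean_symPart (X : Mat n r) (U : Fin N → Mat n r) :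
    mean (fun i => symPart X (U i)) = symPart X (mean U) := by
  let f : Mat n r →ₗ[ℝ] Matrix (Fin r) (Fin r) ℝ :=
    { toFun := symPart X, map_add' := symPart_add X, map_smul' := fun c Y => symPart_smul X Y c }
  change _ = f (mean U)
  rw [mean, mean, map_smul, map_sum]; rfl

/-! ### The induced arithmetic mean -/

lemma isCompact_stiefel (n r : ℕ) : IsCompact (stiefel n r) := by
  have hcl : IsClosed (stiefel n r) :=
    isClosed_eq (Continuous.matrix_mul (Continuous.matrix_transpose continuous_id) continuous_id)
      continuous_const
  have : FiniteDimensional ℝ (Mat n r) := inferInstance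
  have : ProperSpace (Mat n r) := FiniteDimensional.proper ℝ (Mat n r)
  refine Metric.isCompact_of_isClosed_isBounded hcl ?_
  refine (Metric.isBounded_closedBall (x := (0 : Mat n r))
    (r := ‖(1 : Matrix (Fin r) (Fin r) ℝ)‖)).subset fun X hX => ?_
  rw [mem_closedBall_zero_iff]
  have := norm_mul_left_of_mem hX (1 : Matrix (Fin r) (Fin r) ℝ)
  rw [Matrix.mul_one] at this
  exact this.le

lemma exists_isIAM (h : (stiefel n r).Nonempty) (X : Fin N → Mat n r) : ∃ Y, IsIAM X Y := by
  obtain ⟨Y, hY, hmin⟩ := (isCompact_stiefel n r).exists_isMinOn h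
    (f := fun Z => ∑ i, ‖Z - X i‖ ^ 2) (by fun_prop)
  exact ⟨Y, hY, fun Z hZ => hmin hZ⟩

lemma isIAM_iam (h : (stiefel n r).Nonempty) (X : Fin N → Mat n r) : IsIAM X (iam X) :=
  Classical.epsilon_spec (exists_isIAM h X)

/-- The consensus error `‖𝐗 - 𝐗̂‖ / √N`. -/
def consErr (X : Fin N → Mat n r) : ℝ := rms fun i => X i - iam X

lemma consErr_nonneg (X : Fin N → Mat n r) : 0 ≤ consErr X := rms_nonneg _

lemma consErr_sq (X : Fin N → Mat n r) : consErr X ^ 2 = (N : ℝ)⁻¹ * consensusSq X := rms_sq _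

lemma IsIAM.rms_le {X : Fin N → Mat n r} {Y Z : Mat n r} (h : IsIAM X Y)
    (hZ : Z ∈ stiefel n r) : rms (fun i => X i - Y) ≤ rms (fun i => X i - Z) := by
  have := h.2 Z hZ
  simp only [rms, norm_sub_rev (X _)]
  exact Real.sqrt_le_sqrt (mul_le_mul_of_nonneg_left this (by positivity))

variable [NeZero N]

/-- Sums of squared distances to the agents differ from N times the squared distance to their
Euclidean mean by a constant, so the induced mean is a nearest point of the manifold to the
Euclidean mean. -/
lemma IsIAM.norm_mean_sub_le {X : Fin N → Mat n r} {Y Z : Mat n r} (h : IsIAM X Y)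
    (hZ : Z ∈ stiefel n r) : ‖Y - mean X‖ ≤ ‖Z - mean X‖ := by
  have key : ∀ Z : Mat n r, rms (fun i => X i - Z) ^ 2
      = ‖Z - mean X‖ ^ 2 + rms (fun i => X i - mean X) ^ 2 := fun Z => by
    have h1 : mean (fun i => X i - Z) = mean X - Z := by rw [mean_sub, mean_const]
    rw [rms_sq_eq_mean_add, h1, norm_sub_rev]
    simp only [sub_sub_sub_cancel_right]
  have h1 := pow_le_pow_left₀ (rms_nonneg _) (h.rms_le hZ) 2
  rw [key Y, key Z] at h1
  exact abs_le_of_sq_le_sq' (by linarith) (norm_nonneg _) |>.2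

/-- First-order optimality of the induced arithmetic mean. -/
lemma IsIAM.projT_mean {M : ℝ} (hM : IsRetractionConst n r M) {X : Fin N → Mat n r}
    {Y : Mat n r} (h : IsIAM X Y) : projT Y (mean X) = 0 := by
  by_contra hne
  set v := projT Y (mean X) with hv
  have hvt : v ∈ tangent Y := projT_mem_tangent h.1 _
  have hV : 0 < ‖v‖ ^ 2 := by positivity
  have hM0 := hM.1
  have hin : inner ℝ (Y - mean X) v = -‖v‖ ^ 2 := by
    have h1 : inner ℝ v Y = 0 := by
      have := inner_tangent_mul_sym hvt (S := 1) (by simp)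
      rwa [Matrix.mul_one] at this
    have h2 : inner ℝ v (mean X) = ‖v‖ ^ 2 := by
      rw [← inner_projT_of_tangent hvt, ← hv, real_inner_self_eq_norm_sq]
    rw [inner_sub_left, real_inner_comm, h1, real_inner_comm, h2, zero_sub]
  set d := ‖Y - mean X‖ with hd
  have hd0 : 0 ≤ d := norm_nonneg _
  -- Moving from Y by τ v changes the squared distance to the mean by at most -2 τ ‖v‖² + τ² ‖v‖² C
  -- for τ ≤ 1, retraction error included; τ = 1 / C makes this negative unless v = 0.
  set C := 1 + 2 * (d + ‖v‖) * M + M ^ 2 * ‖v‖ ^ 2 with hC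
  have hC1 : 1 ≤ C := by
    have : 0 ≤ 2 * (d + ‖v‖) * M := by positivity
    have : 0 ≤ M ^ 2 * ‖v‖ ^ 2 := by positivity
    linarith
  have hCp : 0 < C := by linarith
  set τ := 1 / C with hτ
  have hτ0 : 0 < τ := by positivity
  have hτ1 : τ ≤ 1 := (div_le_one hCp).2 hC1
  have hτv := tangent_smul hvt τ
  have hmin := h.norm_mean_sub_le (polarRetraction_mem h.1 hτv)
  set R := polarRetraction Y (τ • v)
  have hR := hM.2 Y h.1 _ hτv
  rw [norm_smul, Real.norm_of_nonneg hτ0.le] at hR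
  set ρ := R - (Y + τ • v) with hρ
  have hdec : R - mean X = (Y - mean X) + τ • v + ρ := by rw [hρ]; abel
  have hsq := pow_le_pow_left₀ hd0 hmin 2
  have e1 : ‖(Y - mean X) + τ • v‖ ^ 2 = d ^ 2 - 2 * τ * ‖v‖ ^ 2 + τ ^ 2 * ‖v‖ ^ 2 := by
    rw [norm_add_sq_real, inner_smul_right, hin, norm_smul, Real.norm_of_nonneg hτ0.le]; ring
  have e2 : ‖(Y - mean X) + τ • v‖ ≤ d + ‖v‖ := by
    refine (norm_add_le _ _).trans ?_
    rw [norm_smul, Real.norm_of_nonneg hτ0.le]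
    nlinarith [norm_nonneg v]
  have e3 : ‖R - mean X‖ ^ 2 ≤ ‖(Y - mean X) + τ • v‖ ^ 2 + 2 * ((d + ‖v‖) * ‖ρ‖) + ‖ρ‖ ^ 2 := by
    rw [hdec, norm_add_sq_real]
    have := real_inner_le_norm ((Y - mean X) + τ • v) ρ
    have := mul_le_mul_of_nonneg_right e2 (norm_nonneg ρ)
    linarith
  have e4 : (d + ‖v‖) * ‖ρ‖ ≤ (d + ‖v‖) * (M * (τ * ‖v‖) ^ 2) :=
    mul_le_mul_of_nonneg_left hR (by positivity)
  have e5 : ‖ρ‖ ^ 2 ≤ M ^ 2 * τ ^ 2 * ‖v‖ ^ 4 := by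
    have := pow_le_pow_left₀ (norm_nonneg ρ) hR 2
    have h4 : (M * (τ * ‖v‖) ^ 2) ^ 2 = M ^ 2 * τ ^ 4 * ‖v‖ ^ 4 := by ring
    have h5 : τ ^ 4 ≤ τ ^ 2 := pow_le_pow_of_le_one hτ0.le hτ1 (by norm_num)
    rw [h4] at this
    refine this.trans ?_
    gcongr
  have e6 : 2 * τ * ‖v‖ ^ 2 ≤ τ * ‖v‖ ^ 2 * (τ * C) := by
    rw [hC]; nlinarith
  have e7 : τ * C = 1 := by rw [hτ]; field_simp
  rw [e7] at e6
  have : 0 < τ * ‖v‖ ^ 2 := by positivity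
  linarith

/-- Two points of the manifold differ by a tangential displacement up to second order; all later
quadratic corrections come from this identity. -/
lemma symPart_eq_one_sub {X Z : Mat n r} (hX : X ∈ stiefel n r) (hZ : Z ∈ stiefel n r) :
    symPart X Z = 1 - (1 / 2 : ℝ) • ((X - Z)ᵀ * (X - Z)) := by
  have h1 : Xᵀ * X = 1 := hX
  have h2 : Zᵀ * Z = 1 := hZ
  rw [symPart, Matrix.transpose_sub, Matrix.sub_mul, Matrix.mul_sub, Matrix.mul_sub, h1, h2]
  module

/-- The mean of the agents is `X̂ H` with `H` symmetric and close to the identity. -/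
lemma IsIAM.exists_factor {M : ℝ} (hM : IsRetractionConst n r M) {X : Fin N → Mat n r}
    (hX : ∀ i, X i ∈ stiefel n r) {Y : Mat n r} (h : IsIAM X Y) :
    ∃ H : Matrix (Fin r) (Fin r) ℝ, Hᵀ = H ∧ mean X = Y * H ∧
      ‖H - 1‖ ≤ rms (fun i => X i - Y) ^ 2 / 2 := by
  refine ⟨symPart Y (mean X), symPart_transpose _ _, ?_, ?_⟩
  · have := h.projT_mean hM
    rw [projT_eq] at this
    exact sub_eq_zero.1 this
  · have h1 : symPart Y (mean X) - 1 = mean (fun i => symPart Y (X i) - 1) := by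
      rw [mean_sub, mean_const, mean_symPart]
    rw [h1]
    refine (norm_mean_le _).trans ?_
    rw [rms_sq, mul_div_assoc, Finset.sum_div]
    refine mul_le_mul_of_nonneg_left (Finset.sum_le_sum fun i _ => ?_) (by positivity)
    rw [symPart_eq_one_sub h.1 (hX i), sub_sub_cancel_left, norm_neg, norm_smul]
    have := Matrix.frobenius_norm_mul (Y - X i)ᵀ (Y - X i)
    rw [Matrix.frobenius_norm_transpose, norm_sub_rev] at this
    rw [Real.norm_of_nonneg (by norm_num)]
    nlinarith

/-- The Euclidean mean leaves the manifold only in the normal direction Y (H - 1), whose size is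
quadratic in the consensus error. -/
lemma IsIAM.norm_mean_sub_le_sq {M : ℝ} (hM : IsRetractionConst n r M) {X : Fin N → Mat n r}
    (hX : ∀ i, X i ∈ stiefel n r) {Y : Mat n r} (h : IsIAM X Y) :
    ‖mean X - Y‖ ≤ rms (fun i => X i - Y) ^ 2 / 2 := by
  obtain ⟨H, -, h2, h3⟩ := h.exists_factor hM hX
  have : mean X - Y = Y * (H - 1) := by rw [h2, Matrix.mul_sub, Matrix.mul_one]
  rwa [this, norm_mul_left_of_mem h.1]

/-- The induced arithmetic mean is a Lipschitz function of the mean. -/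
lemma IsIAM.lipschitz {M : ℝ} (hM : IsRetractionConst n r M) {X X' : Fin N → Mat n r}
    (hX : ∀ i, X i ∈ stiefel n r) (hX' : ∀ i, X' i ∈ stiefel n r) {Y Y' : Mat n r}
    (h : IsIAM X Y) (h' : IsIAM X' Y') {η : ℝ} (hη : rms (fun i => X i - Y) ^ 2 / 2 ≤ η)
    (hη' : rms (fun i => X' i - Y') ^ 2 / 2 ≤ η) :
    (1 - η) * ‖Y - Y'‖ ≤ ‖mean X - mean X'‖ := by
  obtain ⟨H, h1, h2, h3⟩ := h.exists_factor hM hX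
  obtain ⟨H', h1', h2', h3'⟩ := h'.exists_factor hM hX'
  rw [h2, h2']
  exact polar_lipschitz h.1 h'.1 (symGE_of_norm_sub_one_le h1 (h3.trans hη))
    (symGE_of_norm_sub_one_le h1' (h3'.trans hη'))

end Mean

/-! ### Mixing matrices -/

section Mixing

variable {N : ℕ}

/-- Symmetric stochastic matrices. -/
structure IsDoublyStochastic (w : Matrix (Fin N) (Fin N) ℝ) : Prop where
  nonneg : ∀ i j, 0 ≤ w i j
  row_sum : ∀ i, ∑ j, w i j = 1
  symm : wᵀ = w

lemma IsDoublyStochastic.col_sum {w : Matrix (Fin N) (Fin N) ℝ} (hw : IsDoublyStochastic w)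
    (j : Fin N) : ∑ i, w i j = 1 := by
  rw [← hw.row_sum j]
  exact Finset.sum_congr rfl fun i _ => congrFun (congrFun hw.symm j) i

lemma IsMixingMatrix.isDoublyStochastic {𝒢 : SimpleGraph (Fin N)}
    {W : Matrix (Fin N) (Fin N) ℝ} (hW : IsMixingMatrix 𝒢 W) : IsDoublyStochastic W where
  nonneg i j := by
    by_cases h : 𝒢.Adj i j ∨ i = j
    · exact (hW.pos i j h).le
    · exact (hW.zero i j h).ge
  row_sum := hW.row_sum
  symm := hW.symm

lemma IsDoublyStochastic.pow {W : Matrix (Fin N) (Fin N) ℝ} (hW : IsDoublyStochastic W) (t : ℕ) :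
    IsDoublyStochastic (W ^ t) := by
  induction t with
  | zero =>
    refine ⟨fun i j => ?_, fun i => ?_, by simp⟩
    · rw [pow_zero, Matrix.one_apply]; split_ifs <;> norm_num
    · simp [Matrix.one_apply]
  | succ t ih =>
    refine ⟨fun i j => ?_, fun i => ?_, by rw [Matrix.transpose_pow, hW.symm]⟩
    · rw [pow_succ, Matrix.mul_apply]
      exact Finset.sum_nonneg fun k _ => mul_nonneg (ih.nonneg _ _) (hW.nonneg _ _)
    · simp only [pow_succ, Matrix.mul_apply]
      rw [Finset.sum_comm]
      simp only [← Finset.mul_sum, hW.row_sum, mul_one, ih.row_sum]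

section Family

variable {E : Type*} [NormedAddCommGroup E] [NormedSpace ℝ E]

/-- One round of mixing of the agents' variables. -/
def mix (w : Matrix (Fin N) (Fin N) ℝ) (U : Fin N → E) (i : Fin N) : E := ∑ j, w i j • U j

lemma mean_mix {w : Matrix (Fin N) (Fin N) ℝ} (hw : IsDoublyStochastic w) (U : Fin N → E) :
    mean (mix w U) = mean U := by
  simp only [mean, mix]
  rw [Finset.sum_comm]
  simp only [← Finset.sum_smul, hw.col_sum, one_smul]

lemma mix_sub (w : Matrix (Fin N) (Fin N) ℝ) (U V : Fin N → E) (i : Fin N) :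
    mix w (fun i => U i - V i) i = mix w U i - mix w V i := by
  simp [mix, smul_sub]

lemma mix_add (w : Matrix (Fin N) (Fin N) ℝ) (U V : Fin N → E) (i : Fin N) :
    mix w (fun i => U i + V i) i = mix w U i + mix w V i := by
  simp [mix, Finset.sum_add_distrib]

lemma mix_const {w : Matrix (Fin N) (Fin N) ℝ} (hw : IsDoublyStochastic w) (x : E) (i : Fin N) :
    mix w (fun _ => x) i = x := by
  simp [mix, ← Finset.sum_smul, hw.row_sum]

lemma norm_mix_le {w : Matrix (Fin N) (Fin N) ℝ} (hw : IsDoublyStochastic w) (U : Fin N → E)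
    (i : Fin N) : ‖mix w U i‖ ≤ mix w (fun j => ‖U j‖) i := by
  refine (norm_sum_le _ _).trans (Finset.sum_le_sum fun j _ => ?_)
  rw [norm_smul, Real.norm_of_nonneg (hw.nonneg i j), smul_eq_mul]

lemma norm_mix_le_of_forall {w : Matrix (Fin N) (Fin N) ℝ} (hw : IsDoublyStochastic w)
    {U : Fin N → E} {c : ℝ} (hU : ∀ i, ‖U i‖ ≤ c) (i : Fin N) : ‖mix w U i‖ ≤ c := by
  refine (norm_mix_le hw U i).trans ?_
  calc mix w (fun j => ‖U j‖) i ≤ ∑ j, w i j * c :=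
        Finset.sum_le_sum fun j _ => mul_le_mul_of_nonneg_left (hU j) (hw.nonneg i j)
    _ = c := by rw [← Finset.sum_mul, hw.row_sum, one_mul]

lemma rms_mix_le {w : Matrix (Fin N) (Fin N) ℝ} (hw : IsDoublyStochastic w) (U : Fin N → E) :
    rms (mix w U) ≤ rms U := by
  refine Real.sqrt_le_sqrt (mul_le_mul_of_nonneg_left ?_ (by positivity))
  calc ∑ i, ‖mix w U i‖ ^ 2 ≤ ∑ i, ∑ j, w i j * ‖U j‖ ^ 2 := by
        refine Finset.sum_le_sum fun i _ => ?_
        refine (pow_le_pow_left₀ (norm_nonneg _) (norm_mix_le hw U i) 2).trans ?_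
        have := (convexOn_pow (𝕜 := ℝ) 2).map_sum_le (t := Finset.univ) (w := w i)
          (p := fun j => ‖U j‖) (fun j _ => hw.nonneg i j) (hw.row_sum i)
          (fun j _ => norm_nonneg _)
        simpa [mix] using this
    _ = ∑ j, ‖U j‖ ^ 2 := by
        rw [Finset.sum_comm]
        simp only [← Finset.sum_mul, hw.col_sum, one_mul]

end Family

/-- The averaging matrix. -/
abbrev avgMat (N : ℕ) : Matrix (Fin N) (Fin N) ℝ := Matrix.of fun _ _ => (N : ℝ)⁻¹

lemma sq_sum_mulVec_le {n r : ℕ} (Z : Mat n r) (x : Fin r → ℝ) :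
    ∑ i, (Z *ᵥ x) i ^ 2 ≤ specNorm Z ^ 2 * ∑ j, x j ^ 2 := by
  have h := (Matrix.toEuclideanLin Z).toContinuousLinearMap.le_opNorm (WithLp.toLp 2 x)
  have h2 := pow_le_pow_left₀ (norm_nonneg _) h 2
  rw [mul_pow, EuclideanSpace.norm_sq_eq, EuclideanSpace.norm_sq_eq] at h2
  simpa [specNorm, Matrix.toLpLin_apply] using h2

lemma specNorm_nonneg {n r : ℕ} (Z : Mat n r) : 0 ≤ specNorm Z := norm_nonneg _

/-- By compactness the norm is attained on the unit sphere, so strictness at every vector gives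
strictness of the norm. -/
lemma specNorm_lt_one {n : ℕ} [NeZero n] (Z : Mat n n)
    (h : ∀ x : Fin n → ℝ, x ≠ 0 → ∑ i, (Z *ᵥ x) i ^ 2 < ∑ j, x j ^ 2) : specNorm Z < 1 := by
  set A := (Matrix.toEuclideanLin Z).toContinuousLinearMap with hA
  have hlt : ∀ x : EuclideanSpace ℝ (Fin n), x ≠ 0 → ‖A x‖ < ‖x‖ := fun x hx => by
    have h1 := h x.ofLp (fun h0 => hx (by ext i; exact congrFun h0 i))
    refine lt_of_pow_lt_pow_left₀ 2 (norm_nonneg _) ?_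
    rw [EuclideanSpace.norm_sq_eq, EuclideanSpace.norm_sq_eq]
    simpa [hA, Matrix.toLpLin_apply] using h1
  have hne : (Metric.sphere (0 : EuclideanSpace ℝ (Fin n)) 1).Nonempty :=
    NormedSpace.sphere_nonempty.2 zero_le_one
  obtain ⟨x₀, hx₀, hmax⟩ := (isCompact_sphere (0 : EuclideanSpace ℝ (Fin n)) 1).exists_isMaxOn hne
    (f := fun x => ‖A x‖) (by fun_prop)
  have hx₁ : ‖x₀‖ = 1 := by simpa using hx₀
  refine lt_of_le_of_lt (ContinuousLinearMap.opNorm_le_of_unit_norm (norm_nonneg (A x₀))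
    fun x hx => hmax (by simpa using hx)) ?_
  rw [← hx₁]
  exact hlt x₀ fun h0 => by simp [h0] at hx₁

/-- Jensen's inequality for each row, with its gap ∑_j W_ij (x_j - m - y_i)² kept explicitly. If no
norm is lost, then m = 0 and all gaps vanish; positive diagonal and edge weights make x constant
along edges, connectedness makes it constant, and its mean is zero, so x = 0. -/
lemma IsMixingMatrix.sigma2_lt_one [NeZero N] {𝒢 : SimpleGraph (Fin N)}
    {W : Matrix (Fin N) (Fin N) ℝ} (hW : IsMixingMatrix 𝒢 W) : sigma2 W < 1 := by
  have hN : (N : ℝ) ≠ 0 := Nat.cast_ne_zero.2 (NeZero.ne N)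
  have hds := hW.isDoublyStochastic
  refine specNorm_lt_one _ fun x hx => ?_
  set m := mean x with hm
  have hsum : ∑ j, x j = N * m := by
    rw [hm, mean, smul_eq_mul, ← mul_assoc, mul_inv_cancel₀ hN, one_mul]
  set y : Fin N → ℝ := fun i => ∑ j, W i j * (x j - m) with hy
  have hmul : ∀ i, ((W - Matrix.of fun _ _ => (N : ℝ)⁻¹) *ᵥ x) i = y i := fun i => by
    simp only [hy, Matrix.mulVec, dotProduct, Matrix.sub_apply, Matrix.of_apply, sub_mul, mul_sub,
      Finset.sum_sub_distrib, ← Finset.sum_mul, ← Finset.mul_sum, hW.row_sum, hsum]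
    rw [← mul_assoc, inv_mul_cancel₀ hN]
  simp only [hmul]
  have hrow : ∀ i, y i ^ 2 = ∑ j, W i j * (x j - m) ^ 2 - ∑ j, W i j * (x j - m - y i) ^ 2 := by
    intro i
    have : ∀ j, W i j * (x j - m - y i) ^ 2
        = W i j * (x j - m) ^ 2 - 2 * y i * (W i j * (x j - m)) + y i ^ 2 * W i j := fun j => by
      ring
    simp only [this, Finset.sum_add_distrib, Finset.sum_sub_distrib, ← Finset.mul_sum, hW.row_sum]
    change _ = _ - (_ - 2 * y i * y i + _)
    ring
  have htot : ∑ i, ∑ j, W i j * (x j - m) ^ 2 = ∑ j, x j ^ 2 - N * m ^ 2 := by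
    rw [Finset.sum_comm]
    simp only [← Finset.sum_mul, hds.col_sum, one_mul, sub_sq, Finset.sum_add_distrib,
      Finset.sum_sub_distrib, mul_assoc, ← Finset.mul_sum, hsum]
    simp
    ring
  have hgap : ∀ i j, 0 ≤ W i j * (x j - m - y i) ^ 2 := fun i j =>
    mul_nonneg (hds.nonneg i j) (sq_nonneg _)
  have hgap' : 0 ≤ ∑ i, ∑ j, W i j * (x j - m - y i) ^ 2 :=
    Finset.sum_nonneg fun i _ => Finset.sum_nonneg fun j _ => hgap i j
  simp only [hrow, Finset.sum_sub_distrib, htot]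
  have hm0 : 0 ≤ (N : ℝ) * m ^ 2 := by positivity
  by_contra hcon
  have h1 : N * m ^ 2 = 0 := by linarith
  have h2 : ∑ i, ∑ j, W i j * (x j - m - y i) ^ 2 = 0 := by linarith
  have hm1 : m = 0 := by simpa [hN] using h1
  have h3 : ∀ i j, W i j * (x j - m - y i) ^ 2 = 0 := fun i j => by
    have := (Finset.sum_eq_zero_iff_of_nonneg
      (fun i _ => Finset.sum_nonneg fun j _ => hgap i j)).1 h2 i (Finset.mem_univ i)
    exact (Finset.sum_eq_zero_iff_of_nonneg (fun j _ => hgap i j)).1 this j (Finset.mem_univ j)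
  have h4 : ∀ i j, 𝒢.Adj i j ∨ i = j → x j = y i := fun i j hij => by
    have := (mul_eq_zero.1 (h3 i j)).resolve_left (hW.pos i j hij).ne'
    have := pow_eq_zero_iff (two_ne_zero) |>.1 this
    linarith
  have h5 : ∀ i j, 𝒢.Adj i j → x i = x j := fun i j hij =>
    (h4 i i (Or.inr rfl)).trans (h4 i j (Or.inl hij)).symm
  have h6 : ∀ i j, x i = x j := fun i j => by
    obtain ⟨p⟩ := hW.connected.preconnected i j
    induction p with
    | nil => rfl
    | cons hadj _ ih => exact (h5 _ _ hadj).trans ih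
  refine hx (funext fun i => ?_)
  have h7 : ∑ j, x j = N * x i := by simp [h6 _ i]
  rw [hsum, hm1, mul_zero, eq_comm] at h7
  simpa [hN] using h7

/-- The averaging matrix J satisfies W J = J W = J² = J, so all mixed terms of the power collapse;
this fails for t = 0. -/
lemma IsDoublyStochastic.pow_sub_avgMat [NeZero N] {W : Matrix (Fin N) (Fin N) ℝ}
    (hW : IsDoublyStochastic W) (t : ℕ) (ht : 1 ≤ t) :
    W ^ t - avgMat N = (W - avgMat N) ^ t := by
  have hN : (N : ℝ) ≠ 0 := Nat.cast_ne_zero.2 (NeZero.ne N)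
  have h1 : W * avgMat N = avgMat N := by
    ext i j; simp [Matrix.mul_apply, ← Finset.sum_mul, hW.row_sum]
  have h2 : ∀ t, avgMat N * W ^ t = avgMat N := fun t => by
    ext i j; simp [Matrix.mul_apply, ← Finset.mul_sum, (hW.pow t).col_sum]
  have h3 : avgMat N * avgMat N = avgMat N := by
    ext i j; simp [Matrix.mul_apply, hN]
  induction t, ht using Nat.le_induction with
  | base => simp
  | succ t ht ih =>
    rw [pow_succ' (W - _), ← ih, Matrix.sub_mul, Matrix.mul_sub, Matrix.mul_sub, h1, h2, h3,
      ← pow_succ']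
    abel

lemma sq_sum_pow_mulVec_le {n : ℕ} (Z : Mat n n) (t : ℕ) (x : Fin n → ℝ) :
    ∑ i, ((Z ^ t) *ᵥ x) i ^ 2 ≤ (specNorm Z ^ t) ^ 2 * ∑ j, x j ^ 2 := by
  induction t with
  | zero => simp
  | succ t ih =>
    rw [pow_succ', ← Matrix.mulVec_mulVec]
    refine (sq_sum_mulVec_le Z _).trans ?_
    rw [pow_succ' (specNorm Z) t, mul_pow, mul_assoc]
    exact mul_le_mul_of_nonneg_left ih (sq_nonneg _)

/-- Mixing contracts the deviations from the mean at least by the factor `s`. -/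
structure IsMixing (w : Matrix (Fin N) (Fin N) ℝ) (s : ℝ) : Prop extends IsDoublyStochastic w where
  s_nonneg : 0 ≤ s
  s_le : s ≤ 1 / 2
  sqrt_mul_s_le : √(N : ℝ) * s ≤ 1 / 2
  contract : ∀ x : Fin N → ℝ, ∑ i, ((w - avgMat N) *ᵥ x) i ^ 2 ≤ s ^ 2 * ∑ j, x j ^ 2

lemma IsMixingMatrix.isMixing [NeZero N] {𝒢 : SimpleGraph (Fin N)}
    {W : Matrix (Fin N) (Fin N) ℝ} (hW : IsMixingMatrix 𝒢 W) {t : ℕ} (ht : 1 ≤ t)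
    (ht' : ⌈Real.logb (sigma2 W) (1 / (2 * √(N : ℝ)))⌉₊ ≤ t) :
    IsMixing (W ^ t) (sigma2 W ^ t) := by
  have h0 : 0 ≤ sigma2 W := specNorm_nonneg _
  have h1 := hW.sigma2_lt_one
  have hN : (1 : ℝ) ≤ N := by exact_mod_cast NeZero.one_le (n := N)
  have hN' : 1 ≤ √(N : ℝ) := Real.one_le_sqrt.2 hN
  have hs : sigma2 W ^ t ≤ 1 / (2 * √(N : ℝ)) := by
    -- For σ₂ = 0 the power vanishes because t ≥ 1; otherwise the base is below one and the
    -- logarithm reverses the inequality.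
    rcases h0.eq_or_lt with h | h
    · rw [← h, zero_pow (by omega)]; positivity
    · have h2 : Real.logb (sigma2 W) (1 / (2 * √(N : ℝ))) ≤ t :=
        (Nat.le_ceil _).trans (by exact_mod_cast ht')
      rw [Real.logb_le_iff_le_rpow_of_base_lt_one h h1 (by positivity)] at h2
      simpa using h2
  have hs' : √(N : ℝ) * sigma2 W ^ t ≤ 1 / 2 := by
    calc √(N : ℝ) * sigma2 W ^ t ≤ √(N : ℝ) * (1 / (2 * √(N : ℝ))) := by gcongr
      _ = 1 / 2 := by field_simp
  have h2 : 0 ≤ sigma2 W ^ t := by positivity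
  refine { hW.isDoublyStochastic.pow t with
    s_nonneg := h2, s_le := by nlinarith, sqrt_mul_s_le := hs', contract := fun x => ?_ }
  rw [hW.isDoublyStochastic.pow_sub_avgMat t ht]
  exact sq_sum_pow_mulVec_le _ t x

section Frobenius

attribute [local instance] Matrix.frobeniusNormedAddCommGroup Matrix.frobeniusNormedSpace
  frobeniusInnerProductSpace

variable {n r : ℕ} {w : Matrix (Fin N) (Fin N) ℝ} {s : ℝ}

/-- Mixing acts on each matrix entry separately, so the scalar contraction is summed over the
entries. -/
lemma IsMixing.rms_mix_sub_mean_le [NeZero N] (hw : IsMixing w s) (U : Fin N → Mat n r) :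
    rms (fun i => mix w U i - mean U) ≤ s * rms U := by
  refine le_of_sq_le_sq ?_ (mul_nonneg hw.s_nonneg (rms_nonneg U))
  rw [mul_pow, rms_sq, rms_sq, mul_left_comm]
  refine mul_le_mul_of_nonneg_left ?_ (by positivity)
  have key : ∀ i a b, (mix w U i - mean U) a b = ((w - avgMat N) *ᵥ fun j => U j a b) i := by
    intro i a b
    simp [mix, mean, Matrix.mulVec, dotProduct, Matrix.sum_apply, sub_mul, Finset.mul_sum]
  simp only [frobenius_sq, key]
  have hswap : ∀ g : Fin N → Fin n → Fin r → ℝ,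
      ∑ i, ∑ a, ∑ b, g i a b = ∑ a, ∑ b, ∑ i, g i a b := fun g => by
    rw [Finset.sum_comm]
    exact Finset.sum_congr rfl fun a _ => Finset.sum_comm
  rw [hswap, hswap, Finset.mul_sum]
  refine Finset.sum_le_sum fun a _ => ?_
  rw [Finset.mul_sum]
  exact Finset.sum_le_sum fun b _ => hw.contract _

lemma IsMixing.rms_mix_le' [NeZero N] (hw : IsMixing w s) (U : Fin N → Mat n r) :
    rms (mix w U) ≤ ‖mean U‖ + s * rms U := by
  have h := rms_add_le (fun i => mix w U i - mean U) (fun _ : Fin N => mean U)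
  simp only [sub_add_cancel, rms_const] at h
  have := hw.rms_mix_sub_mean_le U
  linarith

lemma norm_le_sqrt_mul_rms [NeZero N] (U : Fin N → Mat n r) (i : Fin N) :
    ‖U i‖ ≤ √(N : ℝ) * rms U := by
  have hN : (N : ℝ) ≠ 0 := Nat.cast_ne_zero.2 (NeZero.ne N)
  refine le_of_sq_le_sq ?_ (mul_nonneg (Real.sqrt_nonneg _) (rms_nonneg U))
  rw [mul_pow, Real.sq_sqrt (by positivity), rms_sq, ← mul_assoc, mul_inv_cancel₀ hN, one_mul]
  exact Finset.single_le_sum (f := fun i => ‖U i‖ ^ 2) (fun _ _ => sq_nonneg _)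
    (Finset.mem_univ i)

/-- This is where the number of communication rounds enters: a single deviation is at most √N times
the root mean square, and mixing with √N s ≤ 1/2 absorbs the √N. -/
lemma IsMixing.norm_mix_le [NeZero N] (hw : IsMixing w s) (U : Fin N → Mat n r) (i : Fin N) :
    ‖mix w U i‖ ≤ ‖mean U‖ + rms U / 2 := by
  have h1 := norm_le_sqrt_mul_rms (fun i => mix w U i - mean U) i
  have h2 := hw.rms_mix_sub_mean_le U
  have h3 := norm_add_le (mix w U i - mean U) (mean U)
  rw [sub_add_cancel] at h3
  have h4 := mul_le_mul_of_nonneg_left h2 (Real.sqrt_nonneg (N : ℝ))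
  have h5 := mul_le_mul_of_nonneg_right hw.sqrt_mul_s_le (rms_nonneg U)
  nlinarith

end Frobenius

/-- The spectrum of a symmetric stochastic matrix is contained in `[-1, 1]`. -/
lemma IsDoublyStochastic.abs_le_one_of_mem_spectrum {w : Matrix (Fin N) (Fin N) ℝ}
    (hw : IsDoublyStochastic w) {c : ℝ} (hc : c ∈ spectrum ℝ w) : |c| ≤ 1 := by
  rw [← Matrix.spectrum_toLin', ← Module.End.hasEigenvalue_iff_mem_spectrum] at hc
  obtain ⟨x, hx⟩ := hc.exists_hasEigenvector
  have hx1 : ∀ i, mix w x i = c * x i := fun i => by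
    have := congrFun hx.apply_eq_smul i
    simpa [Matrix.mulVec, dotProduct, mix] using this
  have h1 := rms_mix_le hw x
  have h2 : rms (mix w x) = |c| * rms x := by
    rw [← rms_smul]; exact congrArg rms (funext hx1)
  have h3 : 0 < rms x := by
    obtain ⟨i, hi⟩ := Function.ne_iff.1 hx.2
    have hN : 0 < (N : ℝ) := by exact_mod_cast i.pos
    refine Real.sqrt_pos.2 (mul_pos (by positivity) ?_)
    refine Finset.sum_pos' (fun _ _ => sq_nonneg _) ⟨i, Finset.mem_univ i, ?_⟩
    have : x i ≠ 0 := hi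
    positivity
  rw [h2] at h1
  nlinarith

/-- The spectrum lies in [-1, 1] and contains 1, with the constant vector as eigenvector. The bound
L_t ≤ 2 serves to compare 1 - ρ_t with α. -/
lemma IsDoublyStochastic.mixL_bounds [NeZero N] {W : Matrix (Fin N) (Fin N) ℝ}
    (hW : IsDoublyStochastic W) (t : ℕ) : 0 ≤ mixL W t ∧ mixL W t ≤ 2 := by
  have hw := hW.pow t
  have h1 : (1 : ℝ) ∈ spectrum ℝ (W ^ t) := by
    rw [← Matrix.spectrum_toLin', ← Module.End.hasEigenvalue_iff_mem_spectrum]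
    refine Module.End.hasEigenvalue_of_hasEigenvector (x := fun _ => 1)
      ⟨Module.End.mem_eigenspace_iff.2 ?_, fun h => ?_⟩
    · rw [Matrix.toLin'_apply]
      ext i; simp [Matrix.mulVec, dotProduct, hw.row_sum]
    · exact one_ne_zero (congrFun h (0 : Fin N))
  have h2 : ∀ c ∈ spectrum ℝ (W ^ t), -1 ≤ c := fun c hc =>
    (abs_le.1 (hw.abs_le_one_of_mem_spectrum hc)).1
  have h3 : sInf (spectrum ℝ (W ^ t)) ≤ 1 := csInf_le ⟨-1, h2⟩ h1
  have h4 : -1 ≤ sInf (spectrum ℝ (W ^ t)) := le_csInf ⟨1, h1⟩ h2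
  constructor <;> unfold mixL <;> linarith

end Mixing

/-! ### Smooth costs -/

section Costs

attribute [local instance] Matrix.frobeniusNormedAddCommGroup Matrix.frobeniusNormedSpace
  frobeniusInnerProductSpace

variable {n r N : ℕ}

lemma fderiv_eq_inner_egrad (φ : Mat n r → ℝ) (X V : Mat n r) :
    fderiv ℝ φ X V = inner ℝ (egrad φ X) V := by
  conv_lhs => rw [Matrix.matrix_eq_sum_single V]
  simp only [map_sum, inner_eq_sum]
  refine Finset.sum_congr rfl fun a _ => Finset.sum_congr rfl fun b _ => ?_
  have : Matrix.single a b (V a b) = V a b • Matrix.single a b (1 : ℝ) := by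
    rw [Matrix.smul_single, smul_eq_mul, mul_one]
  rw [this, map_smul, smul_eq_mul, mul_comm]
  rfl

/-- The mean value theorem on the segment from X to Z; it gives the constant L in place of the usual
L / 2, which is enough here. -/
lemma LSmooth.le_add {L : ℝ} {φ : Mat n r → ℝ} (h : LSmooth L φ) (hL : 0 ≤ L) (X Z : Mat n r) :
    φ Z ≤ φ X + inner ℝ (egrad φ X) (Z - X) + L * ‖Z - X‖ ^ 2 := by
  obtain ⟨V, hV, hVeq⟩ := domain_mvt (f := φ) (f' := fderiv ℝ φ) (s := Set.univ)
    (fun x _ => (h.1 x).hasFDerivAt.hasFDerivWithinAt) convex_univ (Set.mem_univ X)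
    (Set.mem_univ Z)
  replace hVeq : φ Z - φ X = inner ℝ (egrad φ V) (Z - X) :=
    hVeq.trans (fderiv_eq_inner_egrad φ V (Z - X))
  have h1 := real_inner_le_norm (egrad φ V - egrad φ X) (Z - X)
  rw [inner_sub_left] at h1
  have h2 := h.2 V X
  have h3 : ‖V - X‖ ≤ ‖Z - X‖ := by
    obtain ⟨a, b, ha, hb, hab, rfl⟩ := hV
    have : a • X + b • Z - X = b • (Z - X) := by
      rw [← eq_sub_iff_add_eq] at hab; rw [hab]; module
    rw [this, norm_smul, Real.norm_of_nonneg hb]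
    exact mul_le_of_le_one_left (norm_nonneg _) (by linarith)
  have h4 : ‖egrad φ V - egrad φ X‖ * ‖Z - X‖ ≤ L * ‖Z - X‖ * ‖Z - X‖ :=
    mul_le_mul_of_nonneg_right (h2.trans (mul_le_mul_of_nonneg_left h3 hL)) (norm_nonneg _)
  nlinarith

lemma rgrad_mem_tangent {X : Mat n r} (hX : X ∈ stiefel n r) (φ : Mat n r → ℝ) :
    rgrad φ X ∈ tangent X := projT_mem_tangent hX _

/-- The descent inequality on the manifold. -/
lemma LSmooth.le_add_rgrad {L A : ℝ} {φ : Mat n r → ℝ} (h : LSmooth L φ) (hL : 0 ≤ L)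
    {X Z : Mat n r} (hX : X ∈ stiefel n r) (hZ : Z ∈ stiefel n r) (hA : ‖egrad φ X‖ ≤ A) :
    φ Z ≤ φ X + inner ℝ (rgrad φ X) (Z - X) + (L + 2 * A) * ‖Z - X‖ ^ 2 := by
  have h1 := h.le_add hL X Z
  have h2 : egrad φ X = rgrad φ X + X * symPart X (egrad φ X) := by
    rw [rgrad, projT_eq, sub_add_cancel]
  set S := symPart X (egrad φ X) with hS
  have hSA : ‖S‖ ≤ A := (norm_symPart_le hX _).trans hA
  -- The normal part X S of the gradient pairs with Z - X only through the symmetric part of Xᵀ (Z -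
  -- X), which is quadratic in Z - X.
  have h3 : inner ℝ (X * S) (Z - X) ≤ 2 * A * ‖Z - X‖ ^ 2 := by
    have h4 : symPart X (Z - X) = -((1 / 2 : ℝ) • ((X - Z)ᵀ * (X - Z))) := by
      rw [sub_eq_add_neg Z X, symPart_add, ← neg_one_smul ℝ X, symPart_smul, symPart_self hX,
        symPart_eq_one_sub hX hZ]
      module
    have h5 := (le_abs_self _).trans (abs_real_inner_le_norm (symPart X (Z - X))ᵀᵀ S)
    rw [inner_def, Matrix.transpose_transpose, symPart_transpose] at h5
    rw [real_inner_comm, inner_mul_sym X _ (symPart_transpose X _)]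
    refine h5.trans ?_
    rw [Matrix.frobenius_norm_transpose, h4, norm_neg, norm_smul, Real.norm_of_nonneg (by norm_num)]
    have h6 := Matrix.frobenius_norm_mul (X - Z)ᵀ (X - Z)
    rw [Matrix.frobenius_norm_transpose, norm_sub_rev] at h6
    have h7 := norm_nonneg S
    have h8 := norm_nonneg ((X - Z)ᵀ * (X - Z))
    have h9 := sq_nonneg ‖Z - X‖
    nlinarith [mul_le_mul h6 hSA h7 (by positivity)]
  have h4 : inner ℝ (egrad φ X) (Z - X)
      = inner ℝ (rgrad φ X) (Z - X) + inner ℝ (X * S) (Z - X) := by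
    conv_lhs => rw [h2]
    rw [inner_add_left]
  linarith

lemma LSmooth.rgrad_lipschitz {L A : ℝ} {φ : Mat n r → ℝ} (h : LSmooth L φ)
    {X Z : Mat n r} (hX : X ∈ stiefel n r) (hZ : Z ∈ stiefel n r) (hA : ‖egrad φ Z‖ ≤ A) :
    ‖rgrad φ X - rgrad φ Z‖ ≤ (L + 2 * A) * ‖X - Z‖ := by
  have h1 : rgrad φ X - rgrad φ Z = projT X (egrad φ X - egrad φ Z)
      + (projT X (egrad φ Z) - projT Z (egrad φ Z)) := by
    rw [projT_sub, rgrad, rgrad]; abel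
  rw [h1]
  have h2 := norm_add_le (projT X (egrad φ X - egrad φ Z))
    (projT X (egrad φ Z) - projT Z (egrad φ Z))
  have h3 := (norm_projT_le hX (egrad φ X - egrad φ Z)).trans (h.2 X Z)
  have h4 := norm_projT_sub_projT_le hX hZ (egrad φ Z)
  have h5 := mul_le_mul_of_nonneg_left hA (norm_nonneg (X - Z))
  linarith

lemma egrad_avgCost {f : Fin N → Mat n r → ℝ} (hf : ∀ i, Differentiable ℝ (f i)) (X : Mat n r) :
    egrad (avgCost f) X = mean fun i => egrad (f i) X := by
  have h1 : fderiv ℝ (avgCost f) X = (N : ℝ)⁻¹ • ∑ i, fderiv ℝ (f i) X := by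
    have h2 : HasFDerivAt (fun X => ∑ i, f i X) (∑ i, fderiv ℝ (f i) X) X :=
      HasFDerivAt.fun_sum fun i _ => (hf i X).hasFDerivAt
    exact (h2.const_mul _).fderiv
  ext a b
  rw [mean_apply]
  simp [egrad, h1]

lemma lsmooth_avgCost [NeZero N] {L : ℝ} {f : Fin N → Mat n r → ℝ} (hf : ∀ i, LSmooth L (f i)) :
    LSmooth L (avgCost f) := by
  refine ⟨?_, fun X Z => ?_⟩
  · exact (Differentiable.fun_sum fun i _ => (hf i).1).const_mul _
  · rw [egrad_avgCost fun i => (hf i).1, egrad_avgCost fun i => (hf i).1, ← mean_sub]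
    refine (norm_mean_le_rms _).trans ?_
    refine rms_le_of_forall ?_ fun i => (hf i).2 X Z
    exact (norm_nonneg _).trans ((hf 0).2 X Z)

lemma rgrad_avgCost {f : Fin N → Mat n r → ℝ} (hf : ∀ i, Differentiable ℝ (f i)) (X : Mat n r) :
    rgrad (avgCost f) X = mean fun i => rgrad (f i) X := by
  rw [rgrad, egrad_avgCost hf, ← mean_projT]; rfl

lemma norm_egrad_avgCost_le [NeZero N] {A : ℝ} {f : Fin N → Mat n r → ℝ}
    (hf : ∀ i, Differentiable ℝ (f i)) {X : Mat n r} (h : ∀ i, ‖egrad (f i) X‖ ≤ A) :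
    ‖egrad (avgCost f) X‖ ≤ A := by
  rw [egrad_avgCost hf]
  exact (norm_mean_le_rms _).trans
    (rms_le_of_forall ((norm_nonneg _).trans (h 0)) h)

lemma exists_abs_le_on_stiefel {φ : Mat n r → ℝ} (h : Continuous φ) :
    ∃ C, ∀ X ∈ stiefel n r, |φ X| ≤ C := by
  obtain ⟨C, hC⟩ := (isCompact_stiefel n r).exists_bound_of_continuousOn h.continuousOn
  exact ⟨C, hC⟩

lemma maxGradNorm_nonneg (f : Fin N → Mat n r → ℝ) : 0 ≤ maxGradNorm f :=
  Real.sSup_nonneg fun _ ⟨_, _, _, hx⟩ => hx ▸ specNorm_nonneg _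

end Costs

/-! ### One step of the algorithm -/

section OneStep

attribute [local instance] Matrix.frobeniusNormedAddCommGroup Matrix.frobeniusNormedSpace
  frobeniusInnerProductSpace

variable {n r N : ℕ}

/-- The search direction of every agent. -/
def direction (w : Matrix (Fin N) (Fin N) ℝ) (α β : ℝ) (X Y : Fin N → Mat n r) (i : Fin N) :
    Mat n r :=
  α • projT (X i) (mix w X i) - β • projT (X i) (Y i)

/-- The new points of the agents. -/
def nextPoint (w : Matrix (Fin N) (Fin N) ℝ) (α β : ℝ) (X Y : Fin N → Mat n r) (i : Fin N) :
    Mat n r :=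
  polarRetraction (X i) (direction w α β X Y i)

lemma direction_mem_tangent (w : Matrix (Fin N) (Fin N) ℝ) (α β : ℝ) {X : Fin N → Mat n r}
    (hX : ∀ i, X i ∈ stiefel n r) (Y : Fin N → Mat n r) (i : Fin N) :
    direction w α β X Y i ∈ tangent (X i) :=
  tangent_sub (tangent_smul (projT_mem_tangent (hX i) _) _)
    (tangent_smul (projT_mem_tangent (hX i) _) _)

lemma nextPoint_mem (w : Matrix (Fin N) (Fin N) ℝ) (α β : ℝ) {X : Fin N → Mat n r}
    (hX : ∀ i, X i ∈ stiefel n r) (Y : Fin N → Mat n r) (i : Fin N) :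
    nextPoint w α β X Y i ∈ stiefel n r :=
  polarRetraction_mem (hX i) (direction_mem_tangent w α β hX Y i)

/-- The curvature term `∑_j w_ij (X_i - X_j)ᵀ (X_i - X_j)`. -/
def spread (w : Matrix (Fin N) (Fin N) ℝ) (X : Fin N → Mat n r) (i : Fin N) :
    Matrix (Fin r) (Fin r) ℝ :=
  mix w (fun j => (X i - X j)ᵀ * (X i - X j)) i

variable {w : Matrix (Fin N) (Fin N) ℝ}

/-- Projecting onto the tangent space changes the Euclidean consensus step only by a normal
correction quadratic in the disagreement, since each X_iᵀ X_j has symmetric part 1 - ½ (X_i - X_j)ᵀ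
(X_i - X_j). -/
lemma projT_mix_eq (hw : IsDoublyStochastic w) {X : Fin N → Mat n r}
    (hX : ∀ i, X i ∈ stiefel n r) (i : Fin N) :
    projT (X i) (mix w X i)
      = mix w X i - X i + (1 / 2 : ℝ) • (X i * spread w X i) := by
  have h1 : symPart (X i) (mix w X i) = 1 - (1 / 2 : ℝ) • spread w X i := by
    let f : Mat n r →ₗ[ℝ] Matrix (Fin r) (Fin r) ℝ :=
      { toFun := symPart (X i), map_add' := symPart_add (X i)
        map_smul' := fun c Y => symPart_smul (X i) Y c }
    have h2 : symPart (X i) (mix w X i) = ∑ j, w i j • symPart (X i) (X j) := by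
      change f (mix w X i) = _
      rw [mix, map_sum]
      exact Finset.sum_congr rfl fun j _ => map_smul f _ _
    rw [h2]
    simp only [symPart_eq_one_sub (hX i) (hX _), smul_sub, Finset.sum_sub_distrib,
      ← Finset.sum_smul, hw.row_sum, one_smul, spread, mix, Finset.smul_sum]
    simp only [smul_comm (1 / 2 : ℝ)]
  rw [projT_eq, h1, Matrix.mul_sub, Matrix.mul_one, Matrix.mul_smul]
  abel

/-- Expanding around a reference point Z lets the cross terms appear through the mixed deviations,
which are already contracted. -/
lemma spread_eq (hw : IsDoublyStochastic w) (X : Fin N → Mat n r) (Z : Mat n r) (i : Fin N) :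
    spread w X i = (X i - Z)ᵀ * (X i - Z) - (X i - Z)ᵀ * mix w (fun j => X j - Z) i
      - (mix w (fun j => X j - Z) i)ᵀ * (X i - Z)
      + mix w (fun j => (X j - Z)ᵀ * (X j - Z)) i := by
  have h : ∀ j, (X i - X j)ᵀ * (X i - X j) = (X i - Z)ᵀ * (X i - Z) - (X i - Z)ᵀ * (X j - Z)
      - (X j - Z)ᵀ * (X i - Z) + (X j - Z)ᵀ * (X j - Z) := fun j => by
    have : X i - X j = (X i - Z) - (X j - Z) := by abel
    rw [this]
    generalize X i - Z = D
    generalize X j - Z = D'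
    rw [Matrix.transpose_sub, Matrix.sub_mul, Matrix.mul_sub, Matrix.mul_sub]
    abel
  simp only [spread, h]
  rw [mix_add, mix_sub, mix_sub, mix_const hw]
  simp only [mix, Matrix.mul_sum, Matrix.mul_smul, Matrix.transpose_sum, Matrix.sum_mul,
    Matrix.transpose_smul, Matrix.smul_mul]

lemma norm_transpose_mul_self_le (D E : Mat n r) : ‖Dᵀ * E‖ ≤ ‖D‖ * ‖E‖ := by
  have := Matrix.frobenius_norm_mul Dᵀ E
  rwa [Matrix.frobenius_norm_transpose] at this

lemma norm_spread_le (hw : IsDoublyStochastic w) (X : Fin N → Mat n r) (Z : Mat n r) (i : Fin N) :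
    ‖spread w X i‖ ≤ ‖X i - Z‖ ^ 2 + 2 * ‖X i - Z‖ * ‖mix w (fun j => X j - Z) i‖
      + mix w (fun j => ‖X j - Z‖ ^ 2) i := by
  rw [spread_eq hw X Z i]
  set D := X i - Z
  set m := mix w (fun j => X j - Z) i
  have h1 := norm_add_le (Dᵀ * D - Dᵀ * m - mᵀ * D) (mix w (fun j => (X j - Z)ᵀ * (X j - Z)) i)
  have h2 := norm_sub_le (Dᵀ * D - Dᵀ * m) (mᵀ * D)
  have h3 := norm_sub_le (Dᵀ * D) (Dᵀ * m)
  have h4 := norm_transpose_mul_self_le D D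
  have h5 := norm_transpose_mul_self_le D m
  have h6 := norm_transpose_mul_self_le m D
  have h7 := norm_mix_le hw (fun j => (X j - Z)ᵀ * (X j - Z)) i
  have h8 : mix w (fun j => ‖(X j - Z)ᵀ * (X j - Z)‖) i ≤ mix w (fun j => ‖X j - Z‖ ^ 2) i := by
    refine Finset.sum_le_sum fun j _ => mul_le_mul_of_nonneg_left ?_ (hw.nonneg i j)
    simp only [sq]; exact norm_transpose_mul_self_le _ _
  linarith

lemma mix_sub_self_eq (hw : IsDoublyStochastic w) (X : Fin N → Mat n r) (Z : Mat n r)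
    (i : Fin N) : mix w X i - X i = mix w (fun j => X j - Z) i - (X i - Z) := by
  rw [mix_sub, mix_const hw]; abel

lemma direction_eq (hw : IsDoublyStochastic w) (α β : ℝ) {X : Fin N → Mat n r}
    (hX : ∀ i, X i ∈ stiefel n r) (Y : Fin N → Mat n r) (i : Fin N) :
    direction w α β X Y i = α • (mix w X i - X i) + (α / 2) • (X i * spread w X i)
      - β • projT (X i) (Y i) := by
  rw [direction, projT_mix_eq hw hX]
  module

/-- The conditions on the step sizes under which one step is analysed. -/
structure StepBounds (n r : ℕ) (M α β δ₁ δ₂ A Λ : ℝ) : Prop where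
  retraction : IsRetractionConst n r M
  α_pos : 0 < α
  α_le : α ≤ 1
  αM_le : α * M ≤ 1
  β_pos : 0 < β
  δ₁_pos : 0 < δ₁
  δ₁_le : δ₁ ≤ α / 640
  δ₁_le' : 5 * δ₁ ≤ δ₂
  δ₂_le : δ₂ ≤ 1 / 6
  A_nonneg : 0 ≤ A
  Λ_nonneg : 0 ≤ Λ
  βA_le : β * (5 * A) ≤ α * δ₁ / 10
  βΛ_le : β * Λ ≤ α * δ₁ / 5

/-- The local region in which the iterates stay. -/
structure IsLocal (δ₁ δ₂ : ℝ) (X : Fin N → Mat n r) : Prop where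
  mem : ∀ i, X i ∈ stiefel n r
  isIAM : IsIAM X (iam X)
  consErr_le : consErr X ≤ δ₁
  dist_le : ∀ i, ‖X i - iam X‖ ≤ δ₂

variable {s M α β δ₁ δ₂ A Λ : ℝ} {X Y : Fin N → Mat n r}

lemma StepBounds.δ₁_le_one (h : StepBounds n r M α β δ₁ δ₂ A Λ) : δ₁ ≤ 1 / 640 := by
  have := h.δ₁_le; have := h.α_le; linarith

lemma IsLocal.consErr_sq_le (h : StepBounds n r M α β δ₁ δ₂ A Λ) (hX : IsLocal δ₁ δ₂ X) :
    consErr X ^ 2 ≤ consErr X / 640 := by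
  have h1 := consErr_nonneg X
  have h2 := hX.consErr_le
  have h3 := h.δ₁_le_one
  nlinarith

variable [NeZero N]

lemma IsLocal.norm_mean_dev_le (h : StepBounds n r M α β δ₁ δ₂ A Λ) (hX : IsLocal δ₁ δ₂ X) :
    ‖mean fun i => X i - iam X‖ ≤ consErr X ^ 2 / 2 := by
  rw [mean_sub, mean_const]
  exact hX.isIAM.norm_mean_sub_le_sq h.retraction hX.mem

/-- The mean deviation is quadratic in the error and costs at most 1/1280 of it; the remainder is
halved by mixing. Hence 0.51. -/
lemma IsLocal.norm_mix_dev_le (h : StepBounds n r M α β δ₁ δ₂ A Λ) (hX : IsLocal δ₁ δ₂ X)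
    (hw : IsMixing w s) (i : Fin N) :
    ‖mix w (fun j => X j - iam X) i‖ ≤ 0.51 * consErr X := by
  have h1 := hw.norm_mix_le (fun j => X j - iam X) i
  have h2 := hX.norm_mean_dev_le h
  have h3 := hX.consErr_sq_le h
  change _ ≤ _ + consErr X / 2 at h1
  have := consErr_nonneg X
  linarith

lemma IsLocal.rms_mix_dev_le (h : StepBounds n r M α β δ₁ δ₂ A Λ) (hX : IsLocal δ₁ δ₂ X)
    (hw : IsMixing w s) :
    rms (mix w fun j => X j - iam X) ≤ 0.51 * consErr X := by
  have h1 := hw.rms_mix_le' (fun j => X j - iam X)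
  have h2 := hX.norm_mean_dev_le h
  have h3 := hX.consErr_sq_le h
  change _ ≤ _ + s * consErr X at h1
  have h4 := consErr_nonneg X
  have := mul_le_mul_of_nonneg_right hw.s_le h4
  linarith

lemma IsLocal.norm_spread_le_aux (h : StepBounds n r M α β δ₁ δ₂ A Λ) (hX : IsLocal δ₁ δ₂ X)
    (hw : IsMixing w s) (i : Fin N) :
    ‖spread w X i‖ ≤ ‖X i - iam X‖ ^ 2
      + 1.02 * consErr X * ‖X i - iam X‖
      + mix w (fun j => ‖X j - iam X‖ ^ 2) i := by
  have h1 := norm_spread_le hw.toIsDoublyStochastic X (iam X) i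
  have h2 := mul_le_mul_of_nonneg_left (hX.norm_mix_dev_le h hw i)
    (norm_nonneg (X i - iam X))
  nlinarith

lemma IsLocal.norm_spread_le (h : StepBounds n r M α β δ₁ δ₂ A Λ) (hX : IsLocal δ₁ δ₂ X)
    (hw : IsMixing w s) (i : Fin N) : ‖spread w X i‖ ≤ 0.34 * δ₂ := by
  have h1 := hX.norm_spread_le_aux h hw i
  have hd := hX.dist_le i
  have hd0 := norm_nonneg (X i - iam X)
  have h2 : mix w (fun j => ‖X j - iam X‖ ^ 2) i ≤ δ₂ ^ 2 := by
    refine (le_abs_self _).trans ?_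
    refine norm_mix_le_of_forall (U := fun j => ‖X j - iam X‖ ^ 2) hw.toIsDoublyStochastic
      (fun j => ?_) i
    rw [norm_pow, norm_norm]
    exact pow_le_pow_left₀ (norm_nonneg _) (hX.dist_le j) 2
  have h3 := pow_le_pow_left₀ hd0 hd 2
  have h4 := h.δ₁_le_one
  have h5 := h.δ₂_le
  have h6 := hX.consErr_le
  have h7 := consErr_nonneg X
  have h8 : consErr X * ‖X i - iam X‖ ≤ 1 / 640 * δ₂ :=
    mul_le_mul (h6.trans h4) hd hd0 (by norm_num)
  have h9 : δ₂ ^ 2 ≤ 1 / 6 * δ₂ := by nlinarith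
  nlinarith

/-- Squared deviations are at most δ₂ times the deviations, so the quadratic term becomes linear
with coefficient 2 δ₂ + 1.02 e ≤ 1/3 + 1.02/640. -/
lemma IsLocal.rms_spread_le (h : StepBounds n r M α β δ₁ δ₂ A Λ) (hX : IsLocal δ₁ δ₂ X)
    (hw : IsMixing w s) : rms (spread w X) ≤ 0.34 * consErr X := by
  set d : Fin N → ℝ := fun i => ‖X i - iam X‖ with hd
  have hde : rms d = consErr X := rms_norm _
  have he := consErr_nonneg X
  have hδ₂ : 0 ≤ δ₂ := (norm_nonneg _).trans (hX.dist_le 0)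
  have hsq : ∀ i, d i ^ 2 ≤ δ₂ * d i := fun i => by
    have := hX.dist_le i
    have := norm_nonneg (X i - iam X)
    simp only [hd]; nlinarith
  have h1 : ∀ i, ‖spread w X i‖ ≤ ‖(δ₂ + 1.02 * consErr X) * d i + δ₂ * mix w d i‖ := fun i => by
    refine le_trans ?_ (le_abs_self _)
    refine (hX.norm_spread_le_aux h hw i).trans ?_
    have h2 : mix w (fun j => ‖X j - iam X‖ ^ 2) i ≤ δ₂ * mix w d i := by
      simp only [mix, Finset.mul_sum, smul_eq_mul]
      refine Finset.sum_le_sum fun j _ => ?_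
      have := mul_le_mul_of_nonneg_left (hsq j) (hw.nonneg i j)
      linarith
    have := hsq i
    simp only [hd] at *
    linarith
  have h3 := (rms_mono h1).trans (rms_add_le (fun i => (δ₂ + 1.02 * consErr X) * d i)
    fun i => δ₂ * mix w d i)
  rw [rms_mul_left _ (by positivity), rms_mul_left _ hδ₂, hde] at h3
  have h4 := rms_mix_le hw.toIsDoublyStochastic d
  rw [hde] at h4
  have h5 := mul_le_mul_of_nonneg_left h4 hδ₂
  have h6 := hX.consErr_sq_le h
  have h7 := mul_le_mul_of_nonneg_right h.δ₂_le he
  nlinarith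

/-- On average the bound stays quadratic: mixing preserves the mean of the squared deviations, so
the three terms contribute 1, 1.02 and 1 times e². -/
lemma IsLocal.mean_norm_spread_le (h : StepBounds n r M α β δ₁ δ₂ A Λ) (hX : IsLocal δ₁ δ₂ X)
    (hw : IsMixing w s) : (N : ℝ)⁻¹ * ∑ i, ‖spread w X i‖ ≤ 3.02 * consErr X ^ 2 := by
  have h1 : (N : ℝ)⁻¹ * ∑ i, ‖spread w X i‖ ≤ (N : ℝ)⁻¹ * ∑ i,
      (‖X i - iam X‖ ^ 2 + 1.02 * consErr X * ‖X i - iam X‖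
      + mix w (fun j => ‖X j - iam X‖ ^ 2) i) :=
    mul_le_mul_of_nonneg_left (Finset.sum_le_sum fun i _ => hX.norm_spread_le_aux h hw i)
      (by positivity)
  rw [Finset.sum_add_distrib, Finset.sum_add_distrib, mul_add, mul_add, ← Finset.mul_sum] at h1
  have h2 : (N : ℝ)⁻¹ * ∑ i, ‖X i - iam X‖ ^ 2 = consErr X ^ 2 :=
    (rms_sq _).symm
  have h3 : (N : ℝ)⁻¹ * ∑ i, mix w (fun j => ‖X j - iam X‖ ^ 2) i
      = consErr X ^ 2 := by
    rw [← h2]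
    exact mean_mix hw.toIsDoublyStochastic fun j => ‖X j - iam X‖ ^ 2
  have h4 : (N : ℝ)⁻¹ * ∑ i, ‖X i - iam X‖ ≤ consErr X := mean_norm_le_rms _
  have h5 := mul_le_mul_of_nonneg_left h4 (consErr_nonneg X)
  rw [h2, h3] at h1
  nlinarith

end OneStep

/-! ### Contraction of consensus, invariance of the region, motion of the mean, descent and tracking
-/

section Progress

attribute [local instance] Matrix.frobeniusNormedAddCommGroup Matrix.frobeniusNormedSpace
  frobeniusInnerProductSpace

variable {n r N : ℕ} {w : Matrix (Fin N) (Fin N) ℝ} {s M α β δ₁ δ₂ A Λ : ℝ}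
  {X Y : Fin N → Mat n r}

/-- The distance of the new points to a point of the manifold. -/
lemma norm_nextPoint_sub_le (hw : IsDoublyStochastic w) (hα : 0 ≤ α) (hα' : α ≤ 1) (hβ : 0 ≤ β)
    (hX : ∀ i, X i ∈ stiefel n r) {Z : Mat n r} (hZ : Z ∈ stiefel n r) (i : Fin N) :
    ‖nextPoint w α β X Y i - Z‖ ≤ (1 - α) * ‖X i - Z‖ + α * ‖mix w (fun j => X j - Z) i‖
      + α / 2 * ‖spread w X i‖ + β * ‖Y i‖ := by
  refine (norm_polarRetraction_sub_le (hX i) (direction_mem_tangent w α β hX Y i) hZ).trans ?_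
  have h1 : X i + direction w α β X Y i - Z = (1 - α) • (X i - Z)
      + α • mix w (fun j => X j - Z) i + (α / 2) • (X i * spread w X i)
      - β • projT (X i) (Y i) := by
    rw [direction_eq hw α β hX, mix_sub_self_eq hw X Z]
    module
  rw [h1]
  refine (norm_sub_le _ _).trans (add_le_add ((norm_add_le _ _).trans (add_le_add
    ((norm_add_le _ _).trans (add_le_add ?_ ?_)) ?_)) ?_)
  · rw [norm_smul, Real.norm_of_nonneg (by linarith)]
  · rw [norm_smul, Real.norm_of_nonneg hα]
  · rw [norm_smul, Real.norm_of_nonneg (by linarith), norm_mul_left_of_mem (hX i)]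
  · rw [norm_smul, Real.norm_of_nonneg hβ]
    exact mul_le_mul_of_nonneg_left (norm_projT_le (hX i) _) hβ

lemma rms_nextPoint_sub_le (hw : IsDoublyStochastic w) (hα : 0 ≤ α) (hα' : α ≤ 1) (hβ : 0 ≤ β)
    (hX : ∀ i, X i ∈ stiefel n r) {Z : Mat n r} (hZ : Z ∈ stiefel n r) :
    rms (fun i => nextPoint w α β X Y i - Z) ≤ (1 - α) * rms (fun i => X i - Z)
      + α * rms (mix w fun j => X j - Z) + α / 2 * rms (spread w X) + β * rms Y := by
  have h0 : ∀ i, ‖nextPoint w α β X Y i - Z‖ ≤ ‖(1 - α) * ‖X i - Z‖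
      + α * ‖mix w (fun j => X j - Z) i‖ + α / 2 * ‖spread w X i‖ + β * ‖Y i‖‖ := fun i =>
    (norm_nextPoint_sub_le hw hα hα' hβ hX hZ i).trans (le_abs_self _)
  refine (rms_mono h0).trans ((rms_add_le _ _).trans (add_le_add ((rms_add_le _ _).trans
    (add_le_add ((rms_add_le _ _).trans (add_le_add ?_ ?_)) ?_)) ?_))
  · rw [rms_mul_left _ (by linarith), rms_norm]
  · rw [rms_mul_left _ hα, rms_norm]
  · rw [rms_mul_left _ (by linarith), rms_norm]
  · rw [rms_mul_left _ hβ, rms_norm]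

lemma IsLocal.norm_direction_le (h : StepBounds n r M α β δ₁ δ₂ A Λ) (hX : IsLocal δ₁ δ₂ X)
    (hw : IsMixing w s) (i : Fin N) :
    ‖direction w α β X Y i‖ ≤ α * (‖mix w (fun j => X j - iam X) i‖ + ‖X i - iam X‖)
      + β * ‖Y i‖ := by
  have h1 : projT (X i) (mix w X i) = projT (X i) (mix w X i - X i) := by
    rw [projT_sub, projT_self (hX.mem i), sub_zero]
  rw [direction, h1, mix_sub_self_eq hw.toIsDoublyStochastic X (iam X)]
  refine (norm_sub_le _ _).trans (add_le_add ?_ ?_)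
  · rw [norm_smul, Real.norm_of_nonneg h.α_pos.le]
    exact mul_le_mul_of_nonneg_left ((norm_projT_le (hX.mem i) _).trans (norm_sub_le _ _))
      h.α_pos.le
  · rw [norm_smul, Real.norm_of_nonneg h.β_pos.le]
    exact mul_le_mul_of_nonneg_left (norm_projT_le (hX.mem i) _) h.β_pos.le

lemma rms_oracle_sub_le {f : Fin N → Mat n r → ℝ} {Λ : ℝ} (hΛ : 0 ≤ Λ)
    (hlip : ∀ i, ∀ Z ∈ stiefel n r, ∀ Z' ∈ stiefel n r,
      ‖rgrad (f i) Z - rgrad (f i) Z'‖ ≤ Λ * ‖Z - Z'‖)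
    {X X' S S' : Fin N → Mat n r} (hX : ∀ i, X i ∈ stiefel n r) (hX' : ∀ i, X' i ∈ stiefel n r) :
    rms (fun i => S' i - S i) ≤ Λ * rms (fun i => X' i - X i)
      + rms (fun i => S' i - rgrad (f i) (X' i)) + rms (fun i => S i - rgrad (f i) (X i)) := by
  have h1 : (fun i => S' i - S i) = fun i => (rgrad (f i) (X' i) - rgrad (f i) (X i)
      + (S' i - rgrad (f i) (X' i))) - (S i - rgrad (f i) (X i)) := funext fun i => by abel
  rw [h1]
  refine (rms_sub_le _ _).trans (add_le_add_left ((rms_add_le _ _).trans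
    (add_le_add_left ?_ _)) _)
  have h2 : ∀ i, ‖rgrad (f i) (X' i) - rgrad (f i) (X i)‖ ≤ ‖Λ * ‖X' i - X i‖‖ := fun i =>
    (hlip i _ (hX' i) _ (hX i)).trans (le_abs_self _)
  refine (rms_mono h2).trans ?_
  rw [rms_mul_left _ hΛ, rms_norm]

/-- The invariant behind gradient tracking: mixing preserves means and the corrections telescope, so
the trackers always average to the current gradient estimates. -/
lemma mean_tracker (hw : IsMixing w s) {Y Y' S S' : Fin N → Mat n r}
    (hY' : ∀ i, Y' i = mix w Y i + S' i - S i) (hmean : mean Y = mean S) : mean Y' = mean S' := by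
  have : Y' = fun i => mix w Y i + (S' i - S i) := funext fun i => by rw [hY', add_sub_assoc]
  have h2 : mean (fun i => mix w Y i) = mean Y := mean_mix hw.toIsDoublyStochastic Y
  rw [this, mean_add, mean_sub, h2, hmean]
  change mean S + (mean S' - mean S) = mean S'
  abel

lemma IsLocal.rms_direction_le (h : StepBounds n r M α β δ₁ δ₂ A Λ) (hX : IsLocal δ₁ δ₂ X)
    (hw : IsMixing w s) :
    rms (direction w α β X Y) ≤ 2 * α * consErr X + β * rms Y := by
  have h1 : ∀ i, ‖direction w α β X Y i‖ ≤
      ‖α * (‖mix w (fun j => X j - iam X) i‖ + ‖X i - iam X‖) + β * ‖Y i‖‖ := fun i =>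
    (hX.norm_direction_le h hw i).trans (le_abs_self _)
  refine ((rms_mono h1).trans (rms_add_le _ _)).trans (add_le_add ?_ ?_)
  · rw [rms_mul_left _ h.α_pos.le]
    have h2 := rms_add_le (fun i => ‖mix w (fun j => X j - iam X) i‖) (fun i => ‖X i - iam X‖)
    rw [rms_norm, rms_norm] at h2
    have h3 := rms_mix_le hw.toIsDoublyStochastic (fun j => X j - iam X)
    have h4 : rms (fun i => X i - iam X) = consErr X := rfl
    rw [h4] at h2 h3
    have := mul_le_mul_of_nonneg_left (h2.trans (add_le_add_left h3 _)) h.α_pos.le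
    linarith
  · rw [rms_mul_left _ h.β_pos.le, rms_norm]

lemma IsLocal.rms_nextPoint_sub_self_le (h : StepBounds n r M α β δ₁ δ₂ A Λ)
    (hX : IsLocal δ₁ δ₂ X) (hw : IsMixing w s) :
    rms (fun i => nextPoint w α β X Y i - X i) ≤ 2 * α * consErr X + β * rms Y := by
  refine (rms_mono fun i => ?_).trans (hX.rms_direction_le h hw)
  have := norm_polarRetraction_sub_le (hX.mem i) (direction_mem_tangent w α β hX.mem Y i)
    (hX.mem i)
  rwa [add_sub_cancel_left] at this

/-- The estimate of the terms of higher order in the descent of the cost. -/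
lemma descent_bound {α β δ Λ g e y ν d : ℝ} (hα : 0 ≤ α) (hα' : α ≤ 1) (hβ : 0 < β) (hδ : 0 ≤ δ)
    (hδ' : δ ≤ 1 / 640) (hΛ : 0 ≤ Λ) (hβΛ : β * Λ ≤ α * δ / 5) (hg : 0 ≤ g) (he : 0 ≤ e)
    (he' : e ≤ δ) (hy : 0 ≤ y) (hd : 0 ≤ d) (hd' : d ≤ 11 * α * e ^ 2 + 1.1 * (β * y)) :
    -(β * g ^ 2) + β * g * (Λ * e + ν + 2 * (e * y)) + g * (10 * α * e ^ 2 + δ * (β * y))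
      + g * d * δ ^ 2 + Λ * d ^ 2
      ≤ -(0.7 * β * g ^ 2) + β * ν ^ 2 + 2.2 * δ * β * y ^ 2 + 6 * δ * (α ^ 2 / β * e ^ 2) := by
  -- Scaled so that β q = (α e)²; then 2 α g e ≤ β g² + q, and every mixed product is split into β
  -- g², β y² and q, with small factors δ.
  set q := α ^ 2 / β * e ^ 2 with hq
  have hβq : β * q = α ^ 2 * e ^ 2 := by rw [hq]; field_simp
  have hq0 : 0 ≤ q := by positivity
  have hge : 2 * (α * g * e) ≤ β * g ^ 2 + q := by
    have h1 : 0 ≤ β * (β * g ^ 2 + q - 2 * (α * g * e)) := by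
      have : β * (β * g ^ 2 + q - 2 * (α * g * e)) = (β * g - α * e) ^ 2 := by
        linear_combination hβq
      rw [this]; positivity
    have := nonneg_of_mul_nonneg_right h1 hβ
    linarith
  have hgy : 2 * (β * g * y) ≤ β * g ^ 2 + β * y ^ 2 := by
    nlinarith [mul_nonneg hβ.le (sq_nonneg (g - y))]
  have hage : 0 ≤ α * g * e := by positivity
  have hbgy : 0 ≤ β * g * y := by positivity
  have hbg : 0 ≤ β * g ^ 2 := by positivity
  have hby : 0 ≤ β * y ^ 2 := by positivity
  have t1 : β * g * ν ≤ β * g ^ 2 / 4 + β * ν ^ 2 := by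
    nlinarith [mul_nonneg hβ.le (sq_nonneg (g / 2 - ν))]
  have t2 : β * g * (Λ * e) ≤ δ / 5 * (α * g * e) := by
    have := mul_le_mul_of_nonneg_right hβΛ (mul_nonneg hg he)
    linarith
  have t3 : g * (10 * α * e ^ 2) ≤ 10 * δ * (α * g * e) := by
    have := mul_le_mul_of_nonneg_right he' hage
    linarith
  have t4 : β * g * (2 * (e * y)) ≤ 2 * δ * (β * g * y) := by
    have := mul_le_mul_of_nonneg_right he' hbgy
    linarith
  have hd2 : d ≤ 11 * δ * (α * e) + 1.1 * (β * y) := by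
    have := mul_le_mul_of_nonneg_right he' (mul_nonneg hα he)
    linarith
  have hδδ : δ ^ 2 ≤ 1 / 640 * δ := by nlinarith
  have t5 : g * d * δ ^ 2 ≤ δ * (0.01 * (α * g * e) + 0.01 * (β * g * y)) := by
    have h1 : g * d * δ ^ 2 ≤ g * (11 * δ * (α * e) + 1.1 * (β * y)) * (1 / 640 * δ) :=
      mul_le_mul (mul_le_mul_of_nonneg_left hd2 hg) hδδ (sq_nonneg _) (by positivity)
    have h2 := mul_le_mul_of_nonneg_right hδ' (mul_nonneg hδ hage)
    have h3 := mul_nonneg hδ hbgy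
    nlinarith
  have t6 : Λ * d ^ 2 ≤ 0.001 * δ * q + 0.5 * δ * (β * y ^ 2) := by
    have h1 : d ^ 2 ≤ 242 * δ ^ 2 * (β * q) + 2.42 * (β * (β * y ^ 2)) := by
      have h0 := pow_le_pow_left₀ hd hd2 2
      have h2 := sq_nonneg (11 * δ * (α * e) - 1.1 * (β * y))
      rw [hβq]
      ring_nf at h0 h2 ⊢
      linarith
    have h2 := mul_le_mul_of_nonneg_left h1 hΛ
    have h3 : β * Λ ≤ δ / 5 := by
      have := mul_le_mul_of_nonneg_right hα' hδ
      linarith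
    have h4 := mul_le_mul_of_nonneg_right h3 (mul_nonneg (sq_nonneg δ) hq0)
    have h5 := mul_le_mul_of_nonneg_right h3 hby
    have h6 : δ / 5 * (δ ^ 2 * q) ≤ 1 / 1000000 * (δ * q) := by
      have h0 : δ ^ 2 ≤ 5 / 1000000 := by nlinarith
      have := mul_le_mul_of_nonneg_right h0 (mul_nonneg hδ hq0)
      linarith
    have h7 := mul_nonneg hδ hby
    have h8 := mul_nonneg hδ hq0
    linarith
  have u1 := mul_le_mul_of_nonneg_left hge hδ
  have u2 := mul_le_mul_of_nonneg_left hgy hδ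
  have u3 := mul_le_mul_of_nonneg_right hδ' hbg
  have u4 := mul_nonneg hδ hq0
  have u5 := mul_nonneg hδ hby
  linarith

variable [NeZero N]

/-- Contraction of the consensus error. -/
lemma IsLocal.consErr_nextPoint_le (h : StepBounds n r M α β δ₁ δ₂ A Λ) (hX : IsLocal δ₁ δ₂ X)
    (hw : IsMixing w s) :
    consErr (nextPoint w α β X Y) ≤ (1 - 0.3 * α) * consErr X + β * rms Y := by
  have hmem := nextPoint_mem w α β hX.mem Y
  -- The new error is bounded by the distance of the new points to the old induced mean, which the
  -- new mean can only improve.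
  have h0 := (isIAM_iam ⟨_, hX.mem 0⟩ (nextPoint w α β X Y)).rms_le hX.isIAM.1
  have h1 := rms_nextPoint_sub_le (Y := Y) hw.toIsDoublyStochastic h.α_pos.le h.α_le h.β_pos.le
    hX.mem hX.isIAM.1
  -- The coefficients add up to 1 - α + 0.51 α + 0.17 α = 1 - 0.32 α.
  have h2 := mul_le_mul_of_nonneg_left (hX.rms_mix_dev_le h hw) h.α_pos.le
  have h3 := mul_le_mul_of_nonneg_left (hX.rms_spread_le h hw) (half_pos h.α_pos).le
  have h4 := mul_nonneg h.α_pos.le (consErr_nonneg X)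
  change consErr (nextPoint w α β X Y) ≤ _ at h0
  change _ ≤ (1 - α) * consErr X + _ + _ + _ at h1
  linarith

lemma StepBounds.beta_rms_le (h : StepBounds n r M α β δ₁ δ₂ A Λ) (hY : ∀ i, ‖Y i‖ ≤ 5 * A) :
    β * rms Y ≤ α * δ₁ / 10 :=
  (mul_le_mul_of_nonneg_left (rms_le_of_forall (by linarith [h.A_nonneg]) hY) h.β_pos.le).trans
    h.βA_le

/-- The mean moves along the tracked gradient, up to terms of second order. -/
lemma IsLocal.norm_mean_nextPoint_sub_le (h : StepBounds n r M α β δ₁ δ₂ A Λ)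
    (hX : IsLocal δ₁ δ₂ X) (hw : IsMixing w s) (hY : ∀ i, ‖Y i‖ ≤ 5 * A) :
    ‖mean (nextPoint w α β X Y) - mean X + β • mean (fun i => projT (X i) (Y i))‖
      ≤ 10 * α * consErr X ^ 2 + δ₁ * (β * rms Y) := by
  set v := direction w α β X Y with hv
  have h1 : mean (nextPoint w α β X Y) - mean X + β • mean (fun i => projT (X i) (Y i))
      = mean (fun i => nextPoint w α β X Y i - (X i + v i))
        + (α / 2) • mean (fun i => X i * spread w X i) := by
    have e1 : mean v = (α / 2) • mean (fun i => X i * spread w X i)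
        - β • mean (fun i => projT (X i) (Y i)) := by
      have : v = fun i => α • (mix w X i - X i) + (α / 2) • (X i * spread w X i)
          - β • projT (X i) (Y i) :=
        funext fun i => direction_eq hw.toIsDoublyStochastic α β hX.mem Y i
      rw [this, mean_sub, mean_add, mean_smul, mean_smul, mean_smul, mean_sub]
      -- The consensus step drops out of the mean; only its quadratic curvature correction remains.
      have e2 : mean (fun i => mix w X i) = mean X := mean_mix hw.toIsDoublyStochastic X
      rw [e2, sub_self, smul_zero, zero_add]
    have e3 : mean (fun i => nextPoint w α β X Y i - (X i + v i))
        = mean (nextPoint w α β X Y) - (mean X + mean v) := by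
      rw [mean_sub (fun i => nextPoint w α β X Y i), mean_add]
    rw [e3, e1]; abel
  have hM := h.retraction.1
  have h2 : ‖mean (fun i => nextPoint w α β X Y i - (X i + v i))‖ ≤ M * rms v ^ 2 := by
    refine (norm_mean_le _).trans ?_
    rw [rms_sq, mul_left_comm]
    refine mul_le_mul_of_nonneg_left ?_ (by positivity)
    rw [Finset.mul_sum]
    exact Finset.sum_le_sum fun i _ => h.retraction.2 _ (hX.mem i) _
      (direction_mem_tangent w α β hX.mem Y i)
  have h3 : ‖mean (fun i => X i * spread w X i)‖ ≤ 3.02 * consErr X ^ 2 := by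
    refine (norm_mean_le _).trans ?_
    simp only [norm_mul_left_of_mem (hX.mem _)]
    exact hX.mean_norm_spread_le h hw
  have h4 := hX.rms_direction_le (Y := Y) h hw
  rw [← hv] at h4
  have hb := h.beta_rms_le hY
  set b := β * rms Y with hbdef
  have hb0 : 0 ≤ b := mul_nonneg h.β_pos.le (rms_nonneg Y)
  have he0 := consErr_nonneg X
  have h5 : rms v ^ 2 ≤ 8 * α ^ 2 * consErr X ^ 2 + 2 * b ^ 2 := by
    have := pow_le_pow_left₀ (rms_nonneg v) h4 2
    nlinarith [sq_nonneg (2 * α * consErr X - b)]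
  -- The retraction error is of order M α² e²; α M ≤ 1 trades one factor α for M, and one factor β y
  -- ≤ α δ₁ / 10 does the same for the tracker part.
  have h6 : M * rms v ^ 2 ≤ 8 * α * consErr X ^ 2 + δ₁ / 5 * b := by
    have e1 := mul_le_mul_of_nonneg_left h5 hM.le
    have e2 : M * (8 * α ^ 2 * consErr X ^ 2) ≤ 8 * α * consErr X ^ 2 := by
      have := mul_le_mul_of_nonneg_right h.αM_le
        (mul_nonneg (mul_nonneg (by norm_num : (0 : ℝ) ≤ 8) h.α_pos.le) (sq_nonneg (consErr X)))
      linarith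
    have e3 : M * b ^ 2 ≤ δ₁ / 10 * b := by
      have f1 : M * b ≤ M * (α * δ₁ / 10) := mul_le_mul_of_nonneg_left hb hM.le
      have f2 := mul_le_mul_of_nonneg_right h.αM_le h.δ₁_pos.le
      have f3 : M * b ≤ δ₁ / 10 := by linarith
      have := mul_le_mul_of_nonneg_right f3 hb0
      linarith
    linarith
  rw [h1]
  refine (norm_add_le _ _).trans ?_
  rw [norm_smul, Real.norm_of_nonneg (half_pos h.α_pos).le]
  have h7 := mul_le_mul_of_nonneg_left h3 (half_pos h.α_pos).le
  have h8 := mul_nonneg h.α_pos.le (sq_nonneg (consErr X))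
  have h9 := mul_nonneg h.δ₁_pos.le hb0
  linarith

lemma norm_mean_projT_le (hX : ∀ i, X i ∈ stiefel n r) :
    ‖mean (fun i => projT (X i) (Y i))‖ ≤ rms Y :=
  (norm_mean_le_rms _).trans (rms_mono fun i => norm_projT_le (hX i) _)

lemma IsLocal.consErr_nextPoint_le_δ₁ (h : StepBounds n r M α β δ₁ δ₂ A Λ)
    (hX : IsLocal δ₁ δ₂ X) (hw : IsMixing w s) (hY : ∀ i, ‖Y i‖ ≤ 5 * A) :
    consErr (nextPoint w α β X Y) ≤ δ₁ := by
  have h1 := hX.consErr_nextPoint_le (Y := Y) h hw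
  have h2 := h.beta_rms_le hY
  have h3 : (1 - 0.3 * α) * consErr X ≤ (1 - 0.3 * α) * δ₁ :=
    mul_le_mul_of_nonneg_left hX.consErr_le (by linarith [h.α_le])
  have := mul_pos h.α_pos h.δ₁_pos
  linarith

/-- The induced arithmetic mean moves slowly. -/
lemma IsLocal.norm_iam_sub_le (h : StepBounds n r M α β δ₁ δ₂ A Λ) (hX : IsLocal δ₁ δ₂ X)
    (hw : IsMixing w s) (hY : ∀ i, ‖Y i‖ ≤ 5 * A) :
    ‖iam (nextPoint w α β X Y) - iam X‖ ≤ 11 * α * consErr X ^ 2 + 1.1 * (β * rms Y) := by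
  have h1 := hX.norm_mean_nextPoint_sub_le h hw hY
  have hI := isIAM_iam ⟨_, hX.mem 0⟩ (nextPoint w α β X Y)
  have hc := hX.consErr_nextPoint_le_δ₁ h hw hY
  have hδ := h.δ₁_le_one
  have hδ0 := h.δ₁_pos
  -- Both consensus errors are at most 1/640, so half their squares are below 1/1000 and the
  -- Lipschitz constant is 1 / 0.999.
  have h2 := hI.lipschitz h.retraction (nextPoint_mem w α β hX.mem Y) hX.mem hX.isIAM (η := 1 / 1000)
    (by
      change consErr _ ^ 2 / 2 ≤ _
      nlinarith [consErr_nonneg (nextPoint w α β X Y)])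
    (by
      change consErr _ ^ 2 / 2 ≤ _
      nlinarith [consErr_nonneg X, hX.consErr_le])
  have h3 : ‖mean (nextPoint w α β X Y) - mean X‖
      ≤ 10 * α * consErr X ^ 2 + δ₁ * (β * rms Y) + β * rms Y := by
    have e1 := norm_sub_le (mean (nextPoint w α β X Y) - mean X
      + β • mean (fun i => projT (X i) (Y i))) (β • mean (fun i => projT (X i) (Y i)))
    rw [add_sub_cancel_right, norm_smul, Real.norm_of_nonneg h.β_pos.le] at e1
    have e2 := mul_le_mul_of_nonneg_left (norm_mean_projT_le (Y := Y) hX.mem) h.β_pos.le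
    linarith
  have hb0 : 0 ≤ β * rms Y := mul_nonneg h.β_pos.le (rms_nonneg Y)
  have he0 := mul_nonneg h.α_pos.le (sq_nonneg (consErr X))
  have h4 := mul_le_mul_of_nonneg_right hδ hb0
  linarith

/-- The local region is invariant. -/
lemma IsLocal.nextPoint (h : StepBounds n r M α β δ₁ δ₂ A Λ) (hX : IsLocal δ₁ δ₂ X)
    (hw : IsMixing w s) (hY : ∀ i, ‖Y i‖ ≤ 5 * A) :
    IsLocal δ₁ δ₂ (nextPoint w α β X Y) where
  mem := nextPoint_mem w α β hX.mem Y
  isIAM := isIAM_iam ⟨_, hX.mem 0⟩ _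
  consErr_le := hX.consErr_nextPoint_le_δ₁ h hw hY
  dist_le i := by
    have h1 := norm_nextPoint_sub_le (Y := Y) hw.toIsDoublyStochastic h.α_pos.le h.α_le h.β_pos.le
      hX.mem hX.isIAM.1 i
    have h2 := hX.norm_iam_sub_le h hw hY
    have h3 := norm_sub_le (StiefelTracking.nextPoint w α β X Y i - iam X)
      (iam (StiefelTracking.nextPoint w α β X Y) - iam X)
    rw [sub_sub_sub_cancel_right] at h3
    have hα := h.α_pos.le
    have h4 := mul_le_mul_of_nonneg_left ((hX.norm_mix_dev_le h hw i)) hα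
    have h5 := mul_le_mul_of_nonneg_left (hX.norm_spread_le h hw i) (half_pos h.α_pos).le
    have h6 := (mul_le_mul_of_nonneg_left (hY i) h.β_pos.le).trans h.βA_le
    have h7 := h.beta_rms_le hY
    have h8 : (1 - α) * ‖X i - iam X‖ ≤ (1 - α) * δ₂ :=
      mul_le_mul_of_nonneg_left (hX.dist_le i) (by linarith [h.α_le])
    have h9 := mul_le_mul_of_nonneg_left hX.consErr_le hα
    have h10 := mul_le_mul_of_nonneg_left (hX.consErr_sq_le h) hα
    -- The step gives up α δ₂ of the old distance. Every other term is of order α δ₁, absorbed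
    -- through 5 δ₁ ≤ δ₂, or is the 0.17 α δ₂ of the curvature.
    have h11 := mul_le_mul_of_nonneg_left h.δ₁_le' hα
    have h12 := mul_nonneg hα h.δ₁_pos.le
    linarith

/-! ### Descent of the cost -/

lemma norm_mean_oracle_le {f : Fin N → Mat n r → ℝ} (hf : ∀ i, Differentiable ℝ (f i)) {Λ : ℝ}
    (hΛ : 0 ≤ Λ) (hlip : ∀ i, ∀ Z ∈ stiefel n r, ∀ Z' ∈ stiefel n r,
      ‖rgrad (f i) Z - rgrad (f i) Z'‖ ≤ Λ * ‖Z - Z'‖)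
    {S : Fin N → Mat n r} (hX : IsLocal δ₁ δ₂ X) :
    ‖mean S - rgrad (avgCost f) (iam X)‖ ≤ Λ * consErr X
      + rms (fun i => S i - rgrad (f i) (X i)) := by
  have h1 : mean S - rgrad (avgCost f) (iam X)
      = mean (fun i => rgrad (f i) (X i) - rgrad (f i) (iam X))
        + mean (fun i => S i - rgrad (f i) (X i)) := by
    rw [rgrad_avgCost hf, mean_sub, mean_sub]; abel
  rw [h1]
  refine (norm_add_le _ _).trans (add_le_add ?_ (norm_mean_le_rms _))
  have h2 : ∀ i, ‖rgrad (f i) (X i) - rgrad (f i) (iam X)‖ ≤ ‖Λ * ‖X i - iam X‖‖ := fun i =>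
    (hlip i _ (hX.mem i) _ hX.isIAM.1).trans (le_abs_self _)
  refine (norm_mean_le_rms _).trans ((rms_mono h2).trans ?_)
  rw [rms_mul_left _ hΛ, rms_norm]
  exact le_rfl

/-- One step decreases the cost at the induced arithmetic mean. -/
lemma IsLocal.descent {f : Fin N → Mat n r → ℝ} {L B : ℝ} (hL : 0 ≤ L)
    (hf : ∀ i, LSmooth L (f i)) (hB : ∀ i, ∀ Z ∈ stiefel n r, ‖egrad (f i) Z‖ ≤ B)
    (h : StepBounds n r M α β δ₁ δ₂ A (L + 2 * B)) (hX : IsLocal δ₁ δ₂ X)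
    (hw : IsMixing w s) (hY : ∀ i, ‖Y i‖ ≤ 5 * A) {S : Fin N → Mat n r} (hYS : mean Y = mean S) :
    avgCost f (iam (StiefelTracking.nextPoint w α β X Y)) ≤ avgCost f (iam X)
      - 0.7 * β * ‖rgrad (avgCost f) (iam X)‖ ^ 2
      + β * rms (fun i => S i - rgrad (f i) (X i)) ^ 2
      + 2.2 * δ₁ * β * rms Y ^ 2 + 6 * δ₁ * (α ^ 2 / β * consErr X ^ 2) := by
  set φ := avgCost f with hφ
  set Z := iam X with hZdef
  set Z' := iam (StiefelTracking.nextPoint w α β X Y) with hZ'def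
  set γ := rgrad φ Z with hγdef
  have hX' := hX.nextPoint h hw hY
  have hZ : Z ∈ stiefel n r := hX.isIAM.1
  have hZ' : Z' ∈ stiefel n r := hX'.isIAM.1
  have hγ : γ ∈ tangent Z := rgrad_mem_tangent hZ φ
  have hdiff : ∀ i, Differentiable ℝ (f i) := fun i => (hf i).1
  have hlip : ∀ i, ∀ V ∈ stiefel n r, ∀ V' ∈ stiefel n r,
      ‖rgrad (f i) V - rgrad (f i) V'‖ ≤ (L + 2 * B) * ‖V - V'‖ := fun i V hV V' hV' =>
    (hf i).rgrad_lipschitz hV hV' (hB i V' hV')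
  have h1 := (lsmooth_avgCost hf).le_add_rgrad hL hZ hZ'
    (norm_egrad_avgCost_le hdiff fun i => hB i Z hZ)
  obtain ⟨H, hH, hXH, -⟩ := hX.isIAM.exists_factor h.retraction hX.mem
  obtain ⟨H', hH', hXH', hHn⟩ := hX'.isIAM.exists_factor h.retraction hX'.mem
  change ‖H' - 1‖ ≤ consErr _ ^ 2 / 2 at hHn
  have hHn' : ‖H' - 1‖ ≤ δ₁ ^ 2 := by
    have := pow_le_pow_left₀ (consErr_nonneg _) hX'.consErr_le 2
    have := sq_nonneg δ₁
    linarith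
  set E := mean (StiefelTracking.nextPoint w α β X Y) - mean X
    + β • mean (fun i => projT (X i) (Y i)) with hE
  have hEn : ‖E‖ ≤ _ := hX.norm_mean_nextPoint_sub_le h hw hY
  -- Both Euclidean means are written through their polar factors, and Z' (H' - 1) is split at Z so
  -- that normal terms at the single point Z can be isolated.
  have hdec : Z' - Z = E - β • mean (fun i => projT (X i) (Y i)) - (Z' - Z) * (H' - 1)
      - Z * (H' - 1) + Z * (H - 1) := by
    rw [hE, hXH, hXH', Matrix.sub_mul, Matrix.mul_sub, Matrix.mul_sub, Matrix.mul_sub,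
      Matrix.mul_one, Matrix.mul_one]
    abel
  clear_value E
  have hP : mean (fun i => projT (X i) (Y i))
      = mean (fun i => projT (X i) (Y i) - projT Z (Y i)) + projT Z (mean S) := by
    rw [mean_sub, mean_projT, hYS]; abel
  have hin : inner ℝ γ (Z' - Z) = inner ℝ γ E
      - β * (inner ℝ γ (mean (fun i => projT (X i) (Y i) - projT Z (Y i)))
        + (‖γ‖ ^ 2 + inner ℝ γ (mean S - γ)))
      - inner ℝ γ ((Z' - Z) * (H' - 1)) := by
    -- The terms Z (H' - 1) and Z (H - 1) are normal at Z and do not meet the tangent vector γ,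
    -- although they are as large as the squared consensus error.
    have e1 : inner ℝ γ (Z * (H' - 1)) = 0 :=
      inner_tangent_mul_sym hγ (by rw [Matrix.transpose_sub, hH', Matrix.transpose_one])
    have e2 : inner ℝ γ (Z * (H - 1)) = 0 :=
      inner_tangent_mul_sym hγ (by rw [Matrix.transpose_sub, hH, Matrix.transpose_one])
    have e3 : inner ℝ γ (projT Z (mean S)) = ‖γ‖ ^ 2 + inner ℝ γ (mean S - γ) := by
      rw [inner_projT_of_tangent hγ, inner_sub_right, real_inner_self_eq_norm_sq]; ring
    conv_lhs => rw [hdec, hP]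
    rw [inner_add_right, inner_sub_right, inner_sub_right, inner_sub_right, inner_smul_right,
      inner_add_right, e1, e2, e3]
    ring
  have hg := norm_nonneg γ
  have b1 : inner ℝ γ E ≤ ‖γ‖ * (10 * α * consErr X ^ 2 + δ₁ * (β * rms Y)) :=
    (real_inner_le_norm _ _).trans (mul_le_mul_of_nonneg_left hEn hg)
  have b2 : -(‖γ‖ * (2 * (consErr X * rms Y)))
      ≤ inner ℝ γ (mean (fun i => projT (X i) (Y i) - projT Z (Y i))) := by
    have e1 : ‖mean (fun i => projT (X i) (Y i) - projT Z (Y i))‖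
        ≤ 2 * (consErr X * rms Y) := by
      refine (norm_mean_le _).trans ?_
      have e2 := mean_mul_le (fun i => ‖X i - Z‖) (fun i => ‖Y i‖)
      rw [rms_norm, rms_norm] at e2
      refine le_trans ?_ (mul_le_mul_of_nonneg_left e2 (by norm_num : (0 : ℝ) ≤ 2))
      rw [mul_left_comm (2 : ℝ)]
      refine mul_le_mul_of_nonneg_left ?_ (by positivity)
      rw [Finset.mul_sum]
      refine Finset.sum_le_sum fun i _ => ?_
      rw [← mul_assoc]
      exact norm_projT_sub_projT_le (hX.mem i) hZ (Y i)
    have e2 := (abs_le.1 (abs_real_inner_le_norm γ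
      (mean (fun i => projT (X i) (Y i) - projT Z (Y i))))).1
    have e3 := mul_le_mul_of_nonneg_left e1 hg
    linarith
  have b3 : -(‖γ‖ * ((L + 2 * B) * consErr X + rms (fun i => S i - rgrad (f i) (X i))))
      ≤ inner ℝ γ (mean S - γ) := by
    have e2 := (abs_le.1 (abs_real_inner_le_norm γ (mean S - γ))).1
    have e3 := mul_le_mul_of_nonneg_left (norm_mean_oracle_le hdiff h.Λ_nonneg hlip hX (S := S)) hg
    linarith
  have b4 : -(‖γ‖ * ‖Z' - Z‖ * δ₁ ^ 2) ≤ inner ℝ γ ((Z' - Z) * (H' - 1)) := by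
    have e2 := (abs_le.1 (abs_real_inner_le_norm γ ((Z' - Z) * (H' - 1)))).1
    have e3 := (Matrix.frobenius_norm_mul (Z' - Z) (H' - 1)).trans
      (mul_le_mul_of_nonneg_left hHn' (norm_nonneg _))
    have e4 := mul_le_mul_of_nonneg_left e3 hg
    linarith
  have key := descent_bound (ν := rms (fun i => S i - rgrad (f i) (X i))) h.α_pos.le h.α_le h.β_pos
    h.δ₁_pos.le h.δ₁_le_one h.Λ_nonneg h.βΛ_le hg (consErr_nonneg X) hX.consErr_le (rms_nonneg Y)
    (norm_nonneg (Z' - Z)) (hX.norm_iam_sub_le h hw hY)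
  have b5 := mul_le_mul_of_nonneg_left b2 h.β_pos.le
  have b6 := mul_le_mul_of_nonneg_left b3 h.β_pos.le
  rw [hin] at h1
  linarith

/-! ### Gradient tracking -/

lemma rms_sub_mean_le (U : Fin N → Mat n r) : rms (fun i => U i - mean U) ≤ rms U := by
  have h1 := rms_sq_eq_mean_add U
  have h2 := sq_nonneg ‖mean U‖
  exact le_of_sq_le_sq (by linarith) (rms_nonneg U)

/-- Contraction of the tracking error. -/
lemma rms_tracking_le (hw : IsMixing w s) {Y Y' S S' : Fin N → Mat n r}
    (hY' : ∀ i, Y' i = mix w Y i + S' i - S i) :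
    rms (fun i => Y' i - mean Y') ≤ 1 / 2 * rms (fun i => Y i - mean Y)
      + rms (fun i => S' i - S i) := by
  have hmean : mean Y' = mean Y + mean (fun i => S' i - S i) := by
    have : Y' = fun i => mix w Y i + (S' i - S i) := funext fun i => by rw [hY', add_sub_assoc]
    rw [this, mean_add]
    congr 1
    exact mean_mix hw.toIsDoublyStochastic Y
  have h1 : (fun i => Y' i - mean Y') = fun i => (mix w (fun j => Y j - mean Y) i)
      + ((S' i - S i) - mean (fun i => S' i - S i)) := funext fun i => by
    rw [hmean, hY', mix_sub, mix_const hw.toIsDoublyStochastic]; abel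
  rw [h1]
  refine (rms_add_le _ _).trans (add_le_add ?_ (rms_sub_mean_le _))
  have h2 := hw.rms_mix_le' (fun j => Y j - mean Y)
  have h3 : mean (fun j => Y j - mean Y) = 0 := by rw [mean_sub, mean_const, sub_self]
  rw [h3, norm_zero, zero_add] at h2
  exact h2.trans (mul_le_mul_of_nonneg_right hw.s_le (rms_nonneg _))

/-- The trackers stay bounded. -/
lemma norm_tracker_sub_le (hw : IsMixing w s) {Y Y' S S' : Fin N → Mat n r}
    (hY' : ∀ i, Y' i = mix w Y i + S' i - S i) (hA : 0 ≤ A) (hS : ∀ i, ‖S i‖ ≤ A)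
    (hmean : mean Y = mean S) (hY : ∀ i, ‖Y i - S i‖ ≤ 4 * A) (i : Fin N) :
    ‖Y' i - S' i‖ ≤ 4 * A := by
  have h1 : Y' i - S' i = mix w (fun j => Y j - S j) i + (mix w S i - S i) := by
    rw [hY', mix_sub]; abel
  rw [h1]
  have h2 := hw.norm_mix_le (fun j => Y j - S j) i
  rw [mean_sub, ← hmean, sub_self, norm_zero, zero_add] at h2
  have h3 : rms (fun j => Y j - S j) ≤ 4 * A := rms_le_of_forall (by linarith) hY
  have h4 := norm_mix_le_of_forall hw.toIsDoublyStochastic hS i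
  have h5 := norm_sub_le (mix w S i) (S i)
  have h6 := norm_add_le (mix w (fun j => Y j - S j) i) (mix w S i - S i)
  have h7 := hS i
  linarith

end Progress

/-! ### Summation of the recursions -/

/-- Convexity of the square for the weights 1 - θ and θ, applied to a and b / θ, gives a'² ≤ (1 - θ)
a² + b² / θ, which telescopes. -/
lemma sum_sq_le_of_contraction {θ : ℝ} (hθ : 0 < θ) (hθ' : θ ≤ 1) {a b : ℕ → ℝ}
    (ha : ∀ k, 0 ≤ a k) (h : ∀ k, a (k + 1) ≤ (1 - θ) * a k + b k) (K : ℕ) :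
    θ * ∑ k ∈ Finset.range (K + 1), a k ^ 2
      ≤ a 0 ^ 2 + (∑ k ∈ Finset.range K, b k ^ 2) / θ := by
  have hsq : ∀ k, a (k + 1) ^ 2 ≤ (1 - θ) * a k ^ 2 + b k ^ 2 / θ := fun k => by
    refine (pow_le_pow_left₀ (ha _) (h k) 2).trans ?_
    have h1 : (1 - θ) * a k ^ 2 + b k ^ 2 / θ - ((1 - θ) * a k + b k) ^ 2
        = (1 - θ) / θ * (θ * a k - b k) ^ 2 := by field_simp; ring
    have h2 : 0 ≤ (1 - θ) / θ * (θ * a k - b k) ^ 2 :=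
      mul_nonneg (div_nonneg (by linarith) hθ.le) (sq_nonneg _)
    linarith
  -- The extra term (1 - θ) a_K² is what the next inductive step consumes.
  have key : ∀ K, θ * ∑ k ∈ Finset.range (K + 1), a k ^ 2 + (1 - θ) * a K ^ 2
      ≤ a 0 ^ 2 + (∑ k ∈ Finset.range K, b k ^ 2) / θ := fun K => by
    induction K with
    | zero => simp; linarith
    | succ K ih =>
      rw [Finset.sum_range_succ, Finset.sum_range_succ (fun k => b k ^ 2), add_div]
      have := hsq K
      linarith
  have h1 := key K
  have h2 : 0 ≤ (1 - θ) * a K ^ 2 := mul_nonneg (by linarith) (sq_nonneg _)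
  linarith

lemma sum_range_shift_le {a : ℕ → ℝ} (ha : ∀ k, 0 ≤ a k) (K : ℕ) :
    ∑ k ∈ Finset.range K, a (k + 1) ≤ ∑ k ∈ Finset.range (K + 1), a k := by
  rw [Finset.sum_range_succ' a]; linarith [ha 0]

lemma sum_range_le_succ {a : ℕ → ℝ} (ha : ∀ k, 0 ≤ a k) (K : ℕ) :
    ∑ k ∈ Finset.range K, a k ≤ ∑ k ∈ Finset.range (K + 1), a k := by
  rw [Finset.sum_range_succ]; linarith [ha K]

/-- Scalar quantities measuring the progress along a trajectory: consensus error `e`, tracking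
error `V`, size `y` of the trackers, gradient norm `g`, oracle error `ν`, cost `φ`. -/
structure ProgressBounds (α β δ Λ C V₀ : ℝ) (e V y g ν φ : ℕ → ℝ) : Prop where
  e_nonneg : ∀ k, 0 ≤ e k
  V_nonneg : ∀ k, 0 ≤ V k
  e_zero : e 0 ≤ 1
  V_zero : V 0 ≤ V₀
  φ_le : ∀ k, |φ k| ≤ C
  e_succ : ∀ k, e (k + 1) ≤ (1 - 0.3 * α) * e k + β * y k
  V_succ : ∀ k, V (k + 1) ≤ 1 / 2 * V k + (Λ * (2 * α * e k + β * y k) + ν (k + 1) + ν k)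
  y_sq : ∀ k, y k ^ 2 ≤ V k ^ 2 + 3 * (g k ^ 2 + Λ ^ 2 * e k ^ 2 + ν k ^ 2)
  φ_succ : ∀ k, φ (k + 1) ≤ φ k - 0.7 * β * g k ^ 2 + β * ν k ^ 2
    + 2.2 * δ * β * y k ^ 2 + 6 * δ * (α ^ 2 / β * e k ^ 2)

/-- The four sums bound one another cyclically: e by y, V by y and ν, y by g and ν, and g by δ times
y and ν. The loop closes because δ ≤ 1/640. The bound is fixed before the sequences are given, which
later makes it independent of the sample sizes. -/
lemma exists_progress_bound {α β δ Λ : ℝ} (C V₀ : ℝ) (hα : 0 < α) (hα' : α ≤ 1) (hβ : 0 < β)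
    (hΛ : 0 ≤ Λ) (hδ : 0 < δ) (hδ' : δ ≤ α / 640) (hβΛ : β * Λ ≤ α * δ / 5) :
    ∃ B, 0 ≤ B ∧ ∀ e V y g ν φ : ℕ → ℝ, ProgressBounds α β δ Λ C V₀ e V y g ν φ → ∀ K,
      ∑ k ∈ Finset.range (K + 1), g k ^ 2 ≤ B + 13 * ∑ k ∈ Finset.range (K + 1), ν k ^ 2 ∧
      ∑ k ∈ Finset.range (K + 1), e k ^ 2
        ≤ B + 1000 * (β / α) ^ 2 * ∑ k ∈ Finset.range (K + 1), ν k ^ 2 := by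
  set p := (β / α) ^ 2 with hp
  have hp0 : 0 ≤ p := sq_nonneg _
  set E₀ := 4 / α with hE₀
  have hE₀0 : 0 ≤ E₀ := by positivity
  set c₁ := 2 * V₀ ^ 2 + 64 * (Λ ^ 2 * E₀) with hc₁
  set c₂ := c₁ + 3 * (Λ ^ 2 * E₀) with hc₂
  have hc₂0 : 0 ≤ c₂ := by positivity
  set c₃ := 2 * |C| / β + 6 * δ * (α ^ 2 / β ^ 2 * E₀) with hc₃
  have hc₃0 : 0 ≤ c₃ := by positivity
  set B₁ := 3 * (c₃ + c₂) with hB₁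
  have hB₁0 : 0 ≤ B₁ := by positivity
  set B₂ := E₀ + 11.3 * p * (c₂ + 3 * B₁) with hB₂
  have hB₂0 : 0 ≤ B₂ := by positivity
  refine ⟨B₁ + B₂, by positivity, fun e V y g ν φ h K => ?_⟩
  set E := ∑ k ∈ Finset.range (K + 1), e k ^ 2 with hE
  set VV := ∑ k ∈ Finset.range (K + 1), V k ^ 2 with hVV
  set Z := ∑ k ∈ Finset.range (K + 1), y k ^ 2 with hZ
  set G := ∑ k ∈ Finset.range (K + 1), g k ^ 2 with hG
  set S := ∑ k ∈ Finset.range (K + 1), ν k ^ 2 with hS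
  have hE0 : 0 ≤ E := Finset.sum_nonneg fun _ _ => sq_nonneg _
  have hZ0 : 0 ≤ Z := Finset.sum_nonneg fun _ _ => sq_nonneg _
  have hG0 : 0 ≤ G := Finset.sum_nonneg fun _ _ => sq_nonneg _
  have hS0 : 0 ≤ S := Finset.sum_nonneg fun _ _ => sq_nonneg _
  have hδ1 : δ ≤ 1 / 640 := by linarith
  -- consensus error
  have h1 : E ≤ E₀ + 11.2 * (p * Z) := by
    have e1 := sum_sq_le_of_contraction (θ := 0.3 * α) (by positivity) (by linarith) h.e_nonneg
      h.e_succ K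
    have e2 : ∑ k ∈ Finset.range K, (β * y k) ^ 2 ≤ β ^ 2 * Z := by
      simp only [mul_pow, ← Finset.mul_sum]
      exact mul_le_mul_of_nonneg_left (sum_range_le_succ (fun k => sq_nonneg (y k)) K)
        (sq_nonneg β)
    have e3 : e 0 ^ 2 ≤ 1 := pow_le_one₀ (h.e_nonneg 0) h.e_zero
    have e4 : 0.3 * α * E ≤ 1 + β ^ 2 * Z / (0.3 * α) := by
      have := div_le_div_of_nonneg_right e2 (by positivity : 0 ≤ 0.3 * α)
      linarith
    have e5 : E ≤ (1 + β ^ 2 * Z / (0.3 * α)) / (0.3 * α) := by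
      rw [le_div_iff₀ (by positivity)]; linarith
    have e6 : (1 + β ^ 2 * Z / (0.3 * α)) / (0.3 * α) = 10 / 3 / α + 100 / 9 * (p * Z) := by
      rw [hp]; field_simp; ring
    have e7 : 10 / 3 / α ≤ E₀ := by rw [hE₀]; gcongr; norm_num
    have e8 := mul_nonneg hp0 hZ0
    linarith
  -- That Λ β and Λ β / α are both at most 1/3200 makes the feedback of the movement of the points
  -- into the tracking error negligible.
  have hΛβ : Λ * β ≤ 1 / 3200 := by
    have := mul_le_mul_of_nonneg_right hα' hδ.le
    linarith
  have hΛβ2 : Λ ^ 2 * β ^ 2 ≤ 1 / 10000000 := by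
    have := pow_le_pow_left₀ (mul_nonneg hΛ hβ.le) hΛβ 2
    rw [mul_pow] at this
    linarith
  have hΛp : Λ ^ 2 * p ≤ 1 / 10000000 := by
    have e1 : Λ * (β / α) ≤ 1 / 3200 := by
      rw [← mul_div_assoc, div_le_iff₀ hα]
      have := mul_le_mul_of_nonneg_left hδ1 hα.le
      linarith
    have := pow_le_pow_left₀ (by positivity) e1 2
    rw [mul_pow] at this
    linarith
  have hΛE : Λ ^ 2 * E ≤ Λ ^ 2 * E₀ + 2 / 1000000 * Z := by
    have e1 := mul_le_mul_of_nonneg_left h1 (sq_nonneg Λ)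
    have e2 := mul_le_mul_of_nonneg_right hΛp hZ0
    linarith
  -- tracking error
  have h2 : VV ≤ c₁ + 0.0002 * Z + 32 * S := by
    have e1 := sum_sq_le_of_contraction (θ := 1 / 2) (by norm_num) (by norm_num) h.V_nonneg
      (fun k => (h.V_succ k).trans (by rw [show (1 : ℝ) - 1 / 2 = 1 / 2 by norm_num])) K
    have e2 : ∀ k, (Λ * (2 * α * e k + β * y k) + ν (k + 1) + ν k) ^ 2
        ≤ 16 * (Λ ^ 2 * e k ^ 2) + 4 * (Λ ^ 2 * β ^ 2) * y k ^ 2 + 4 * ν (k + 1) ^ 2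
          + 4 * ν k ^ 2 := fun k => by
      have f1 : (Λ * (2 * α * e k + β * y k) + ν (k + 1) + ν k) ^ 2
          ≤ 4 * (4 * (α ^ 2 * (Λ ^ 2 * e k ^ 2)) + Λ ^ 2 * β ^ 2 * y k ^ 2 + ν (k + 1) ^ 2
            + ν k ^ 2) := by
        have g1 := sq_nonneg (Λ * (2 * α * e k) - Λ * (β * y k))
        have g2 := sq_nonneg (Λ * (2 * α * e k) - ν (k + 1))
        have g3 := sq_nonneg (Λ * (2 * α * e k) - ν k)
        have g4 := sq_nonneg (Λ * (β * y k) - ν (k + 1))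
        have g5 := sq_nonneg (Λ * (β * y k) - ν k)
        have g6 := sq_nonneg (ν (k + 1) - ν k)
        linarith
      have f2 : α ^ 2 * (Λ ^ 2 * e k ^ 2) ≤ Λ ^ 2 * e k ^ 2 :=
        mul_le_of_le_one_left (by positivity) (pow_le_one₀ hα.le hα')
      linarith
    have e3 : ∑ k ∈ Finset.range K, (Λ * (2 * α * e k + β * y k) + ν (k + 1) + ν k) ^ 2
        ≤ 16 * (Λ ^ 2 * E) + 4 * (Λ ^ 2 * β ^ 2) * Z + 8 * S := by
      refine (Finset.sum_le_sum fun k _ => e2 k).trans ?_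
      simp only [Finset.sum_add_distrib, ← Finset.mul_sum]
      have f1 := mul_le_mul_of_nonneg_left
        (sum_range_le_succ (fun k => sq_nonneg (e k)) K) (sq_nonneg Λ)
      have f2 := mul_le_mul_of_nonneg_left (sum_range_le_succ (fun k => sq_nonneg (y k)) K)
        (by positivity : 0 ≤ 4 * (Λ ^ 2 * β ^ 2))
      have f3 := sum_range_le_succ (fun k => sq_nonneg (ν k)) K
      have f4 := sum_range_shift_le (fun k => sq_nonneg (ν k)) K
      linarith
    have e4 : V 0 ^ 2 ≤ V₀ ^ 2 := pow_le_pow_left₀ (h.V_nonneg 0) h.V_zero 2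
    have e5 := mul_le_mul_of_nonneg_right hΛβ2 hZ0
    rw [hc₁]
    linarith
  -- trackers
  have h3 : Z ≤ 1.001 * (c₂ + 3 * G + 35 * S) := by
    have e1 : Z ≤ VV + 3 * (G + Λ ^ 2 * E + S) := by
      refine (Finset.sum_le_sum fun k _ => h.y_sq k).trans_eq ?_
      simp only [Finset.sum_add_distrib, ← Finset.mul_sum, hVV, hG, hE, hS]
    rw [hc₂]
    linarith
  -- cost
  have h4 : 0.7 * G ≤ c₃ + S + 69.4 * (δ * Z) := by
    have e1 : ∀ J, φ J ≤ φ 0 + ∑ k ∈ Finset.range J, (-(0.7 * β * g k ^ 2) + β * ν k ^ 2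
        + 2.2 * δ * β * y k ^ 2 + 6 * δ * (α ^ 2 / β * e k ^ 2)) := fun J => by
      induction J with
      | zero => simp
      | succ J ih =>
        rw [Finset.sum_range_succ]
        have := h.φ_succ J
        linarith
    have e2 := e1 (K + 1)
    simp only [Finset.sum_add_distrib, Finset.sum_neg_distrib, ← Finset.mul_sum] at e2
    have e3 := (abs_le.1 (h.φ_le (K + 1))).1
    have e4 := (abs_le.1 (h.φ_le 0)).2
    have e5 := le_abs_self C
    have e6 : 0.7 * β * G ≤ 2 * |C| + β * S + 2.2 * δ * β * Z + 6 * δ * (α ^ 2 / β * E) := by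
      linarith
    have e7 : α ^ 2 / β * E ≤ β * (α ^ 2 / β ^ 2 * E₀) + 11.2 * (β * Z) := by
      have f1 := mul_le_mul_of_nonneg_left h1 (by positivity : 0 ≤ α ^ 2 / β)
      have f2 : α ^ 2 / β * (E₀ + 11.2 * (p * Z))
          = β * (α ^ 2 / β ^ 2 * E₀) + 11.2 * (β * Z) := by
        rw [hp]; field_simp
      linarith
    have e8 := mul_le_mul_of_nonneg_left e7 hδ.le
    have e9 : β * (2 * |C| / β) = 2 * |C| := by field_simp
    have e10 : β * (0.7 * G) ≤ β * (c₃ + S + 69.4 * (δ * Z)) := by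
      rw [hc₃, mul_add, mul_add, mul_add, e9]
      linarith
    exact le_of_mul_le_mul_left e10 hβ
  -- With δ ≤ 1/640 the term 69.4 δ Z contains only about 0.33 G, which the left side 0.7 G absorbs;
  -- the remaining noise coefficient is just below 13.
  have h5 : G ≤ B₁ + 13 * S := by
    have e1 := mul_le_mul_of_nonneg_right hδ1 hZ0
    rw [hB₁]
    linarith
  refine ⟨by linarith, ?_⟩
  -- Here 74 = 3 · 13 + 35; multiplied by 11.2 it stays below 1000.
  have h6 : Z ≤ 1.001 * (c₂ + 3 * B₁ + 74 * S) := by linarith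
  have h7 := mul_le_mul_of_nonneg_left h6 hp0
  have h8 := mul_nonneg hp0 hS0
  have h9 := mul_nonneg hp0 (by positivity : 0 ≤ c₂ + 3 * B₁)
  rw [hB₂]
  linarith

/-! ### Invariants and recursions along one trajectory -/

section Trajectory

attribute [local instance] Matrix.frobeniusNormedAddCommGroup Matrix.frobeniusNormedSpace
  frobeniusInnerProductSpace

variable {n r N : ℕ} {w : Matrix (Fin N) (Fin N) ℝ} [NeZero N] {s M α β δ₁ δ₂ A Λ : ℝ}

/-- A trajectory of the algorithm with the gradient estimates `S`. -/
structure IsTrajectory (w : Matrix (Fin N) (Fin N) ℝ) (α β A : ℝ) (X Y S : ℕ → Fin N → Mat n r) :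
    Prop where
  zero : Y 0 = S 0
  X_succ : ∀ k, X (k + 1) = nextPoint w α β (X k) (Y k)
  Y_succ : ∀ k i, Y (k + 1) i = mix w (Y k) i + S (k + 1) i - S k i
  bound : ∀ k i, X k i ∈ stiefel n r → ‖S k i‖ ≤ A

lemma IsTrajectory.invariant {X Y S : ℕ → Fin N → Mat n r} (hT : IsTrajectory w α β A X Y S)
    (h : StepBounds n r M α β δ₁ δ₂ A Λ) (hw : IsMixing w s) (hX : IsLocal δ₁ δ₂ (X 0)) (k : ℕ) :
    IsLocal δ₁ δ₂ (X k) ∧ mean (Y k) = mean (S k) ∧ ∀ i, ‖Y k i - S k i‖ ≤ 4 * A := by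
  induction k with
  | zero =>
    refine ⟨hX, by rw [hT.zero], fun i => ?_⟩
    rw [hT.zero, sub_self, norm_zero]; linarith [h.A_nonneg]
  | succ k ih =>
    obtain ⟨h1, h2, h3⟩ := ih
    have hS : ∀ i, ‖S k i‖ ≤ A := fun i => hT.bound k i (h1.mem i)
    refine ⟨?_, mean_tracker hw (hT.Y_succ k) h2,
      norm_tracker_sub_le hw (hT.Y_succ k) h.A_nonneg hS h2 h3⟩
    rw [hT.X_succ]
    refine h1.nextPoint h hw fun i => ?_
    have := norm_add_le (Y k i - S k i) (S k i)
    rw [sub_add_cancel] at this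
    linarith [h3 i, hS i]

lemma IsTrajectory.norm_tracker_le {X Y S : ℕ → Fin N → Mat n r} (hT : IsTrajectory w α β A X Y S)
    (h : StepBounds n r M α β δ₁ δ₂ A Λ) (hw : IsMixing w s) (hX : IsLocal δ₁ δ₂ (X 0)) (k : ℕ)
    (i : Fin N) : ‖Y k i‖ ≤ 5 * A := by
  obtain ⟨h1, -, h3⟩ := hT.invariant h hw hX k
  have := norm_add_le (Y k i - S k i) (S k i)
  rw [sub_add_cancel] at this
  linarith [h3 i, hT.bound k i (h1.mem i)]

/-- The scalar quantities along a trajectory satisfy the recursions. -/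
lemma IsTrajectory.progressBounds {f : Fin N → Mat n r → ℝ} {L B C : ℝ} (hL : 0 ≤ L)
    (hf : ∀ i, LSmooth L (f i)) (hB : ∀ i, ∀ Z ∈ stiefel n r, ‖egrad (f i) Z‖ ≤ B)
    (hC : ∀ Z ∈ stiefel n r, |avgCost f Z| ≤ C)
    (h : StepBounds n r M α β δ₁ δ₂ A (L + 2 * B)) (hw : IsMixing w s)
    {X Y S : ℕ → Fin N → Mat n r} (hT : IsTrajectory w α β A X Y S)
    (hX : IsLocal δ₁ δ₂ (X 0)) :
    ProgressBounds α β δ₁ (L + 2 * B) C (5 * A) (fun k => consErr (X k))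
      (fun k => rms fun i => Y k i - mean (Y k)) (fun k => rms (Y k))
      (fun k => ‖rgrad (avgCost f) (iam (X k))‖)
      (fun k => rms fun i => S k i - rgrad (f i) (X k i))
      (fun k => avgCost f (iam (X k))) := by
  have hI := hT.invariant h hw hX
  have hY := hT.norm_tracker_le h hw hX
  have hlip : ∀ i, ∀ V ∈ stiefel n r, ∀ V' ∈ stiefel n r,
      ‖rgrad (f i) V - rgrad (f i) V'‖ ≤ (L + 2 * B) * ‖V - V'‖ := fun i V hV V' hV' =>
    (hf i).rgrad_lipschitz hV hV' (hB i V' hV')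
  refine ⟨fun k => consErr_nonneg _, fun k => rms_nonneg _, ?_, ?_,
    fun k => hC _ (hI k).1.isIAM.1, fun k => ?_, fun k => ?_, fun k => ?_, fun k => ?_⟩
  · exact hX.consErr_le.trans (by linarith [h.δ₁_le_one])
  · exact (rms_sub_mean_le _).trans (rms_le_of_forall (by linarith [h.A_nonneg]) (hY 0))
  · simp only [hT.X_succ k]
    exact (hI k).1.consErr_nextPoint_le h hw
  · have h1 := rms_tracking_le hw (hT.Y_succ k)
    have h2 := rms_oracle_sub_le h.Λ_nonneg hlip (hI k).1.mem (hI (k + 1)).1.mem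
      (S := S k) (S' := S (k + 1))
    have h3 := mul_le_mul_of_nonneg_left ((hI k).1.rms_nextPoint_sub_self_le (Y := Y k) h hw)
      h.Λ_nonneg
    rw [← hT.X_succ k] at h3
    linarith
  · have h1 := rms_sq_eq_mean_add (Y k)
    have h2 := norm_mean_oracle_le (fun i => (hf i).1) h.Λ_nonneg hlip (hI k).1 (S := S k)
    rw [← (hI k).2.1] at h2
    have h3 := norm_add_le (mean (Y k) - rgrad (avgCost f) (iam (X k)))
      (rgrad (avgCost f) (iam (X k)))
    rw [sub_add_cancel] at h3
    set g := ‖rgrad (avgCost f) (iam (X k))‖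
    set e := (L + 2 * B) * consErr (X k) with he
    set ν := rms fun i => S k i - rgrad (f i) (X k i)
    have h4 : ‖mean (Y k)‖ ^ 2 ≤ (g + e + ν) ^ 2 :=
      pow_le_pow_left₀ (norm_nonneg _) (by linarith) 2
    have h5 : (L + 2 * B) ^ 2 * consErr (X k) ^ 2 = e ^ 2 := by rw [he, mul_pow]
    simp only [h5]
    nlinarith [sq_nonneg (g - e), sq_nonneg (g - ν), sq_nonneg (e - ν)]
  · have := (hI k).1.descent hL hf hB h hw (hY k) (hI k).2.1
    rw [← hT.X_succ k] at this
    exact this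

end Trajectory

/-! ### Measurability of the iterates -/

/-- The product `σ`-algebra on matrices. -/
abbrev matMeasurableSpace (n r : ℕ) : MeasurableSpace (Mat n r) :=
  inferInstanceAs (MeasurableSpace (Fin n → Fin r → ℝ))

section Measurability

attribute [local instance] Matrix.frobeniusNormedAddCommGroup Matrix.frobeniusNormedSpace
  frobeniusInnerProductSpace matMeasurableSpace

lemma matBorelSpace (n r : ℕ) : BorelSpace (Mat n r) :=
  inferInstanceAs (BorelSpace (Fin n → Fin r → ℝ))

lemma matSecondCountable (n r : ℕ) : SecondCountableTopology (Mat n r) :=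
  inferInstanceAs (SecondCountableTopology (Fin n → Fin r → ℝ))

attribute [local instance] matBorelSpace matSecondCountable

variable {n r N : ℕ} {Ω : Type*} [MeasurableSpace Ω]

lemma measurable_mat {f : Ω → Mat n r} (h : ∀ a b, Measurable fun ω => f ω a b) :
    Measurable f :=
  measurable_pi_lambda _ fun a => measurable_pi_lambda _ fun b => h a b

lemma continuous_projT : Continuous fun p : Mat n r × Mat n r => projT p.1 p.2 := by
  unfold projT; fun_prop

lemma measurable_projT {X Y : Ω → Mat n r} (hX : Measurable X) (hY : Measurable Y) :
    Measurable fun ω => projT (X ω) (Y ω) :=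
  continuous_projT.measurable.comp (hX.prodMk hY)

lemma measurable_mix (w : Matrix (Fin N) (Fin N) ℝ) {U : Ω → Fin N → Mat n r}
    (hU : ∀ j, Measurable fun ω => U ω j) (i : Fin N) : Measurable fun ω => mix w (U ω) i :=
  Finset.measurable_sum _ fun j _ => (hU j).const_smul (w i j)

/-- Composition of a function that is continuous on a closed set with a measurable function. -/
lemma measurable_comp_of_continuousOn {E F : Type*} [TopologicalSpace E] [MeasurableSpace E]
    [BorelSpace E] [TopologicalSpace F] [MeasurableSpace F] [BorelSpace F] {T : Set E} {f : E → F}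
    (hf : ContinuousOn f T) {g : Ω → E} (hg : Measurable g) (hgT : ∀ ω, g ω ∈ T) :
    Measurable fun ω => f (g ω) := by
  have h1 : Measurable (T.domRestrict f) := (continuousOn_iff_continuous_domRestrict.1 hf).measurable
  exact h1.comp (hg.subtype_mk (h := hgT))

/-- Nonexpansiveness in X + v yields continuity without studying how the functional calculus depends
on the matrix. -/
lemma continuousOn_polarRetraction :
    ContinuousOn (fun p : Mat n r × Mat n r => polarRetraction p.1 p.2)
      {p | p.1 ∈ stiefel n r ∧ p.2 ∈ tangent p.1} := by
  intro p hp
  have h1 : Filter.Tendsto (fun q : Mat n r × Mat n r => ‖(q.1 + q.2) - (p.1 + p.2)‖)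
      (nhdsWithin p {p | p.1 ∈ stiefel n r ∧ p.2 ∈ tangent p.1}) (nhds 0) := by
    have : Continuous fun q : Mat n r × Mat n r => ‖(q.1 + q.2) - (p.1 + p.2)‖ := by fun_prop
    have h2 := this.continuousWithinAt (s := {p | p.1 ∈ stiefel n r ∧ p.2 ∈ tangent p.1}) (x := p)
    simpa [ContinuousWithinAt] using h2
  refine tendsto_iff_norm_sub_tendsto_zero.2 (squeeze_zero' ?_ ?_ h1)
  · exact Filter.Eventually.of_forall fun _ => norm_nonneg _
  · filter_upwards [self_mem_nhdsWithin] with q hq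
    exact norm_polarRetraction_sub_polarRetraction_le hq.1 hq.2 hp.1 hp.2

lemma measurable_polarRetraction {X v : Ω → Mat n r} (hX : Measurable X) (hv : Measurable v)
    (hmem : ∀ ω, X ω ∈ stiefel n r) (hvt : ∀ ω, v ω ∈ tangent (X ω)) :
    Measurable fun ω => polarRetraction (X ω) (v ω) :=
  measurable_comp_of_continuousOn continuousOn_polarRetraction (hX.prodMk hv)
    fun ω => ⟨hmem ω, hvt ω⟩

lemma measurable_nextPoint (w : Matrix (Fin N) (Fin N) ℝ) (α β : ℝ) {X Y : Ω → Fin N → Mat n r}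
    (hX : ∀ i, Measurable fun ω => X ω i) (hY : ∀ i, Measurable fun ω => Y ω i)
    (hmem : ∀ ω i, X ω i ∈ stiefel n r) (i : Fin N) :
    Measurable fun ω => nextPoint w α β (X ω) (Y ω) i := by
  refine measurable_polarRetraction (hX i) ?_ (fun ω => hmem ω i)
    fun ω => direction_mem_tangent w α β (hmem ω) _ i
  exact ((measurable_projT (hX i) (measurable_mix w hX i)).const_smul α).sub
    ((measurable_projT (hX i) (hY i)).const_smul β)

variable {Ξ : Fin N → Type*} {W : Matrix (Fin N) (Fin N) ℝ} {t : ℕ}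
  {α β : ℝ} {G : ∀ i, Mat n r → Ξ i → Mat n r} {X₀ : Fin N → Mat n r} {m : ℕ → ℕ}

lemma iterates_mem (hX₀ : ∀ i, X₀ i ∈ stiefel n r) (s : ∀ i, ℕ → ℕ → Ξ i) (k : ℕ) (i : Fin N) :
    (iterates W t α β G X₀ m s k).1 i ∈ stiefel n r := by
  induction k generalizing i with
  | zero => exact hX₀ i
  | succ k ih => exact nextPoint_mem (W ^ t) α β ih _ i

variable [∀ i, MeasurableSpace (Ξ i)]

lemma measurable_oracle {P : ∀ i, Measure (Ξ i)} {f : Fin N → Mat n r → ℝ} {A₁ σ : ℝ}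
    (hG : IsGradientOracle P f G A₁ σ) (i : Fin N) :
    Measurable fun p : Mat n r × Ξ i => G i p.1 p.2 :=
  measurable_mat fun a b => hG.measurable i a b

lemma measurable_batchGrad {P : ∀ i, Measure (Ξ i)} {f : Fin N → Mat n r → ℝ} {A₁ σ : ℝ}
    (hG : IsGradientOracle P f G A₁ σ) {X : Ω → Fin N → Mat n r}
    (hX : ∀ i, Measurable fun ω => X ω i) {s : Ω → ∀ i, ℕ → ℕ → Ξ i} {k : ℕ}
    (hs : ∀ i j, Measurable fun ω => s ω i k j) (i : Fin N) :
    Measurable fun ω => batchGrad G m (s ω) k (X ω) i := by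
  have h : Measurable fun ω => ∑ j ∈ Finset.range (m k), G i (X ω i) (s ω i k j) :=
    Finset.measurable_sum _ fun j _ => (measurable_oracle hG i).comp ((hX i).prodMk (hs i j))
  exact h.const_smul ((m k : ℝ)⁻¹)

/-- The iterates are measurable functions of the samples drawn before. -/
lemma measurable_iterates {P : ∀ i, Measure (Ξ i)} {f : Fin N → Mat n r → ℝ} {A₁ σ : ℝ}
    (hG : IsGradientOracle P f G A₁ σ) (hX₀ : ∀ i, X₀ i ∈ stiefel n r)
    {s : Ω → ∀ i, ℕ → ℕ → Ξ i} {K : ℕ} (hs : ∀ i, ∀ k < K, ∀ j, Measurable fun ω => s ω i k j)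
    (k : ℕ) :
    (k ≤ K → ∀ i, Measurable fun ω => (iterates W t α β G X₀ m (s ω) k).1 i) ∧
    (k < K → ∀ i, Measurable fun ω => (iterates W t α β G X₀ m (s ω) k).2 i) := by
  induction k with
  | zero =>
    refine ⟨fun _ i => measurable_const, fun h i => ?_⟩
    exact measurable_batchGrad hG (X := fun _ => X₀) (fun i => measurable_const)
      (fun i j => hs i 0 h j) i
  | succ k ih =>
    have hX : k + 1 ≤ K → ∀ i,
        Measurable fun ω => (iterates W t α β G X₀ m (s ω) (k + 1)).1 i := fun h i =>
      measurable_nextPoint (W ^ t) α β (ih.1 (by omega)) (ih.2 (by omega))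
        (fun ω => iterates_mem hX₀ (s ω) k) i
    refine ⟨hX, fun h i => ?_⟩
    refine ((measurable_mix (W ^ t) (ih.2 (by omega)) i).add ?_).sub ?_
    · exact measurable_batchGrad hG (hX (by omega)) (fun i j => hs i (k + 1) h j) i
    · exact measurable_batchGrad hG (ih.1 (by omega)) (fun i j => hs i k (by omega) j) i

/-! ### The variance of the averaged samples -/

/-- Averages of independent centred bounded variables. -/
lemma integral_sq_avg_le {μ : Measure Ω} [IsProbabilityMeasure μ] {c : ℕ → Ω → ℝ} {v : ℝ}
    (hL : ∀ j, MemLp (c j) 2 μ) (h0 : ∀ j, ∫ ω, c j ω ∂μ = 0)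
    (hv : ∀ j, ∫ ω, c j ω ^ 2 ∂μ = v) (hind : Pairwise fun j l => IndepFun (c j) (c l) μ) (M : ℕ) :
    ∫ ω, (∑ j ∈ Finset.range M, c j ω) ^ 2 ∂μ = M * v := by
  have h1 := IndepFun.variance_sum (s := Finset.range M) (fun j _ => hL j)
    (fun j _ l _ hjl => hind hjl)
  have h2 : ∀ j, variance (c j) μ = v := fun j => by
    rw [variance_of_integral_eq_zero (hL j).1.aemeasurable (h0 j), ← hv j]
  rw [variance_of_integral_eq_zero] at h1
  · simpa [h2] using h1
  · exact (Finset.aemeasurable_sum _ fun j _ => (hL j).1.aemeasurable)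
  · simp only [Finset.sum_apply]
    rw [integral_finsetSum _ fun j _ => (hL j).integrable (by norm_num)]
    simp [h0]

lemma continuous_rgrad {L : ℝ} {φ : Mat n r → ℝ} (h : LSmooth L φ) :
    Continuous (rgrad φ) := by
  have h1 : Continuous (egrad φ) := by
    have h2 : LipschitzWith (Real.toNNReal L) (egrad φ) := by
      refine LipschitzWith.of_dist_le_mul fun X Y => ?_
      rw [dist_eq_norm, dist_eq_norm]
      exact (h.2 X Y).trans (mul_le_mul_of_nonneg_right (Real.le_coe_toNNReal L) (norm_nonneg _))
    exact h2.continuous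
  exact continuous_projT.comp (continuous_id.prodMk h1)

/-- The variance of the averaged samples at a fixed point. -/
lemma lintegral_avg_sample_le {P : ∀ i, Measure (Ξ i)} {f : Fin N → Mat n r → ℝ}
    {A₁ σ : ℝ} (hG : IsGradientOracle P f G A₁ σ) {μ : Measure Ω} [IsProbabilityMeasure μ]
    {i : Fin N} {z : ℕ → Ω → Ξ i} (hz : ∀ j, Measurable (z j)) (hlaw : ∀ j, μ.map (z j) = P i)
    (hind : iIndepFun z μ) {x : Mat n r} (hx : x ∈ stiefel n r) {M : ℕ} (hM : 0 < M) :
    ∫⁻ ω, ENNReal.ofReal (‖(M : ℝ)⁻¹ • ∑ j ∈ Finset.range M, G i x (z j ω)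
      - rgrad (f i) x‖ ^ 2) ∂μ ≤ ENNReal.ofReal (σ ^ 2 / M) := by
  have hM' : (M : ℝ) ≠ 0 := by positivity
  have : IsProbabilityMeasure (P i) := by
    rw [← hlaw 0]; exact Measure.isProbabilityMeasure_map (hz 0).aemeasurable
  set γ := rgrad (f i) x with hγ
  have hGm : ∀ a b, Measurable fun s => G i x s a b := fun a b =>
    (hG.measurable i a b).comp measurable_prodMk_left
  -- Each matrix entry is a bounded centred scalar, so variances add by independence; the Frobenius
  -- norm then sums the entries.
  let c : Fin n → Fin r → Ξ i → ℝ := fun a b s => G i x s a b - γ a b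
  have hcm : ∀ a b, Measurable (c a b) := fun a b => (hGm a b).sub_const _
  have hGb : ∀ a b, ∀ᵐ s ∂(P i), ‖G i x s a b‖ ≤ A₁ := fun a b => by
    filter_upwards [hG.bounded i] with s hs
    exact (abs_apply_le_norm _ a b).trans (hs x hx)
  have hGi : ∀ a b, MemLp (fun s => G i x s a b) 2 (P i) := fun a b =>
    MemLp.of_bound (hGm a b).aestronglyMeasurable A₁ (hGb a b)
  have hcL : ∀ a b, MemLp (c a b) 2 (P i) := fun a b => (hGi a b).sub (memLp_const _)
  have hmp : ∀ j, MeasurePreserving (z j) μ (P i) := fun j => ⟨hz j, hlaw j⟩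
  have hcL' : ∀ a b j, MemLp (fun ω => c a b (z j ω)) 2 μ := fun a b j =>
    (hcL a b).comp_measurePreserving (hmp j)
  have hc0 : ∀ a b j, ∫ ω, c a b (z j ω) ∂μ = 0 := fun a b j => by
    have h1 : ∫ ω, c a b (z j ω) ∂μ = ∫ s, c a b s ∂(P i) := by
      rw [← hlaw j, integral_map (hz j).aemeasurable]
      exact (hcm a b).aestronglyMeasurable
    rw [h1, integral_sub ((hGi a b).integrable (by norm_num)) (integrable_const _),
      hG.unbiased i x hx a b]
    simp [hγ]
  have hcv : ∀ a b j, ∫ ω, c a b (z j ω) ^ 2 ∂μ = ∫ s, c a b s ^ 2 ∂(P i) := fun a b j => by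
    rw [← hlaw j, integral_map (hz j).aemeasurable]
    exact ((hcm a b).pow_const 2).aestronglyMeasurable
  have hsum : ∀ a b, ∫ ω, (∑ j ∈ Finset.range M, c a b (z j ω)) ^ 2 ∂μ
      = M * ∫ s, c a b s ^ 2 ∂(P i) := fun a b =>
    integral_sq_avg_le (hcL' a b) (hc0 a b) (hcv a b)
      (fun j l hjl => (hind.indepFun hjl).comp (hcm a b) (hcm a b)) M
  have hnorm : ∀ ω, ‖(M : ℝ)⁻¹ • ∑ j ∈ Finset.range M, G i x (z j ω) - γ‖ ^ 2
      = ∑ a, ∑ b, ((M : ℝ)⁻¹) ^ 2 * (∑ j ∈ Finset.range M, c a b (z j ω)) ^ 2 := fun ω => by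
    rw [frobenius_sq]
    refine Finset.sum_congr rfl fun a _ => Finset.sum_congr rfl fun b _ => ?_
    rw [← mul_pow]
    congr 1
    simp only [c, Matrix.sub_apply, Matrix.smul_apply, Matrix.sum_apply, smul_eq_mul,
      Finset.sum_sub_distrib, Finset.sum_const, Finset.card_range, nsmul_eq_mul]
    field_simp
  have hint : ∀ a b, Integrable (fun ω => ((M : ℝ)⁻¹) ^ 2 *
      (∑ j ∈ Finset.range M, c a b (z j ω)) ^ 2) μ := fun a b =>
    (memLp_finsetSum _ fun j _ => hcL' a b j).integrable_sq.const_mul _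
  simp only [hnorm]
  rw [← ofReal_integral_eq_lintegral_ofReal]
  · refine ENNReal.ofReal_le_ofReal ?_
    rw [integral_finsetSum _ fun a _ => integrable_finsetSum _ fun b _ => hint a b]
    simp only [integral_finsetSum _ fun b _ => hint _ b, integral_const_mul, hsum]
    have h1 : ∑ a, ∑ b, ∫ s, c a b s ^ 2 ∂(P i) ≤ σ ^ 2 := by
      refine le_trans (le_of_eq ?_) (hG.variance i x hx)
      have hF : ∀ s, ‖G i x s - rgrad (f i) x‖ ^ 2 = ∑ a, ∑ b, c a b s ^ 2 := fun s => by
        rw [frobenius_sq]; rfl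
      simp only [hF]
      rw [integral_finsetSum _ fun a _ => integrable_finsetSum _ fun b _ => (hcL a b).integrable_sq]
      refine Finset.sum_congr rfl fun a _ => ?_
      rw [integral_finsetSum _ fun b _ => (hcL a b).integrable_sq]
    calc ∑ a, ∑ b, ((M : ℝ)⁻¹) ^ 2 * (M * ∫ s, c a b s ^ 2 ∂(P i))
        = (M : ℝ)⁻¹ * ∑ a, ∑ b, ∫ s, c a b s ^ 2 ∂(P i) := by
          simp only [Finset.mul_sum]
          refine Finset.sum_congr rfl fun a _ => Finset.sum_congr rfl fun b _ => ?_
          field_simp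
      _ ≤ (M : ℝ)⁻¹ * σ ^ 2 := mul_le_mul_of_nonneg_left h1 (by positivity)
      _ = σ ^ 2 / M := by rw [div_eq_inv_mul]
  · exact integrable_finsetSum _ fun a _ => integrable_finsetSum _ fun b _ => hint a b
  · exact Filter.Eventually.of_forall fun ω => Finset.sum_nonneg fun a _ =>
      Finset.sum_nonneg fun b _ => by positivity

end Measurability

/-! ### Variance of the gradient estimates along the iterates; regularity of the induced mean -/

section Expectation

attribute [local instance] Matrix.frobeniusNormedAddCommGroup Matrix.frobeniusNormedSpace
  frobeniusInnerProductSpace matMeasurableSpace matBorelSpace matSecondCountable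

variable {n r N : ℕ} {Ω : Type*} [mΩ : MeasurableSpace Ω] {μ : Measure Ω} [IsProbabilityMeasure μ]
  {Ξ : Fin N → Type*} [∀ i, MeasurableSpace (Ξ i)] {P : ∀ i, Measure (Ξ i)}
  {f : Fin N → Mat n r → ℝ} {G : ∀ i, Mat n r → Ξ i → Mat n r} {A₁ σ : ℝ}
  {ξ : ∀ i, ℕ → ℕ → Ω → Ξ i} {W : Matrix (Fin N) (Fin N) ℝ} {t : ℕ}
  {α β : ℝ} {X₀ : Fin N → Mat n r} {m : ℕ → ℕ}

/-- The samples drawn in the experiment `ω`. -/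
abbrev samples (ξ : ∀ i, ℕ → ℕ → Ω → Ξ i) (ω : Ω) (i : Fin N) (k j : ℕ) : Ξ i := ξ i k j ω

/-- The averaged samples of agent `i` at its current point have variance at most `σ² / m k`. -/
lemma lintegral_batch_le (hG : IsGradientOracle P f G A₁ σ) (hf : ∀ i, Continuous (rgrad (f i)))
    (hξ : IsSampling μ P ξ) (hX₀ : ∀ i, X₀ i ∈ stiefel n r) {k : ℕ} (hm : 0 < m k) (i : Fin N) :
    ∫⁻ ω, ENNReal.ofReal (‖batchGrad G m (samples ξ ω) k (iterates W t α β G X₀ m (samples ξ ω) k).1 i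
      - rgrad (f i) ((iterates W t α β G X₀ m (samples ξ ω) k).1 i)‖ ^ 2) ∂μ
      ≤ ENNReal.ofReal (σ ^ 2 / m k) := by
  set X : Ω → Mat n r := fun ω => (iterates W t α β G X₀ m (samples ξ ω) k).1 i with hX
  let S : ℕ → Ω → ∀ i : Fin N, ℕ → Ξ i := fun l ω i j => ξ i l j ω
  have hSm : ∀ l, Measurable (S l) := fun l =>
    measurable_pi_lambda _ fun i => measurable_pi_lambda _ fun j => hξ.measurable i l j
  let ℱ : ℕ → MeasurableSpace Ω := fun l => MeasurableSpace.comap (S l) inferInstance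
  have hle : ∀ l, ℱ l ≤ mΩ := fun l => (hSm l).comap_le
  have hindep : Indep (⨆ l ∈ Set.Iio k, ℱ l) (⨆ l ∈ ({k} : Set ℕ), ℱ l) μ :=
    indep_iSup_of_disjoint hle hξ.indep_iter (by simp)
  -- The points at iteration k use only the samples of iterations before k; the trackers at
  -- iteration k would not.
  have hXm : Measurable[⨆ l ∈ Set.Iio k, ℱ l] X := by
    refine (@measurable_iterates n r N Ω (⨆ l ∈ Set.Iio k, ℱ l) Ξ W t α β G X₀ m _ P f A₁ σ hG hX₀
      (samples ξ) k (fun i l hl j => ?_) k).1 le_rfl i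
    have h1 : Measurable[ℱ l] (S l) := comap_measurable _
    have h2 : Measurable[ℱ l] fun ω => ξ i l j ω :=
      (measurable_pi_apply j).comp ((measurable_pi_apply i).comp h1)
    exact h2.mono (le_iSup₂_of_le l hl le_rfl) le_rfl
  have hzm : Measurable fun ω => fun j => ξ i k j ω :=
    measurable_pi_lambda _ fun j => hξ.measurable i k j
  have hzm' : Measurable[⨆ l ∈ ({k} : Set ℕ), ℱ l] fun ω => fun j => ξ i k j ω := by
    have h1 : Measurable[ℱ k] (S k) := comap_measurable _
    have h2 : Measurable[ℱ k] fun ω => S k ω i := (measurable_pi_apply i).comp h1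
    exact h2.mono (le_iSup₂_of_le k rfl le_rfl) le_rfl
  have hle' : (⨆ l ∈ Set.Iio k, ℱ l) ≤ mΩ := iSup₂_le fun l _ => hle l
  have hXm0 : Measurable X := hXm.mono hle' le_rfl
  have hIF : IndepFun X (fun ω => fun j => ξ i k j ω) μ := by
    rw [IndepFun_iff_Indep]
    exact indep_of_indep_of_le_left (indep_of_indep_of_le_right hindep hzm'.comap_le) hXm.comap_le
  let Φ : Mat n r × (ℕ → Ξ i) → ENNReal := fun p => ENNReal.ofReal
    (‖(m k : ℝ)⁻¹ • ∑ j ∈ Finset.range (m k), G i p.1 (p.2 j) - rgrad (f i) p.1‖ ^ 2)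
  have hΦ : Measurable Φ := by
    have h1 : Measurable fun p : Mat n r × (ℕ → Ξ i) =>
        ∑ j ∈ Finset.range (m k), G i p.1 (p.2 j) :=
      Finset.measurable_sum _ fun j _ => (measurable_oracle hG i).comp
        (measurable_fst.prodMk ((measurable_pi_apply j).comp measurable_snd))
    have h2 : Measurable fun p : Mat n r × (ℕ → Ξ i) => rgrad (f i) p.1 :=
      (hf i).measurable.comp measurable_fst
    have h3 : Continuous fun Z : Mat n r => ‖Z‖ ^ 2 := by fun_prop
    exact ENNReal.measurable_ofReal.comp
      (h3.measurable.comp ((h1.const_smul ((m k : ℝ)⁻¹)).sub h2))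
  -- Independence makes the joint law a product, so the point can be frozen and the fixed-point
  -- variance bound applied under the outer integral.
  have hmap : μ.map (fun ω => (X ω, fun j => ξ i k j ω))
      = (μ.map X).prod (μ.map fun ω => fun j => ξ i k j ω) :=
    (indepFun_iff_map_prod_eq_prod_map_map hXm0.aemeasurable hzm.aemeasurable).1 hIF
  have : IsProbabilityMeasure (μ.map X) := Measure.isProbabilityMeasure_map hXm0.aemeasurable
  have : IsProbabilityMeasure (μ.map fun ω => fun j => ξ i k j ω) :=
    Measure.isProbabilityMeasure_map hzm.aemeasurable
  calc _ = ∫⁻ ω, Φ (X ω, fun j => ξ i k j ω) ∂μ := rfl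
    _ = ∫⁻ p, Φ p ∂(μ.map fun ω => (X ω, fun j => ξ i k j ω)) :=
        (lintegral_map hΦ (hXm0.prodMk hzm)).symm
    _ = ∫⁻ x, ∫⁻ z, Φ (x, z) ∂(μ.map fun ω => fun j => ξ i k j ω) ∂(μ.map X) := by
        rw [hmap, lintegral_prod _ hΦ.aemeasurable]
    _ = ∫⁻ ω, ∫⁻ z, Φ (X ω, z) ∂(μ.map fun ω => fun j => ξ i k j ω) ∂μ :=
        lintegral_map hΦ.lintegral_prod_right' hXm0
    _ ≤ ∫⁻ _, ENNReal.ofReal (σ ^ 2 / m k) ∂μ := by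
        refine lintegral_mono fun ω => ?_
        refine (lintegral_map (f := fun z => Φ (X ω, z)) (hΦ.comp measurable_prodMk_left)
          hzm).le.trans ?_
        exact lintegral_avg_sample_le hG (hξ.measurable i k) (hξ.law i k) (hξ.indep_batch i k)
          (iterates_mem hX₀ _ k i) hm
    _ = ENNReal.ofReal (σ ^ 2 / m k) := by simp

/-! ### Continuity of the induced arithmetic mean -/

lemma continuous_rms : Continuous (rms : (Fin N → Mat n r) → ℝ) := by
  unfold rms; fun_prop

lemma continuous_mean : Continuous (mean : (Fin N → Mat n r) → Mat n r) := by
  unfold mean; fun_prop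

/-- The error is the minimal root mean square distance to a constant family on the manifold, hence
1-Lipschitz, even where the choice of the minimizer jumps. -/
lemma continuous_consErr (hne : (stiefel n r).Nonempty) :
    Continuous (consErr : (Fin N → Mat n r) → ℝ) := by
  have key : ∀ X X' : Fin N → Mat n r, consErr X ≤ consErr X' + rms fun i => X i - X' i := by
    intro X X'
    have h1 := (isIAM_iam hne X).rms_le (isIAM_iam hne X').1
    have h2 := rms_add_le (fun i => X' i - iam X') (fun i => X i - X' i)
    have h3 : (fun i => X' i - iam X' + (X i - X' i)) = fun i => X i - iam X' :=
      funext fun i => by abel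
    rw [h3] at h2
    exact h1.trans h2
  rw [continuous_iff_continuousAt]
  intro X
  have h1 : Filter.Tendsto (fun X' : Fin N → Mat n r => rms fun i => X' i - X i) (nhds X)
      (nhds 0) := by
    have h2 : Continuous fun X' : Fin N → Mat n r => rms fun i => X' i - X i :=
      continuous_rms.comp (by fun_prop)
    have h3 := h2.tendsto X
    have h4 : rms (fun i => X i - X i) = 0 := by simp [rms]
    rwa [h4] at h3
  refine tendsto_iff_norm_sub_tendsto_zero.2 (squeeze_zero (fun _ => norm_nonneg _)
    (fun X' => ?_) h1)
  rw [Real.norm_eq_abs, abs_le]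
  have h2 := key X' X
  have h3 := key X X'
  have h4 : rms (fun i => X i - X' i) = rms fun i => X' i - X i := by
    rw [← rms_neg]; simp only [neg_sub]
  rw [h4] at h3
  constructor <;> linarith

variable [NeZero N]

/-- On this set both polar factors are at least 1/2, so the minimizer is determined by the Euclidean
mean and is 2-Lipschitz in it. -/
lemma continuousOn_iam {M : ℝ} (hM : IsRetractionConst n r M) :
    ContinuousOn (iam : (Fin N → Mat n r) → Mat n r)
      {X | (∀ i, X i ∈ stiefel n r) ∧ consErr X ≤ 1} := by
  intro X hX
  have h1 : Filter.Tendsto (fun X' : Fin N → Mat n r => 2 * ‖mean X' - mean X‖)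
      (nhdsWithin X {X | (∀ i, X i ∈ stiefel n r) ∧ consErr X ≤ 1}) (nhds 0) := by
    have h2 : Continuous fun X' : Fin N → Mat n r => 2 * ‖mean X' - mean X‖ :=
      continuous_const.mul (continuous_mean.sub continuous_const).norm
    have h3 := h2.continuousWithinAt (s := {X | (∀ i, X i ∈ stiefel n r) ∧ consErr X ≤ 1}) (x := X)
    simpa [ContinuousWithinAt] using h3
  refine tendsto_iff_norm_sub_tendsto_zero.2 (squeeze_zero' ?_ ?_ h1)
  · exact Filter.Eventually.of_forall fun _ => norm_nonneg _
  · filter_upwards [self_mem_nhdsWithin] with X' hX'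
    have hne : (stiefel n r).Nonempty := ⟨_, hX.1 0⟩
    have hsq : ∀ Z : Fin N → Mat n r, consErr Z ≤ 1 → consErr Z ^ 2 / 2 ≤ 1 / 2 := fun Z hZ => by
      have := pow_le_one₀ (n := 2) (consErr_nonneg Z) hZ
      linarith
    have := (isIAM_iam hne X').lipschitz hM hX'.1 hX.1 (isIAM_iam hne X) (hsq X' hX'.2)
      (hsq X hX.2)
    linarith

lemma isClosed_stiefel : IsClosed (stiefel n r) := (isCompact_stiefel n r).isClosed

/-- The squared gradient norm at the mean of random points that are almost surely close to each
other is measurable up to null sets. -/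
lemma aestronglyMeasurable_grad {μ' : Measure Ω} {L M : ℝ}
    (hM : IsRetractionConst n r M) {φ : Mat n r → ℝ}
    (hφ : LSmooth L φ) (hne : (stiefel n r).Nonempty) {X : Ω → Fin N → Mat n r}
    (hX : ∀ i, Measurable fun ω => X ω i)
    (hloc : ∀ᵐ ω ∂μ', (∀ i, X ω i ∈ stiefel n r) ∧ consErr (X ω) ≤ 1) :
    AEStronglyMeasurable (fun ω => ‖rgrad φ (iam (X ω))‖ ^ 2) μ' := by
  set T : Set (Fin N → Mat n r) := {X | (∀ i, X i ∈ stiefel n r) ∧ consErr X ≤ 1} with hT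
  have hTc : IsClosed T := by
    have h1 : T = (⋂ i, (fun X : Fin N → Mat n r => X i) ⁻¹' stiefel n r)
        ∩ consErr ⁻¹' Set.Iic 1 := by ext X; simp [hT]
    rw [h1]
    have h2 : IsClosed (consErr ⁻¹' Set.Iic 1 : Set (Fin N → Mat n r)) :=
      isClosed_Iic.preimage (continuous_consErr hne)
    have h3 : IsClosed (⋂ i, (fun X : Fin N → Mat n r => X i) ⁻¹' stiefel n r) :=
      isClosed_iInter fun i => isClosed_stiefel.preimage (continuous_apply i)
    exact h3.inter h2
  have hXm : Measurable X := measurable_pi_lambda _ hX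
  have hcont : ContinuousOn (fun X : Fin N → Mat n r => ‖rgrad φ (iam X)‖ ^ 2) T :=
    ((continuous_rgrad hφ).comp_continuousOn (continuousOn_iam hM)).norm.pow 2
  -- Off the closed set T the choice of a minimizer is arbitrary; the function is replaced by zero
  -- there, which changes it only on a null set.
  have hmeas : Measurable (T.indicator fun X : Fin N → Mat n r => ‖rgrad φ (iam X)‖ ^ 2) := by
    classical
    rw [← Set.piecewise_eq_indicator]
    exact hcont.measurable_piecewise continuousOn_const hTc.measurableSet
  refine (hmeas.comp hXm).aestronglyMeasurable.congr ?_
  filter_upwards [hloc] with ω hω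
  simp only [Function.comp_apply]
  exact Set.indicator_of_mem (s := T) (show X ω ∈ T from hω) _

end Expectation

/-! ### From trajectories to expectations -/

section Expectation

attribute [local instance] Matrix.frobeniusNormedAddCommGroup Matrix.frobeniusNormedSpace
  frobeniusInnerProductSpace matMeasurableSpace matBorelSpace matSecondCountable

lemma norm_batchGrad_le {n r N : ℕ} {Ξ : Fin N → Type*} {G : ∀ i, Mat n r → Ξ i → Mat n r}
    {m : ℕ → ℕ} {A : ℝ} {s : ∀ i, ℕ → ℕ → Ξ i} {k : ℕ} {X : Fin N → Mat n r} {i : Fin N}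
    (hA : 0 ≤ A) (h : ∀ j, ‖G i (X i) (s i k j)‖ ≤ A) : ‖batchGrad G m s k X i‖ ≤ A := by
  rw [batchGrad, norm_smul, norm_inv, Real.norm_natCast]
  have h1 : ‖∑ j ∈ Finset.range (m k), G i (X i) (s i k j)‖ ≤ m k * A := by
    refine (norm_sum_le _ _).trans ((Finset.sum_le_sum fun j _ => h j).trans_eq ?_)
    simp
  rcases (m k).eq_zero_or_pos with h0 | h0
  · simpa [h0] using hA
  · rw [inv_mul_le_iff₀ (by exact_mod_cast h0)]; exact h1

lemma isTrajectory_iterates {n r N : ℕ} {Ξ : Fin N → Type*}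
    {G : ∀ i, Mat n r → Ξ i → Mat n r} {W : Matrix (Fin N) (Fin N) ℝ} {t : ℕ} {α β : ℝ}
    {X₀ : Fin N → Mat n r} {m : ℕ → ℕ} {A : ℝ} (hA : 0 ≤ A) {s : ∀ i, ℕ → ℕ → Ξ i}
    (h : ∀ i k j, ∀ X ∈ stiefel n r, ‖G i X (s i k j)‖ ≤ A) :
    IsTrajectory (W ^ t) α β A (fun k => (iterates W t α β G X₀ m s k).1)
      (fun k => (iterates W t α β G X₀ m s k).2)
      (fun k => batchGrad G m s k (iterates W t α β G X₀ m s k).1) where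
  zero := rfl
  X_succ _ := rfl
  Y_succ _ _ := rfl
  bound k i hX := norm_batchGrad_le hA fun j => h i k j _ hX

variable {n r N : ℕ} {Ω : Type*} [mΩ : MeasurableSpace Ω] {μ : Measure Ω}
  {Ξ : Fin N → Type*} [∀ i, MeasurableSpace (Ξ i)] {P : ∀ i, Measure (Ξ i)}
  {f : Fin N → Mat n r → ℝ} {G : ∀ i, Mat n r → Ξ i → Mat n r} {A₁ A σ : ℝ}
  {ξ : ∀ i, ℕ → ℕ → Ω → Ξ i} {W : Matrix (Fin N) (Fin N) ℝ} {t : ℕ}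
  {α β : ℝ} {X₀ : Fin N → Mat n r} {m : ℕ → ℕ}

/-- Almost surely all the oracle answers are bounded. -/
lemma ae_norm_oracle_le (hG : IsGradientOracle P f G A₁ σ) (hξ : IsSampling μ P ξ) :
    ∀ᵐ ω ∂μ, ∀ i k j, ∀ X ∈ stiefel n r, ‖G i X (ξ i k j ω)‖ ≤ A₁ := by
  simp only [ae_all_iff (ι := Fin N), ae_all_iff (ι := ℕ)]
  intro i k j
  refine ae_of_ae_map (f := ξ i k j) (p := fun s => ∀ X ∈ stiefel n r, ‖G i X s‖ ≤ A₁)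
    (hξ.measurable i k j).aemeasurable ?_
  rw [hξ.law i k j]
  exact hG.bounded i

variable [IsProbabilityMeasure μ] [NeZero N]

/-- The mean squared error of the gradient estimates. -/
lemma noise_bound (hG : IsGradientOracle P f G A₁ σ) (hf : ∀ i, Continuous (rgrad (f i)))
    (hξ : IsSampling μ P ξ) (hX₀ : ∀ i, X₀ i ∈ stiefel n r) {k : ℕ} (hm : 0 < m k) :
    Integrable (fun ω => (rms fun i =>
      batchGrad G m (samples ξ ω) k (iterates W t α β G X₀ m (samples ξ ω) k).1 i
        - rgrad (f i) ((iterates W t α β G X₀ m (samples ξ ω) k).1 i)) ^ 2) μ ∧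
    ∫ ω, (rms fun i =>
      batchGrad G m (samples ξ ω) k (iterates W t α β G X₀ m (samples ξ ω) k).1 i
        - rgrad (f i) ((iterates W t α β G X₀ m (samples ξ ω) k).1 i)) ^ 2 ∂μ
      ≤ σ ^ 2 * (m k : ℝ)⁻¹ := by
  set D : Ω → Fin N → Mat n r := fun ω i =>
    batchGrad G m (samples ξ ω) k (iterates W t α β G X₀ m (samples ξ ω) k).1 i
      - rgrad (f i) ((iterates W t α β G X₀ m (samples ξ ω) k).1 i) with hD
  have hN : (N : ℝ) ≠ 0 := NeZero.ne _
  have hXm : ∀ i, Measurable fun ω => (iterates W t α β G X₀ m (samples ξ ω) k).1 i :=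
    (measurable_iterates hG hX₀ (s := samples ξ) (K := k)
      (fun i l _ j => hξ.measurable i l j) k).1 le_rfl
  have hDm : ∀ i, Measurable fun ω => ‖D ω i‖ ^ 2 := fun i => by
    have h1 : Measurable fun ω => D ω i :=
      (measurable_batchGrad hG hXm (s := samples ξ) (fun i j => hξ.measurable i k j) i).sub
        ((hf i).measurable.comp (hXm i))
    have h2 : Continuous fun Z : Mat n r => ‖Z‖ ^ 2 := by fun_prop
    exact h2.measurable.comp h1
  have hb : ∀ i, ∫⁻ ω, ENNReal.ofReal (‖D ω i‖ ^ 2) ∂μ ≤ ENNReal.ofReal (σ ^ 2 / m k) := fun i =>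
    lintegral_batch_le hG hf hξ hX₀ hm i
  -- The variance bound was stated for the extended integral, so finiteness and integrability come
  -- from it.
  have hi : ∀ i, Integrable (fun ω => ‖D ω i‖ ^ 2) μ := fun i =>
    ⟨(hDm i).aestronglyMeasurable, by
      rw [hasFiniteIntegral_iff_ofReal (Filter.Eventually.of_forall fun ω => sq_nonneg _)]
      exact (hb i).trans_lt ENNReal.ofReal_lt_top⟩
  have hi' : ∀ i, ∫ ω, ‖D ω i‖ ^ 2 ∂μ ≤ σ ^ 2 / m k := fun i => by
    rw [integral_eq_lintegral_of_nonneg_ae (Filter.Eventually.of_forall fun ω => sq_nonneg _)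
      (hDm i).aestronglyMeasurable]
    exact ENNReal.toReal_le_of_le_ofReal (by positivity) (hb i)
  simp only [rms_sq]
  refine ⟨(integrable_finsetSum _ fun i _ => hi i).const_mul _, ?_⟩
  rw [integral_const_mul, integral_finsetSum _ fun i _ => hi i]
  calc (N : ℝ)⁻¹ * ∑ i, ∫ ω, ‖D ω i‖ ^ 2 ∂μ ≤ (N : ℝ)⁻¹ * ∑ _i : Fin N, σ ^ 2 / m k :=
        mul_le_mul_of_nonneg_left (Finset.sum_le_sum fun i _ => hi' i) (by positivity)
    _ = σ ^ 2 * (m k : ℝ)⁻¹ := by simp; field_simp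

/-- The expected squared gradient norms and consensus errors, summed over the iterations, are
bounded by a constant and a multiple of the sum of the variances of the gradient estimates. -/
theorem exists_expectation_bound {L B M δ₁ δ₂ s : ℝ} (hG : IsGradientOracle P f G A₁ σ)
    (hL : 0 ≤ L) (hf : ∀ i, LSmooth L (f i)) (hB : ∀ i, ∀ Z ∈ stiefel n r, ‖egrad (f i) Z‖ ≤ B)
    (hξ : IsSampling μ P ξ) (h : StepBounds n r M α β δ₁ δ₂ A (L + 2 * B)) (hA : A₁ ≤ A)
    (hw : IsMixing (W ^ t) s) (hX₀ : IsLocal δ₁ δ₂ X₀) :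
    ∃ C, 0 ≤ C ∧ ∀ m : ℕ → ℕ, (∀ k, 0 < m k) →
      (∀ k, Integrable (fun ω => consensusSq (randomIterate W t α β G X₀ ξ m k ω)) μ ∧
        Integrable (fun ω => ‖rgrad (avgCost f) (iam (randomIterate W t α β G X₀ ξ m k ω))‖ ^ 2)
          μ) ∧
      ∀ K, ∑ k ∈ Finset.range (K + 1),
          ∫ ω, ‖rgrad (avgCost f) (iam (randomIterate W t α β G X₀ ξ m k ω))‖ ^ 2 ∂μ
            ≤ C + 13 * (σ ^ 2 * ∑ k ∈ Finset.range (K + 1), (m k : ℝ)⁻¹) ∧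
        ∑ k ∈ Finset.range (K + 1),
          (N : ℝ)⁻¹ * ∫ ω, consensusSq (randomIterate W t α β G X₀ ξ m k ω) ∂μ
            ≤ C + 1000 * (β / α) ^ 2 * (σ ^ 2 * ∑ k ∈ Finset.range (K + 1), (m k : ℝ)⁻¹) := by
  have hne : (stiefel n r).Nonempty := ⟨_, hX₀.mem 0⟩
  have hF := lsmooth_avgCost hf
  obtain ⟨Cφ, hCφ⟩ := exists_abs_le_on_stiefel (n := n) (r := r) hF.1.continuous
  have hδ₁1 := h.δ₁_le_one
  obtain ⟨C, hC0, hC⟩ := exists_progress_bound Cφ (5 * A) h.α_pos h.α_le h.β_pos h.Λ_nonneg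
    h.δ₁_pos h.δ₁_le h.βΛ_le
  -- The constant precedes the sample sizes; hence the final constants depend neither on the
  -- rounding nor on Q.
  refine ⟨C, hC0, fun m hm => ?_⟩
  set X : ℕ → Ω → Fin N → Mat n r := randomIterate W t α β G X₀ ξ m with hXdef
  have hXm : ∀ k i, Measurable fun ω => X k ω i := fun k =>
    (measurable_iterates hG hX₀.mem (s := samples ξ) (K := k)
      (fun i l _ j => hξ.measurable i l j) k).1 le_rfl
  have htraj : ∀ᵐ ω ∂μ, IsTrajectory (W ^ t) α β A (fun k => X k ω)
      (fun k => (iterates W t α β G X₀ m (samples ξ ω) k).2)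
      (fun k => batchGrad G m (samples ξ ω) k (X k ω)) := by
    filter_upwards [ae_norm_oracle_le hG hξ] with ω hω
    exact isTrajectory_iterates h.A_nonneg fun i k j Z hZ => (hω i k j Z hZ).trans hA
  have hloc : ∀ k, ∀ᵐ ω ∂μ, IsLocal δ₁ δ₂ (X k ω) := fun k => by
    filter_upwards [htraj] with ω hω
    exact (hω.invariant h hw hX₀ k).1
  have hI1 : ∀ k, Integrable (fun ω => consErr (X k ω) ^ 2) μ := fun k => by
    refine Integrable.of_bound (C := 1) ?_ ?_
    · have h1 : Measurable fun ω => X k ω := measurable_pi_lambda _ (hXm k)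
      exact (((continuous_consErr hne).pow 2).measurable.comp h1).aestronglyMeasurable
    · filter_upwards [hloc k] with ω hω
      rw [Real.norm_of_nonneg (sq_nonneg _)]
      exact pow_le_one₀ (consErr_nonneg _) (hω.consErr_le.trans (by linarith))
  have hcons : ∀ k ω, consensusSq (X k ω) = N * consErr (X k ω) ^ 2 := fun k ω => by
    rw [consErr_sq, mul_inv_cancel_left₀ (NeZero.ne _)]
  have hI2 : ∀ k, Integrable (fun ω => ‖rgrad (avgCost f) (iam (X k ω))‖ ^ 2) μ := fun k => by
    refine Integrable.of_bound (C := B ^ 2) (aestronglyMeasurable_grad h.retraction hF hne (hXm k) ?_) ?_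
    · filter_upwards [hloc k] with ω hω
      exact ⟨hω.mem, hω.consErr_le.trans (by linarith)⟩
    · filter_upwards [hloc k] with ω hω
      rw [Real.norm_of_nonneg (sq_nonneg _)]
      refine pow_le_pow_left₀ (norm_nonneg _) ?_ 2
      exact (norm_projT_le hω.isIAM.1 _).trans
        (norm_egrad_avgCost_le (fun i => (hf i).1) fun i => hB i _ hω.isIAM.1)
  refine ⟨fun k => ⟨?_, hI2 k⟩, fun K => ?_⟩
  · simp only [hcons]; exact (hI1 k).const_mul _
  set ν : ℕ → Ω → ℝ := fun k ω => rms fun i =>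
    batchGrad G m (samples ξ ω) k (X k ω) i - rgrad (f i) (X k ω i) with hν
  have hν1 : ∀ k, Integrable (fun ω => ν k ω ^ 2) μ ∧
      ∫ ω, ν k ω ^ 2 ∂μ ≤ σ ^ 2 * (m k : ℝ)⁻¹ := fun k =>
    noise_bound hG (fun i => continuous_rgrad (hf i)) hξ hX₀.mem (hm k)
  have hpath : ∀ᵐ ω ∂μ, ∑ k ∈ Finset.range (K + 1), ‖rgrad (avgCost f) (iam (X k ω))‖ ^ 2
        ≤ C + 13 * ∑ k ∈ Finset.range (K + 1), ν k ω ^ 2 ∧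
      ∑ k ∈ Finset.range (K + 1), consErr (X k ω) ^ 2
        ≤ C + 1000 * (β / α) ^ 2 * ∑ k ∈ Finset.range (K + 1), ν k ω ^ 2 := by
    filter_upwards [htraj] with ω hω
    exact hC _ _ _ _ _ _ (hω.progressBounds hL hf hB hCφ h hw hX₀) K
  have hsum : ∫ ω, ∑ k ∈ Finset.range (K + 1), ν k ω ^ 2 ∂μ
      ≤ σ ^ 2 * ∑ k ∈ Finset.range (K + 1), (m k : ℝ)⁻¹ := by
    rw [integral_finsetSum _ fun k _ => (hν1 k).1, Finset.mul_sum]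
    exact Finset.sum_le_sum fun k _ => (hν1 k).2
  have hνi : Integrable (fun ω => ∑ k ∈ Finset.range (K + 1), ν k ω ^ 2) μ :=
    integrable_finsetSum _ fun k _ => (hν1 k).1
  have hbound : ∀ {c : ℝ} {u : ℕ → Ω → ℝ}, 0 ≤ c → (∀ k, Integrable (u k) μ) →
      (∀ᵐ ω ∂μ, ∑ k ∈ Finset.range (K + 1), u k ω
        ≤ C + c * ∑ k ∈ Finset.range (K + 1), ν k ω ^ 2) →
      ∑ k ∈ Finset.range (K + 1), ∫ ω, u k ω ∂μ
        ≤ C + c * (σ ^ 2 * ∑ k ∈ Finset.range (K + 1), (m k : ℝ)⁻¹) := by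
    intro c u hc hu hle
    rw [← integral_finsetSum _ fun k _ => hu k]
    refine (integral_mono_ae (integrable_finsetSum _ fun k _ => hu k)
      ((integrable_const C).add (hνi.const_mul c)) hle).trans ?_
    simp only [Pi.add_apply]
    rw [integral_add (integrable_const C) (hνi.const_mul c), integral_const_mul]
    simp only [integral_const, probReal_univ, one_smul]
    have := mul_le_mul_of_nonneg_left hsum hc
    linarith
  constructor
  · exact hbound (by norm_num) hI2 (hpath.mono fun ω hω => hω.1)
  · have h1 : ∀ k, (N : ℝ)⁻¹ * ∫ ω, consensusSq (X k ω) ∂μ = ∫ ω, consErr (X k ω) ^ 2 ∂μ := fun k => by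
      rw [← integral_const_mul]
      simp only [consErr_sq]
    simp only [h1]
    exact hbound (by positivity) hI1 (hpath.mono fun ω hω => hω.2)

end Expectation

/-! ### What the step size conditions imply -/

section Parameters

attribute [local instance] Matrix.frobeniusNormedAddCommGroup Matrix.frobeniusNormedSpace

lemma regionPhi_le_two {n r N : ℕ} {δ₁ δ₂ : ℝ} (h : (localRegion n r N δ₁ δ₂).Nonempty) :
    regionPhi n r N δ₁ δ₂ ≤ 2 := by
  obtain ⟨X, hX⟩ := h
  by_cases hb : BddBelow
      ((fun X : Fin N → Mat n r => 2 - ⨆ i, ‖X i - iam X‖ ^ 2) '' localRegion n r N δ₁ δ₂)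
  · refine (csInf_le hb ⟨X, hX, rfl⟩).trans ?_
    have : 0 ≤ ⨆ i, ‖X i - iam X‖ ^ 2 := Real.iSup_nonneg fun i => sq_nonneg _
    simp only
    linarith
  -- For a set without lower bound the real infimum has the default value 0.
  · rw [regionPhi, Real.sInf_of_not_bddBelow hb]; norm_num

namespace Params

variable {p : Params}

/-- Consequences of the step size conditions. -/
structure Tame (p : Params) : Prop where
  α_le_one : p.α ≤ 1
  αM_le : p.α * p.M ≤ 1
  δ₁_pos : 0 < p.δ₁
  β_mul_le : p.β * (10 * p.A + p.LG) ≤ p.α * p.δ₁ / 5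
  δ₁_le : p.δ₁ ≤ p.α / 640
  Γ₀_ge : 1 / (2 * p.α ^ 2) ≤ p.Γ₀
  Γ₀_nonneg : 0 ≤ p.Γ₀

/-- The term D₄ = 4 r δ₁² / (β² L_G) inside C₁ is the decisive one: a bound on β C₁ becomes δ₁² ≤ β
L_G / 128, and β L_G ≤ α δ₁ / 5 turns this into δ₁ ≤ α / 640. -/
lemma StepSizes.tame (h : p.StepSizes) (hr : 1 ≤ p.r) (hLG : 0 < p.LG) (hA : 0 ≤ p.A)
    (hM : 0 < p.M) (hLt : 0 ≤ p.Lt) (hLt' : p.Lt ≤ 2) (hΦ : p.Φ ≤ 2) :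
    p.Tame := by
  obtain ⟨hα, hα', hβ, hβ'⟩ := h
  have hα1 := hα'.trans (min_le_left _ _)
  have hαM := hα'.trans ((min_le_right _ _).trans (min_le_left _ _))
  have hβ1 := hβ'.trans ((min_le_left _ _).trans (min_le_left _ _))
  have hβ2 := hβ'.trans ((min_le_left _ _).trans (min_le_right _ _))
  have hβ3 := hβ'.trans ((min_le_right _ _).trans (min_le_right _ _))
  have hAL : 0 < 10 * p.A + p.LG := by linarith
  -- The signs of δ₁ and of 1 - ρ are not assumed: they follow from β > 0, since both numbers are
  -- factors of upper bounds of β.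
  have hδ0 : 0 < p.δ₁ := by
    have h1 := hβ.trans_le hβ2
    have h2 : 0 < p.α * p.δ₁ := by
      by_contra hc
      exact absurd h1 (not_lt.2 (div_nonpos_of_nonpos_of_nonneg (not_lt.1 hc) (by linarith)))
    exact (mul_pos_iff_of_pos_left hα).1 h2
  have hρ1 : 0 < 1 - p.rho := by
    have h1 := hβ.trans_le hβ1
    have h2 := (mul_pos_iff_of_pos_right hδ0).1 h1
    by_contra hc
    exact absurd h2 (not_lt.2 (div_nonpos_of_nonpos_of_nonneg (not_lt.1 hc) hAL.le))
  have hρ0 : 0 ≤ p.rho := Real.sqrt_nonneg _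
  -- Since Φ ≤ 2, the radicand is at least (1 - α L_t)², so 1 - ρ ≤ α L_t ≤ 2 α.
  have hρ : 1 - p.rho ≤ 2 * p.α := by
    have hx : p.α * p.Lt * p.Φ ≤ p.α * p.Lt * 2 := mul_le_mul_of_nonneg_left hΦ (by positivity)
    have h1 : |1 - p.α * p.Lt| ≤ p.rho := Real.abs_le_sqrt (by linarith)
    have h2 := le_abs_self (1 - p.α * p.Lt)
    have h3 := mul_le_mul_of_nonneg_left hLt' hα.le
    linarith
  have hΓ : 1 / (2 * p.α ^ 2) ≤ p.Γ₀ := by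
    rw [Γ₀, div_le_div_iff₀ (by positivity) (by positivity)]
    have := pow_le_pow_left₀ hρ1.le hρ 2
    linarith
  have hΓ2 : 2 ≤ p.Γ₀ := by
    rw [Γ₀, le_div_iff₀ (by positivity)]
    have := pow_le_one₀ (n := 2) hρ1.le (by linarith)
    linarith
  have hβm : p.β * (10 * p.A + p.LG) ≤ p.α * p.δ₁ / 5 := by
    rw [le_div_iff₀ (by positivity)] at hβ2
    linarith
  have hr' : (1 : ℝ) ≤ p.r := by exact_mod_cast hr
  have hD₄ : 0 ≤ p.D₄ := by unfold D₄; positivity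
  have hΓ₂ : 0 ≤ p.Γ₂ := by unfold Γ₂; positivity
  have hD₁ : 0 < p.D₁ := by unfold D₁; positivity
  have hD₂ : p.D₄ ≤ p.D₂ := by
    have : 0 ≤ p.Ctilde := by unfold Ctilde; positivity
    have : 0 ≤ 3 * p.LG + 2 * p.α * p.A + 13 * p.LG * p.Ctilde * p.α ^ 2 := by positivity
    unfold D₂; linarith
  have hC₁ : 2 * (p.D₄ * p.Γ₀) < p.C₁ := by
    have := mul_le_mul_of_nonneg_right hD₂ (by linarith : 0 ≤ p.Γ₀)
    unfold C₁; linarith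
  -- From 8 β C₁ ≤ 1 and C₁ ≥ 2 D₄ Γ₀ ≥ 4 D₄.
  have hDΓ : 4 * (p.D₄ * p.β) ≤ 1 / 8 := by
    have h1 := mul_le_mul_of_nonneg_left hΓ2 hD₄
    have hE : 0 ≤ p.α * p.δ₁ * p.LG * (16 * p.Γ₀ + p.Γ₂) := by positivity
    rw [le_div_iff₀ (by linarith [mul_nonneg hD₄ (by linarith : 0 ≤ p.Γ₀)])] at hβ3
    have h2 := mul_le_mul_of_nonneg_left (show 4 * p.D₄ ≤ p.C₁ by linarith) hβ.le
    have h3 := mul_nonneg hβ.le hE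
    linarith
  have hδ : p.δ₁ ≤ p.α / 640 := by
    have h1 : 4 * (p.D₄ * p.β) = 16 * p.r * p.δ₁ ^ 2 / (p.β * p.LG) := by
      unfold D₄; field_simp; ring
    rw [h1, div_le_iff₀ (by positivity)] at hDΓ
    have h2 := mul_le_mul_of_nonneg_right hr' (sq_nonneg p.δ₁)
    have h3 : 0 ≤ p.β * p.A := by positivity
    have h4 : p.δ₁ * p.δ₁ ≤ p.α / 640 * p.δ₁ := by linarith
    exact le_of_mul_le_mul_right h4 hδ0
  refine ⟨hα1, ?_, hδ0, hβm, hδ, hΓ, by linarith⟩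
  rwa [le_div_iff₀ hM] at hαM

/-- Since β L_G ≤ α δ₁ / 5 ≤ 1/3200, the number 1 / (2 L_G) exceeds 1600 β. -/
lemma Tame.D₃_ge (h : p.Tame) (hβ : 0 < p.β) (hLG : 0 < p.LG) (hA : 0 ≤ p.A) :
    1600 * p.β ≤ p.D₃ := by
  have h1 := h.β_mul_le
  have h2 := mul_le_mul h.α_le_one h.δ₁_le h.δ₁_pos.le zero_le_one
  have h3 := h.α_le_one
  have h4 : 0 ≤ p.β * p.A := by positivity
  have h5 : 0 ≤ p.LG ^ 2 * p.β ^ 2 := by positivity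
  have h6 := mul_le_mul_of_nonneg_right (show p.β * p.LG ≤ 1 / 3200 by linarith) hLG.le
  rw [D₃, le_div_iff₀ (by positivity)]
  linarith

/-- With Γ₀ ≥ 1 / (2 α²) and D₃ ≥ 1600 β the floor has coefficient at least 6400 (β/α)². What is
needed is 2 · 1000 (β/α)², the factor 2 being lost when one index must serve two criteria. -/
lemma Tame.consensusFloor_ge (h : p.Tame) (hα : 0 < p.α) (hβ : 0 < p.β) (hLG : 0 < p.LG)
    (hA : 0 ≤ p.A) (σ : ℝ) (Q : ℕ) :
    2000 * (p.β / p.α) ^ 2 * (σ ^ 2 * (Q : ℝ)⁻¹) ≤ p.consensusFloor σ Q := by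
  have h1 := h.D₃_ge hβ hLG hA
  have hΓ₂ : 0 ≤ p.Γ₂ := by unfold Γ₂; positivity
  have h2 : 1600 * p.β ≤ 4 * p.β * p.Γ₂ + p.D₃ + p.β / 2 := by
    have : 0 ≤ p.β * p.Γ₂ := by positivity
    linarith
  have h3 : 8 * p.β * (1 / (2 * p.α ^ 2)) * (1600 * p.β)
      ≤ 8 * p.β * p.Γ₀ * (4 * p.β * p.Γ₂ + p.D₃ + p.β / 2) := by
    have := h.Γ₀_ge
    have := h.Γ₀_nonneg
    gcongr
  have h4 : 2000 * (p.β / p.α) ^ 2 ≤ 8 * p.β * (1 / (2 * p.α ^ 2)) * (1600 * p.β) := by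
    have h5 : 8 * p.β * (1 / (2 * p.α ^ 2)) * (1600 * p.β) = 6400 * (p.β / p.α) ^ 2 := by
      field_simp; ring
    rw [h5]
    have := sq_nonneg (p.β / p.α)
    linarith
  have h5 := mul_le_mul_of_nonneg_right (h4.trans h3) (by positivity : 0 ≤ σ ^ 2 * (Q : ℝ)⁻¹)
  refine h5.trans_eq ?_
  rw [consensusFloor, div_eq_mul_inv]; ring

/-- Already 16 · 1600 exceeds 26 = 2 · 13, twice the noise coefficient of the summed squared
gradients. -/
lemma Tame.gradFloor_ge (h : p.Tame) (hα : 0 < p.α) (hβ : 0 < p.β) (hLG : 0 < p.LG)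
    (hA : 0 ≤ p.A) (σ : ℝ) (Q : ℕ) :
    26 * (σ ^ 2 * (Q : ℝ)⁻¹) ≤ p.gradFloor σ Q := by
  have h1 := h.D₃_ge hβ hLG hA
  have hΓ₂ : 0 ≤ p.Γ₂ := by unfold Γ₂; positivity
  have hΓ₀ := h.Γ₀_nonneg
  have h2 : 1600 * p.β ≤ 4 * p.β * p.Γ₂ + p.D₃tilde := by
    have : 0 ≤ p.β * p.Γ₂ := by positivity
    unfold D₃tilde
    linarith
  have h3 : 16 ≤ 16 + p.Γ₀ * p.α ^ 2 * p.δ₁ ^ 2 := by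
    have : 0 ≤ p.Γ₀ * p.α ^ 2 * p.δ₁ ^ 2 := by positivity
    linarith
  have h4 : 16 * (1600 * p.β) ≤ (16 + p.Γ₀ * p.α ^ 2 * p.δ₁ ^ 2) * (4 * p.β * p.Γ₂ + p.D₃tilde) :=
    by gcongr
  have h5 : 26 ≤ (16 + p.Γ₀ * p.α ^ 2 * p.δ₁ ^ 2) * (4 * p.β * p.Γ₂ + p.D₃tilde) / p.β := by
    rw [le_div_iff₀ hβ]; linarith
  have h6 := mul_le_mul_of_nonneg_right h5 (by positivity : 0 ≤ σ ^ 2 * (Q : ℝ)⁻¹)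
  refine h6.trans_eq ?_
  rw [gradFloor, div_eq_mul_inv _ (p.β * Q), mul_inv, div_eq_mul_inv]; ring

end Params

end Parameters

/-! ### From the parameters to the hypotheses of the one-step analysis -/

section

attribute [local instance] Matrix.frobeniusNormedAddCommGroup Matrix.frobeniusNormedSpace
  frobeniusInnerProductSpace

lemma Params.Tame.stepBounds {p : Params} (h : p.Tame) {n r : ℕ} {L A₂ : ℝ}
    (hM : IsRetractionConst n r p.M) (hα : 0 < p.α) (hβ : 0 < p.β) (hL : 0 ≤ L)
    (hLG : L ≤ p.LG) (hA₂ : 0 ≤ A₂) (hA : A₂ ≤ p.A) (hδ : 5 * p.δ₁ ≤ p.δ₂) (hδ₂ : p.δ₂ ≤ 1 / 6) :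
    StepBounds n r p.M p.α p.β p.δ₁ p.δ₂ p.A (L + 2 * A₂) where
  retraction := hM
  α_pos := hα
  α_le := h.α_le_one
  αM_le := h.αM_le
  β_pos := hβ
  δ₁_pos := h.δ₁_pos
  δ₁_le := h.δ₁_le
  δ₁_le' := hδ
  δ₂_le := hδ₂
  A_nonneg := hA₂.trans hA
  Λ_nonneg := by linarith
  βA_le := by
    have h1 := h.β_mul_le
    have h2 := mul_nonneg hβ.le (hL.trans hLG)
    linarith
  βΛ_le := by
    refine le_trans (mul_le_mul_of_nonneg_left ?_ hβ.le) h.β_mul_le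
    linarith

lemma isLocal_of_mem_localRegion {n r N : ℕ} [NeZero N] {δ₁ δ₂ : ℝ} (hδ₁ : 0 ≤ δ₁)
    {X : Fin N → Mat n r} (hX : X ∈ localRegion n r N δ₁ δ₂) : IsLocal δ₁ δ₂ X where
  mem := hX.1
  isIAM := isIAM_iam ⟨_, hX.1 0⟩ X
  consErr_le := by
    refine (abs_le_of_sq_le_sq' ?_ hδ₁).2
    have hN : (0 : ℝ) < N := Nat.cast_pos.2 (NeZero.pos N)
    rw [consErr_sq, inv_mul_le_iff₀ hN]
    exact hX.2.1
  dist_le := hX.2.2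

end

/-! ### Sample sizes and complexities -/

/-- For x ≥ 1 both roundings lie between x / 2 and 2 x, so rounding costs only factors 2. -/
lemma IsRounding.bounds {x : ℝ} {m : ℕ} (h : IsRounding x m) (hx : 1 ≤ x) :
    0 < m ∧ (m : ℝ)⁻¹ ≤ 2 * x⁻¹ ∧ (m : ℝ) ≤ 2 * x := by
  have h1 : 1 ≤ m ∧ x ≤ 2 * m ∧ (m : ℝ) ≤ 2 * x := by
    rcases h with rfl | rfl
    · have h1 : 1 ≤ ⌊x⌋₊ := Nat.le_floor (by simpa using hx)
      have h2 : (1 : ℝ) ≤ ⌊x⌋₊ := by exact_mod_cast h1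
      have h3 := Nat.lt_floor_add_one x
      have h4 := Nat.floor_le (zero_le_one.trans hx)
      exact ⟨h1, by linarith, by linarith⟩
    · have h1 : 1 ≤ ⌈x⌉₊ := Nat.ceil_pos.2 (by linarith)
      have h2 := Nat.le_ceil x
      have h3 := Nat.ceil_lt_add_one (zero_le_one.trans hx)
      exact ⟨h1, by linarith, by linarith⟩
  obtain ⟨h1, h2, h3⟩ := h1
  refine ⟨h1, ?_, h3⟩
  have hm : (0 : ℝ) < m := by exact_mod_cast h1
  rw [← div_eq_mul_inv, inv_eq_one_div, div_le_div_iff₀ hm (by linarith)]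
  linarith

/-- The average of e / ε₁ + g / ε₂ is at most 1, so one index has both summands at most 1; separate
averages would give two different indices. -/
lemma exists_le_of_sum_le {e g : ℕ → ℝ} (he : ∀ k, 0 ≤ e k) (hg : ∀ k, 0 ≤ g k) {ε₁ ε₂ : ℝ}
    (h₁ : 0 < ε₁) (h₂ : 0 < ε₂) {K : ℕ}
    (hse : ∑ k ∈ Finset.range (K + 1), e k ≤ (K + 1) * ε₁ / 2)
    (hsg : ∑ k ∈ Finset.range (K + 1), g k ≤ (K + 1) * ε₂ / 2) :
    ∃ k ≤ K, e k ≤ ε₁ ∧ g k ≤ ε₂ := by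
  obtain ⟨k, hk, hle⟩ : ∃ k ∈ Finset.range (K + 1), e k / ε₁ + g k / ε₂ ≤ 1 := by
    refine Finset.exists_le_of_sum_le ⟨0, by simp⟩ ?_
    rw [Finset.sum_add_distrib, ← Finset.sum_div, ← Finset.sum_div]
    have h3 := (div_le_iff₀ h₁).2 (hse.trans_eq (show _ = ((K : ℝ) + 1) / 2 * ε₁ by ring))
    have h4 := (div_le_iff₀ h₂).2 (hsg.trans_eq (show _ = ((K : ℝ) + 1) / 2 * ε₂ by ring))
    simp only [Finset.sum_const, Finset.card_range, nsmul_eq_mul, mul_one, Nat.cast_add,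
      Nat.cast_one]
    linarith
  have h3 := div_nonneg (he k) h₁.le
  have h4 := div_nonneg (hg k) h₂.le
  exact ⟨k, Nat.lt_succ_iff.1 (Finset.mem_range.1 hk), (div_le_one h₁).1 (by linarith),
    (div_le_one h₂).1 (by linarith)⟩

/-- A number of iterations comparable to `x`. -/
lemma exists_iterations {x : ℝ} (hx : 1 ≤ x) : ∃ K : ℕ, x ≤ K + 1 ∧ (K : ℝ) + 1 ≤ x + 1 := by
  have h1 : 1 ≤ ⌈x⌉₊ := Nat.ceil_pos.2 (by linarith)
  refine ⟨⌈x⌉₊ - 1, ?_⟩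
  rw [Nat.cast_sub h1, Nat.cast_one, sub_add_cancel]
  exact ⟨Nat.le_ceil x, (Nat.ceil_lt_add_one (by linarith)).le⟩

/-- The variances have a convergent geometric sum, so K + 1 of order 1 / ε suffices. The same c₁
must bound the iterations and stand in the exponent, because q^(-(K+1)) dominates the sampling cost.
-/
lemma exponential_complexity {B q : ℝ} (hB : 1 ≤ B) (hq : 0 < q) (hq' : q < 1) :
    ∃ c₁ > 0, ∃ c > 0, ∀ m : ℕ → ℕ, (∀ k, IsRounding ((q ^ k)⁻¹) (m k)) →
      (∀ k, 0 < m k) ∧ ∀ ε : ℝ, 0 < ε → ε ≤ 1 / 2 → ∃ K : ℕ,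
        B * (1 + ∑ k ∈ Finset.range (K + 1), (m k : ℝ)⁻¹) ≤ ε * (K + 1) ∧
        (K : ℝ) + 1 ≤ c₁ / ε ∧
        ∑ k ∈ Finset.range (K + 1), (m k : ℝ) ≤ c * Real.exp (c₁ / ε * Real.log (1 / q)) := by
  set D := B * (1 + 2 * (1 - q)⁻¹) with hD
  have hq1 : 0 < (1 - q)⁻¹ := inv_pos.2 (by linarith)
  have hD1 : 1 ≤ D := by
    have : 0 ≤ B * (2 * (1 - q)⁻¹) := by positivity
    rw [hD, mul_add]; linarith
  have hqi : 1 < q⁻¹ := (one_lt_inv₀ hq).2 hq'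
  refine ⟨D + 1, by linarith, 2 / (q⁻¹ - 1), div_pos two_pos (by linarith), fun m hm => ?_⟩
  have hb : ∀ k, 0 < m k ∧ (m k : ℝ)⁻¹ ≤ 2 * q ^ k ∧ (m k : ℝ) ≤ 2 * q⁻¹ ^ k := fun k => by
    have := (hm k).bounds ((one_le_inv₀ (pow_pos hq k)).2 (pow_le_one₀ hq.le hq'.le))
    rwa [inv_inv, ← inv_pow] at this
  refine ⟨fun k => (hb k).1, fun ε hε hε' => ?_⟩
  obtain ⟨K, hK, hK'⟩ := exists_iterations (x := D / ε)
    ((one_le_div hε).2 (by linarith))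
  have hKε : (K : ℝ) + 1 ≤ (D + 1) / ε := by
    rw [add_div]
    have : 1 ≤ 1 / ε := (one_le_div hε).2 (by linarith)
    linarith
  refine ⟨K, ?_, hKε, ?_⟩
  · rw [div_le_iff₀ hε] at hK
    refine le_trans ?_ (hK.trans_eq (mul_comm _ _))
    refine mul_le_mul_of_nonneg_left ?_ (by linarith)
    have h1 : ∑ k ∈ Finset.range (K + 1), (m k : ℝ)⁻¹ ≤ 2 * (1 - q)⁻¹ := by
      refine (Finset.sum_le_sum fun k _ => (hb k).2.1).trans ?_
      rw [← Finset.mul_sum, ← tsum_geometric_of_lt_one hq.le hq']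
      exact mul_le_mul_of_nonneg_left ((summable_geometric_of_lt_one hq.le hq').sum_le_tsum _
        fun k _ => (pow_pos hq k).le) (by norm_num)
    linarith
  · refine (Finset.sum_le_sum fun k _ => (hb k).2.2).trans ?_
    rw [← Finset.mul_sum, geom_sum_eq hqi.ne', mul_div_assoc', div_mul_eq_mul_div]
    refine div_le_div_of_nonneg_right ?_ (by linarith)
    have h1 : q⁻¹ ^ (K + 1) = Real.exp (((K : ℝ) + 1) * Real.log (1 / q)) := by
      rw [one_div, mul_comm, Real.exp_mul, Real.exp_log (by linarith)]
      exact_mod_cast (Real.rpow_natCast q⁻¹ (K + 1)).symm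
    have h2 : Real.exp (((K : ℝ) + 1) * Real.log (1 / q))
        ≤ Real.exp ((D + 1) / ε * Real.log (1 / q)) := by
      refine Real.exp_le_exp.2 (mul_le_mul_of_nonneg_right hKε (Real.log_nonneg ?_))
      rw [one_div]; exact hqi.le
    rw [h1]
    linarith

lemma rounded_rpow_bounds {a : ℝ} (ha : 0 < a) {m : ℕ → ℕ}
    (hm : ∀ k : ℕ, IsRounding (((k : ℝ) + 1) ^ a) (m k)) (k : ℕ) :
    0 < m k ∧ (m k : ℝ)⁻¹ ≤ 2 * (((k : ℝ) + 1) ^ a)⁻¹ ∧ (m k : ℝ) ≤ 2 * ((k : ℝ) + 1) ^ a :=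
  (hm k).bounds (Real.one_le_rpow (by linarith [(Nat.cast_nonneg k : (0 : ℝ) ≤ k)]) ha.le)

lemma sum_rounded_rpow_le {a : ℝ} (ha : 0 < a) {m : ℕ → ℕ}
    (hm : ∀ k : ℕ, IsRounding (((k : ℝ) + 1) ^ a) (m k)) (K : ℕ) :
    ∑ k ∈ Finset.range (K + 1), (m k : ℝ) ≤ 2 * ((K : ℝ) + 1) ^ (a + 1) := by
  have h1 : ∀ k ∈ Finset.range (K + 1), (m k : ℝ) ≤ 2 * ((K : ℝ) + 1) ^ a := fun k hk => by
    refine (rounded_rpow_bounds ha hm k).2.2.trans ?_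
    have : (k : ℝ) ≤ K := by exact_mod_cast Nat.lt_succ_iff.1 (Finset.mem_range.1 hk)
    gcongr
  refine (Finset.sum_le_sum h1).trans_eq ?_
  rw [Finset.sum_const, Finset.card_range, nsmul_eq_mul, Real.rpow_add (by positivity),
    Real.rpow_one]
  push_cast; ring

/-- The series ∑ (k+1)^(-a) converges, so again K + 1 of order 1 / ε suffices, and the sampling cost
is of order (K + 1)^(a+1). -/
lemma superlinear_complexity {B a : ℝ} (hB : 1 ≤ B) (ha : 1 < a) :
    ∃ c > 0, ∀ m : ℕ → ℕ, (∀ k : ℕ, IsRounding (((k : ℝ) + 1) ^ a) (m k)) →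
      (∀ k, 0 < m k) ∧ ∀ ε : ℝ, 0 < ε → ε ≤ 1 / 2 → ∃ K : ℕ,
        B * (1 + ∑ k ∈ Finset.range (K + 1), (m k : ℝ)⁻¹) ≤ ε * (K + 1) ∧
        (K : ℝ) + 1 ≤ c * (1 / ε) ∧
        ∑ k ∈ Finset.range (K + 1), (m k : ℝ) ≤ c * (1 / ε ^ (a + 1)) := by
  have ha0 : 0 < a := by linarith
  have hs : Summable fun k : ℕ => (((k : ℝ) + 1) ^ a)⁻¹ := by
    have := (summable_nat_add_iff 1).2 (Real.summable_nat_rpow_inv.2 ha)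
    simpa using this
  set Z := ∑' k : ℕ, (((k : ℝ) + 1) ^ a)⁻¹
  have hZ : 0 ≤ Z := tsum_nonneg fun k => by positivity
  set D := B * (1 + 2 * Z) with hD
  have hD1 : 1 ≤ D := by
    have : 0 ≤ B * (2 * Z) := by positivity
    rw [hD, mul_add]; linarith
  have hc : 0 < 2 * (D + 1) ^ (a + 1) := by positivity
  refine ⟨D + 1 + 2 * (D + 1) ^ (a + 1), by positivity, fun m hm =>
    ⟨fun k => (rounded_rpow_bounds ha0 hm k).1, fun ε hε hε' => ?_⟩⟩
  obtain ⟨K, hK, hK'⟩ := exists_iterations (x := D / ε)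
    ((one_le_div hε).2 (by linarith))
  have hKε : (K : ℝ) + 1 ≤ (D + 1) / ε := by
    rw [add_div]
    have : 1 ≤ 1 / ε := (one_le_div hε).2 (by linarith)
    linarith
  refine ⟨K, ?_, ?_, ?_⟩
  · rw [div_le_iff₀ hε] at hK
    refine le_trans ?_ (hK.trans_eq (mul_comm _ _))
    refine mul_le_mul_of_nonneg_left ?_ (by linarith)
    have h1 : ∑ k ∈ Finset.range (K + 1), (m k : ℝ)⁻¹ ≤ 2 * Z := by
      refine (Finset.sum_le_sum fun k _ => (rounded_rpow_bounds ha0 hm k).2.1).trans ?_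
      rw [← Finset.mul_sum]
      exact mul_le_mul_of_nonneg_left (hs.sum_le_tsum _ fun k _ => by positivity) (by norm_num)
    linarith
  · refine hKε.trans ?_
    rw [← div_eq_mul_one_div]
    exact div_le_div_of_nonneg_right (by linarith) hε.le
  · refine (sum_rounded_rpow_le ha0 hm K).trans ?_
    have h1 : ((K : ℝ) + 1) ^ (a + 1) ≤ ((D + 1) / ε) ^ (a + 1) := by gcongr
    rw [Real.div_rpow (by linarith) hε.le] at h1
    rw [← div_eq_mul_one_div]
    calc 2 * ((K : ℝ) + 1) ^ (a + 1) ≤ (2 * (D + 1) ^ (a + 1)) / ε ^ (a + 1) := by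
          rw [mul_div_assoc]; linarith
      _ ≤ _ := div_le_div_of_nonneg_right (by linarith) (by positivity)

/-- Bernoulli's inequality for the exponent 1 - a bounds each summand by an increment of n^(1-a) /
(1-a), replacing the comparison with an integral. -/
lemma sum_inv_rpow_le {a : ℝ} (ha : 0 < a) (ha' : a < 1) (n : ℕ) :
    ∑ k ∈ Finset.range n, (((k : ℝ) + 1) ^ a)⁻¹ ≤ (n : ℝ) ^ (1 - a) / (1 - a) := by
  have ha1 : 0 < 1 - a := by linarith
  induction n with
  | zero => simp [Real.zero_rpow ha1.ne']
  | succ n ih =>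
    rw [Finset.sum_range_succ]
    have hn : (0 : ℝ) < (n : ℝ) + 1 := by positivity
    have h1 : (n : ℝ) ^ (1 - a)
        ≤ ((n : ℝ) + 1) ^ (1 - a) - (1 - a) * (((n : ℝ) + 1) ^ a)⁻¹ := by
      have h2 := rpow_one_add_le_one_add_mul_self (s := -((n : ℝ) + 1)⁻¹) (p := 1 - a)
        (neg_le_neg (inv_le_one_of_one_le₀ (by linarith [(Nat.cast_nonneg n : (0 : ℝ) ≤ n)])))
        ha1.le (by linarith)
      have h3 : (n : ℝ) = ((n : ℝ) + 1) * (1 + -((n : ℝ) + 1)⁻¹) := by field_simp; ring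
      have h4 : 0 ≤ 1 + -((n : ℝ) + 1)⁻¹ := by
        have : ((n : ℝ) + 1)⁻¹ ≤ 1 :=
          inv_le_one_of_one_le₀ (by linarith [(Nat.cast_nonneg n : (0 : ℝ) ≤ n)])
        linarith
      have h5 : ((n : ℝ) + 1) ^ (1 - a) = ((n : ℝ) + 1) * (((n : ℝ) + 1) ^ a)⁻¹ := by
        rw [Real.rpow_sub hn, Real.rpow_one, div_eq_mul_inv]
      calc (n : ℝ) ^ (1 - a) = (((n : ℝ) + 1) * (1 + -((n : ℝ) + 1)⁻¹)) ^ (1 - a) := by rw [← h3]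
        _ = ((n : ℝ) + 1) ^ (1 - a) * (1 + -((n : ℝ) + 1)⁻¹) ^ (1 - a) :=
            Real.mul_rpow hn.le h4
        _ ≤ ((n : ℝ) + 1) ^ (1 - a) * (1 + (1 - a) * -((n : ℝ) + 1)⁻¹) := by gcongr
        _ = _ := by rw [h5]; field_simp; ring
    push_cast
    have h6 := div_le_div_of_nonneg_right h1 ha1.le
    rw [sub_div, mul_div_cancel_left₀ _ ha1.ne'] at h6
    linarith

/-- Here ∑ 1/N_k grows like (K+1)^(1-a), so the requirement becomes D ≤ ε (K+1)^a; this fixes K + 1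
at about (D / ε)^(1/a). -/
lemma sublinear_complexity {B a : ℝ} (hB : 1 ≤ B) (ha : 0 < a) (ha' : a < 1) :
    ∃ c > 0, ∀ m : ℕ → ℕ, (∀ k : ℕ, IsRounding (((k : ℝ) + 1) ^ a) (m k)) →
      (∀ k, 0 < m k) ∧ ∀ ε : ℝ, 0 < ε → ε ≤ 1 / 2 → ∃ K : ℕ,
        B * (1 + ∑ k ∈ Finset.range (K + 1), (m k : ℝ)⁻¹) ≤ ε * (K + 1) ∧
        (K : ℝ) + 1 ≤ c * (1 / ε ^ (1 / a)) ∧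
        ∑ k ∈ Finset.range (K + 1), (m k : ℝ) ≤ c * (1 / ε ^ (1 + 1 / a)) := by
  have ha1 : 0 < 1 - a := by linarith
  set D := B * (1 + 2 * (1 - a)⁻¹) with hD
  have hD1 : 1 ≤ D := by
    have : 0 ≤ B * (2 * (1 - a)⁻¹) := by positivity
    rw [hD, mul_add]; linarith
  have hc₁ : 0 < 2 * D ^ (1 / a) := by positivity
  have hc₂ : 0 < 2 * (2 * D ^ (1 / a)) ^ (a + 1) := by positivity
  refine ⟨2 * D ^ (1 / a) + 2 * (2 * D ^ (1 / a)) ^ (a + 1), by positivity, fun m hm =>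
    ⟨fun k => (rounded_rpow_bounds ha hm k).1, fun ε hε hε' => ?_⟩⟩
  have hDε : 1 ≤ D / ε := (one_le_div hε).2 (by linarith)
  have hx1 : 1 ≤ (D / ε) ^ (1 / a) := Real.one_le_rpow hDε (by positivity)
  obtain ⟨K, hK, hK'⟩ := exists_iterations hx1
  have hKε : (K : ℝ) + 1 ≤ 2 * D ^ (1 / a) / ε ^ (1 / a) := by
    rw [mul_div_assoc, ← Real.div_rpow (by linarith) hε.le]
    linarith
  have hK0 : (1 : ℝ) ≤ (K : ℝ) + 1 := hx1.trans hK
  refine ⟨K, ?_, ?_, ?_⟩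
  · have h1 : ∑ k ∈ Finset.range (K + 1), (m k : ℝ)⁻¹
        ≤ 2 * (((K : ℝ) + 1) ^ (1 - a) * (1 - a)⁻¹) := by
      refine (Finset.sum_le_sum fun k _ => (rounded_rpow_bounds ha hm k).2.1).trans ?_
      rw [← Finset.mul_sum, ← div_eq_mul_inv]
      have := sum_inv_rpow_le ha ha' (K + 1)
      push_cast at this
      linarith
    have h2 : 1 ≤ ((K : ℝ) + 1) ^ (1 - a) := Real.one_le_rpow hK0 ha1.le
    have h3 : D ≤ ε * ((K : ℝ) + 1) ^ a := by
      have := Real.rpow_le_rpow (by positivity) hK ha.le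
      rw [← Real.rpow_mul (by linarith), one_div_mul_cancel ha.ne', Real.rpow_one,
        div_le_iff₀ hε] at this
      linarith
    calc B * (1 + ∑ k ∈ Finset.range (K + 1), (m k : ℝ)⁻¹)
        ≤ B * (((K : ℝ) + 1) ^ (1 - a) + 2 * (((K : ℝ) + 1) ^ (1 - a) * (1 - a)⁻¹)) :=
          mul_le_mul_of_nonneg_left (by linarith) (by linarith)
      _ = D * ((K : ℝ) + 1) ^ (1 - a) := by rw [hD]; ring
      _ ≤ ε * ((K : ℝ) + 1) ^ a * ((K : ℝ) + 1) ^ (1 - a) :=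
          mul_le_mul_of_nonneg_right h3 (by positivity)
      _ = ε * (K + 1) := by
          rw [mul_assoc, ← Real.rpow_add (by linarith), add_sub_cancel, Real.rpow_one]
  · refine hKε.trans ?_
    rw [← div_eq_mul_one_div]
    exact div_le_div_of_nonneg_right (by linarith) (by positivity)
  · refine (sum_rounded_rpow_le ha hm K).trans ?_
    have h1 : ((K : ℝ) + 1) ^ (a + 1) ≤ (2 * D ^ (1 / a) / ε ^ (1 / a)) ^ (a + 1) := by gcongr
    have h2 : (ε ^ (1 / a)) ^ (a + 1) = ε ^ (1 + 1 / a) := by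
      rw [← Real.rpow_mul hε.le]; congr 1; field_simp
    rw [Real.div_rpow hc₁.le (by positivity), h2] at h1
    rw [← div_eq_mul_one_div]
    calc 2 * ((K : ℝ) + 1) ^ (a + 1)
        ≤ (2 * (2 * D ^ (1 / a)) ^ (a + 1)) / ε ^ (1 + 1 / a) := by
          rw [mul_div_assoc]; linarith
      _ ≤ _ := div_le_div_of_nonneg_right (by linarith) (by positivity)

/-- The harmonic sum is logarithmic, and the logarithm of (1/ε) log (1/ε) is again O(log (1/ε)), so
that many iterations suffice. The assumption ε ≤ 1/2 keeps log (1/ε) away from zero. -/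
lemma linear_complexity {B : ℝ} (hB : 1 ≤ B) :
    ∃ c > 0, ∀ m : ℕ → ℕ, (∀ k : ℕ, m k = k + 1) →
      (∀ k, 0 < m k) ∧ ∀ ε : ℝ, 0 < ε → ε ≤ 1 / 2 → ∃ K : ℕ,
        B * (1 + ∑ k ∈ Finset.range (K + 1), (m k : ℝ)⁻¹) ≤ ε * (K + 1) ∧
        (K : ℝ) + 1 ≤ c * (1 / ε * Real.log (1 / ε)) ∧
        ∑ k ∈ Finset.range (K + 1), (m k : ℝ) ≤ c * (1 / ε ^ 2 * Real.log (1 / ε) ^ 2) := by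
  -- Chosen so that B (4 u + 2) ≤ u² - 1. The number of iterations is taken near (u² - 1) times
  -- (1/ε) log (1/ε), leaving one unit for rounding up.
  set u := 4 * B + 3 with hu
  have hu0 : 7 ≤ u := by linarith
  refine ⟨u ^ 2 + u ^ 4, by positivity, fun m hm => ⟨fun k => by rw [hm k]; omega,
    fun ε hε hε' => ?_⟩⟩
  set l := Real.log (1 / ε) with hl
  have hε2 : 2 ≤ 1 / ε := by rw [le_div_iff₀ hε]; linarith
  have hl2 : 1 / 2 ≤ l := by
    have := Real.log_le_log (by norm_num) hε2
    linarith [Real.log_two_gt_d9]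
  have hlε : 1 ≤ 1 / ε * l := by
    have := mul_le_mul hε2 hl2 (by norm_num) (by linarith)
    linarith
  have hu1 : 1 ≤ (u ^ 2 - 1) * (1 / ε * l) := by
    have : 1 ≤ u ^ 2 - 1 := by nlinarith
    nlinarith
  obtain ⟨K, hK, hK'⟩ := exists_iterations hu1
  have hKε : (K : ℝ) + 1 ≤ u ^ 2 * (1 / ε * l) := by linarith
  have hK0 : (0 : ℝ) < (K : ℝ) + 1 := by positivity
  have hsum : ∑ k ∈ Finset.range (K + 1), (m k : ℝ)⁻¹ ≤ 1 + Real.log ((K : ℝ) + 1) := by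
    have := harmonic_le_one_add_log (K + 1)
    simp only [harmonic, hm] at this ⊢
    push_cast at this ⊢
    exact this
  -- The bound log x ≤ x - 1 for x = u and for x = l removes the constant and the iterated
  -- logarithm.
  have hlog : Real.log ((K : ℝ) + 1) ≤ 2 * (u - 1) + 2 * l := by
    refine (Real.log_le_log hK0 hKε).trans ?_
    rw [Real.log_mul (by positivity) (by positivity), Real.log_mul (by positivity) (by positivity),
      Real.log_pow, ← hl]
    have h1 := Real.log_le_sub_one_of_pos (show 0 < u by linarith)
    have h2 := Real.log_le_sub_one_of_pos (show 0 < l by linarith)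
    push_cast
    linarith
  refine ⟨K, ?_, ?_, ?_⟩
  · have h1 : ε * ((u ^ 2 - 1) * (1 / ε * l)) = (u ^ 2 - 1) * l := by field_simp
    have h2 : B * (1 + ∑ k ∈ Finset.range (K + 1), (m k : ℝ)⁻¹) ≤ B * (2 * u + 2 * l) :=
      mul_le_mul_of_nonneg_left (by linarith) (by linarith)
    have h3 := mul_le_mul_of_nonneg_left hK hε.le
    have h4 : B * (2 * u + 2 * l) ≤ B * ((4 * u + 2) * l) :=
      mul_le_mul_of_nonneg_left (by nlinarith) (by linarith)
    have h5 : B * ((4 * u + 2) * l) ≤ (u ^ 2 - 1) * l := by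
      rw [← mul_assoc]
      refine mul_le_mul_of_nonneg_right ?_ (by linarith)
      rw [hu]; nlinarith
    linarith
  · refine hKε.trans (mul_le_mul_of_nonneg_right ?_ (by linarith))
    have : 0 ≤ u ^ 4 := by positivity
    linarith
  · have h1 : ∑ k ∈ Finset.range (K + 1), (m k : ℝ) ≤ ((K : ℝ) + 1) ^ 2 := by
      have h2 : ∀ k ∈ Finset.range (K + 1), (m k : ℝ) ≤ (K : ℝ) + 1 := fun k hk => by
        rw [hm k]
        exact_mod_cast Finset.mem_range.1 hk
      refine (Finset.sum_le_sum h2).trans_eq ?_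
      rw [Finset.sum_const, Finset.card_range, nsmul_eq_mul]
      push_cast; ring
    refine h1.trans ((pow_le_pow_left₀ hK0.le hKε 2).trans ?_)
    have h3 : (u ^ 2 * (1 / ε * l)) ^ 2 = u ^ 4 * (1 / ε ^ 2 * l ^ 2) := by
      rw [mul_pow, mul_pow, one_div_pow]; ring
    rw [h3]
    exact mul_le_mul_of_nonneg_right (by linarith [sq_nonneg u]) (by positivity)

/-! ### From summed errors to stationary iterates -/

section

attribute [local instance] Matrix.frobeniusNormedAddCommGroup Matrix.frobeniusNormedSpace

variable {Ω : Type*} [MeasurableSpace Ω] {μ : Measure Ω} {n r N : ℕ} {f : Mat n r → ℝ}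
  {X : ℕ → Ω → Fin N → Mat n r}

lemma reachesWithin_of_sum_le (𝒢 : SimpleGraph (Fin N)) (t : ℕ) {m : ℕ → ℕ}
    (hX : ∀ k, Integrable (fun ω => consensusSq (X k ω)) μ ∧
      Integrable (fun ω => ‖rgrad f (iam (X k ω))‖ ^ 2) μ)
    {ε₁ ε₂ : ℝ} (h₁ : 0 < ε₁) (h₂ : 0 < ε₂) {K : ℕ}
    (hse : ∑ k ∈ Finset.range (K + 1), (N : ℝ)⁻¹ * ∫ ω, consensusSq (X k ω) ∂μ
      ≤ (K + 1) * ε₁ / 2)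
    (hsg : ∑ k ∈ Finset.range (K + 1), ∫ ω, ‖rgrad f (iam (X k ω))‖ ^ 2 ∂μ
      ≤ (K + 1) * ε₂ / 2)
    {I O C : ℝ} (hI : (K : ℝ) + 1 ≤ I) (hO : N * ∑ k ∈ Finset.range (K + 1), (m k : ℝ) ≤ O)
    (hC : 2 * t * 𝒢.edgeSet.ncard * ((K : ℝ) + 1) ≤ C) : ReachesWithin μ f X 𝒢 t m ε₁ ε₂ I O C := by
  obtain ⟨k, hk, he, hg⟩ := exists_le_of_sum_le
    (fun k => mul_nonneg (by positivity) (integral_nonneg fun ω =>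
      Finset.sum_nonneg fun i _ => sq_nonneg ‖X k ω i - iam (X k ω)‖))
    (fun k => integral_nonneg fun ω => sq_nonneg _) h₁ h₂ hse hsg
  refine ⟨K, ⟨k, hk, (hX k).1, (hX k).2, he, hg⟩, hI, ?_, ?_⟩
  · simpa [oracleCalls] using hO
  · simpa [communications] using hC

lemma GradBoundedBy.nonneg [NeZero N] {f : Fin N → Mat n r → ℝ} {A : ℝ} (h : GradBoundedBy f A)
    (hne : (stiefel n r).Nonempty) : 0 ≤ A :=
  (norm_nonneg _).trans (h 0 _ hne.some_mem)

end

end StiefelTracking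

end

/-! ### The main theorem: the five sample size schedules -/

open StiefelTracking MeasureTheory ProbabilityTheory in
theorem corollary1
    -- dimensions, number of agents, network, number of communication rounds
    {n r N : ℕ} (hr : 1 ≤ r)
    (𝒢 : SimpleGraph (Fin N)) (W : Matrix (Fin N) (Fin N) ℝ) (hW : IsMixingMatrix 𝒢 W)
    (t : ℕ) (ht : 1 ≤ t) (ht' : ⌈Real.logb (sigma2 W) (1 / (2 * √(N : ℝ)))⌉₊ ≤ t)
    -- expectation-valued local costs, smooth in Euclidean space
    {Ξ : Fin N → Type*} [∀ i, MeasurableSpace (Ξ i)]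
    (P : ∀ i, Measure (Ξ i)) [∀ i, IsProbabilityMeasure (P i)]
    (F : ∀ i, Mat n r → Ξ i → ℝ) (hF : ∀ i X, Integrable (F i X) (P i))
    (L : ℝ) (hL : 0 < L) (hf : ∀ i, LSmooth L (localCost P F i))
    -- stochastic oracle
    (G : ∀ i, Mat n r → Ξ i → Mat n r) (A₁ A₂ σ : ℝ) (hA₁ : 0 < A₁)
    (hG : IsGradientOracle P (localCost P F) G A₁ σ) (hA₂ : GradBoundedBy (localCost P F) A₂)
    -- samples
    {Ω : Type*} [MeasurableSpace Ω] (μ : Measure Ω) [IsProbabilityMeasure μ]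
    (ξ : ∀ i, ℕ → ℕ → Ω → Ξ i) (hξ : IsSampling μ P ξ)
    -- local region, initial point, step sizes
    (δ₁ δ₂ : ℝ) (hδ₁ : δ₁ ≤ 1 / (5 * √(r : ℝ)) * δ₂) (hδ₂ : δ₂ ≤ 1 / 6)
    (X₀ : Fin N → Mat n r) (hX₀ : X₀ ∈ localRegion n r N δ₁ δ₂)
    (M : ℝ) (hM : IsRetractionConst n r M) (α β : ℝ) (p : Params)
    (hp : p = { r := r, t := t, LG := L + 2 * maxGradNorm (localCost P F), A := max A₁ A₂,
                M := M, σ₂ := sigma2 W, Lt := mixL W t, Φ := regionPhi n r N δ₁ δ₂,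
                δ₁ := δ₁, δ₂ := δ₂, α := α, β := β })
    (hstep : p.StepSizes) :
    -- exponentially increasing sample size
    (∀ q : ℝ, 0 < q → q < 1 → ∃ c₁ > 0, ∃ c > 0, ∀ m : ℕ → ℕ,
      (∀ k : ℕ, IsRounding ((q ^ k)⁻¹) (m k)) → ∀ ε : ℝ, 0 < ε → ε ≤ 1 / 2 →
        ReachesWithin μ (avgCost (localCost P F)) (randomIterate W t α β G X₀ ξ m) 𝒢 t m ε ε
          (c₁ / ε)
          (c * Real.exp (c₁ / ε * Real.log (1 / q)))
          (c * (t * 𝒢.edgeSet.ncard / ε))) ∧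
    -- polynomially increasing sample size, exponent one
    (∃ c > 0, ∀ m : ℕ → ℕ, (∀ k : ℕ, m k = k + 1) → ∀ ε : ℝ, 0 < ε → ε ≤ 1 / 2 →
        ReachesWithin μ (avgCost (localCost P F)) (randomIterate W t α β G X₀ ξ m) 𝒢 t m ε ε
          (c * (1 / ε * Real.log (1 / ε)))
          (c * (1 / ε ^ 2 * Real.log (1 / ε) ^ 2))
          (c * (t * 𝒢.edgeSet.ncard / ε * Real.log (1 / ε)))) ∧
    -- polynomially increasing sample size, exponent less than one
    (∀ a : ℝ, 0 < a → a < 1 → ∃ c > 0, ∀ m : ℕ → ℕ,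
      (∀ k : ℕ, IsRounding (((k : ℝ) + 1) ^ a) (m k)) → ∀ ε : ℝ, 0 < ε → ε ≤ 1 / 2 →
        ReachesWithin μ (avgCost (localCost P F)) (randomIterate W t α β G X₀ ξ m) 𝒢 t m ε ε
          (c * (1 / ε ^ (1 / a)))
          (c * (1 / ε ^ (1 + 1 / a)))
          (c * (t * 𝒢.edgeSet.ncard / ε ^ (1 / a)))) ∧
    -- polynomially increasing sample size, exponent greater than one
    (∀ a : ℝ, 1 < a → ∃ c > 0, ∀ m : ℕ → ℕ,
      (∀ k : ℕ, IsRounding (((k : ℝ) + 1) ^ a) (m k)) → ∀ ε : ℝ, 0 < ε → ε ≤ 1 / 2 →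
        ReachesWithin μ (avgCost (localCost P F)) (randomIterate W t α β G X₀ ξ m) 𝒢 t m ε ε
          (c * (1 / ε))
          (c * (1 / ε ^ (a + 1)))
          (c * (t * 𝒢.edgeSet.ncard / ε))) ∧
    -- constant sample size
    (∃ c > 0, ∀ Q : ℕ, 0 < Q → ∀ m : ℕ → ℕ, (∀ k : ℕ, m k = Q) →
      ∀ ε : ℝ, 0 < ε → ε ≤ 1 / 2 →
        ReachesWithin μ (avgCost (localCost P F)) (randomIterate W t α β G X₀ ξ m) 𝒢 t m
          (ε + p.consensusFloor σ Q) (ε + p.gradFloor σ Q)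
          (c * (1 / ε))
          (c * (Q / ε))
          (c * (t * 𝒢.edgeSet.ncard / ε))) := by
  have hN : NeZero N := ⟨by
    rintro rfl
    exact hW.connected.nonempty.elim fun i => i.elim0⟩
  have hne : (stiefel n r).Nonempty := ⟨_, hX₀.1 0⟩
  have hr' : (1 : ℝ) ≤ √(r : ℝ) := Real.one_le_sqrt.2 (by exact_mod_cast hr)
  have hA₂' : 0 ≤ A₂ := hA₂.nonneg hne
  have hn := maxGradNorm_nonneg (localCost P F)
  have hLt := hW.isDoublyStochastic.mixL_bounds t
  obtain ⟨hpr, hpLG, hpA, hpM, hpLt, hpΦ, hpδ₁, hpδ₂, hpα, hpβ⟩ :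
      p.r = r ∧ p.LG = L + 2 * maxGradNorm (localCost P F) ∧ p.A = max A₁ A₂ ∧ p.M = M ∧
      p.Lt = mixL W t ∧ p.Φ = regionPhi n r N δ₁ δ₂ ∧ p.δ₁ = δ₁ ∧ p.δ₂ = δ₂ ∧ p.α = α ∧
      p.β = β := by subst hp; exact ⟨rfl, rfl, rfl, rfl, rfl, rfl, rfl, rfl, rfl, rfl⟩
  have hα := hstep.α_pos
  have hβ := hstep.β_pos
  have hLG : 0 < p.LG := by rw [hpLG]; linarith
  have hA : 0 ≤ p.A := by rw [hpA]; exact hA₁.le.trans (le_max_left _ _)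
  have htame : p.Tame := hstep.tame (hpr ▸ hr) hLG hA (hpM ▸ hM.1) (hpLt ▸ hLt.1) (hpLt ▸ hLt.2)
    (hpΦ ▸ regionPhi_le_two ⟨X₀, hX₀⟩)
  have hδ : 5 * p.δ₁ ≤ p.δ₂ := by
    have h0 := htame.δ₁_pos
    rw [hpδ₁] at h0 ⊢
    rw [hpδ₂]
    rw [one_div, inv_mul_eq_div, le_div_iff₀ (by positivity)] at hδ₁
    have := mul_le_mul_of_nonneg_left hr' h0.le
    linarith
  -- The analysis runs with the Lipschitz constant L + 2 A₂ from Frobenius bounds, not with L_G; the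
  -- step sizes control β (10 A + L_G), which dominates it.
  have hsb : StepBounds n r p.M p.α p.β p.δ₁ p.δ₂ p.A (L + 2 * A₂) :=
    htame.stepBounds (hpM ▸ hM) hα hβ hL.le (by rw [hpLG]; linarith) hA₂'
      (by rw [hpA]; exact le_max_right _ _) hδ (hpδ₂ ▸ hδ₂)
  have hloc : IsLocal p.δ₁ p.δ₂ X₀ :=
    isLocal_of_mem_localRegion htame.δ₁_pos.le (by rw [hpδ₁, hpδ₂]; exact hX₀)
  obtain ⟨C, hC0, hC⟩ := exists_expectation_bound hG hL.le hf hA₂ hξ hsb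
    (by rw [hpA]; exact le_max_left _ _) (hW.isMixing ht ht') hloc
  rw [hpα, hpβ] at hC
  set V := 13 * σ ^ 2 + 1000 * (β / α) ^ 2 * σ ^ 2 with hV
  have hV1 : 0 ≤ 1000 * (β / α) ^ 2 * σ ^ 2 := by positivity
  have hV2 : 0 ≤ 13 * σ ^ 2 := by positivity
  -- The factor 2 pays for serving both criteria at one index; the summand 1 ensures B ≥ 1.
  set B := 2 * (C + V) + 1 with hB
  have hB1 : 1 ≤ B := by linarith
  -- For growing sample sizes both criteria follow from the single inequality B (1 + ∑ 1/N_k) ≤ ε (K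
  -- + 1), in which V majorizes both noise coefficients.
  have hgrow : ∀ m : ℕ → ℕ, (∀ k, 0 < m k) → ∀ ε : ℝ, 0 < ε → ∀ K : ℕ,
      B * (1 + ∑ k ∈ Finset.range (K + 1), (m k : ℝ)⁻¹) ≤ ε * (K + 1) →
      ∀ I O Cc : ℝ, (K : ℝ) + 1 ≤ I → N * ∑ k ∈ Finset.range (K + 1), (m k : ℝ) ≤ O →
      2 * t * 𝒢.edgeSet.ncard * ((K : ℝ) + 1) ≤ Cc →
      ReachesWithin μ (avgCost (localCost P F)) (randomIterate W t α β G X₀ ξ m) 𝒢 t m ε ε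
        I O Cc := by
    intro m hm ε hε K hK I O Cc hI hO hCc
    obtain ⟨hint, hsum⟩ := hC m hm
    set S := ∑ k ∈ Finset.range (K + 1), (m k : ℝ)⁻¹ with hS
    have hS0 : 0 ≤ S := Finset.sum_nonneg fun k _ => by positivity
    have hCS := mul_nonneg hC0 hS0
    have h1 := mul_nonneg hV1 hS0
    have h2 := mul_nonneg hV2 hS0
    have h3 : (C + V) * (1 + S) ≤ (K + 1) * ε / 2 := by
      have : B * (1 + S) = 2 * ((C + V) * (1 + S)) + (1 + S) := by rw [hB]; ring
      linarith
    have h4 : (C + V) * (1 + S) = C + C * S + 13 * σ ^ 2 + 1000 * (β / α) ^ 2 * σ ^ 2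
        + 13 * σ ^ 2 * S + 1000 * (β / α) ^ 2 * σ ^ 2 * S := by rw [hV]; ring
    refine reachesWithin_of_sum_le 𝒢 t hint hε hε ((hsum K).2.trans ?_) ((hsum K).1.trans ?_)
      hI hO hCc
    · linarith
    · linarith
  have hE : (0 : ℝ) ≤ t * 𝒢.edgeSet.ncard := by positivity
  -- The common factor 2 (N + 1) covers the N agents in the sampling cost and the factor 2 in the
  -- communications.
  have hcost : ∀ {c x y : ℝ} {K : ℕ} {m : ℕ → ℕ}, 0 < c → 0 ≤ x → 0 ≤ y → (K : ℝ) + 1 ≤ c * x →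
      ∑ k ∈ Finset.range (K + 1), (m k : ℝ) ≤ c * y →
      (K : ℝ) + 1 ≤ 2 * (N + 1) * c * x ∧
      N * ∑ k ∈ Finset.range (K + 1), (m k : ℝ) ≤ 2 * (N + 1) * c * y ∧
      2 * t * 𝒢.edgeSet.ncard * ((K : ℝ) + 1)
        ≤ 2 * (N + 1) * c * (t * 𝒢.edgeSet.ncard * x) := by
    intro c x y K m hc hx hy h1 h2
    have hN0 : (0 : ℝ) ≤ N := by positivity
    have h3 := mul_nonneg hc.le hx
    have h4 := mul_nonneg hc.le hy
    have h5 := mul_nonneg hN0 h3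
    have h6 := mul_nonneg hN0 h4
    have h7 := mul_le_mul_of_nonneg_left h2 hN0
    have h8 := mul_le_mul_of_nonneg_left h1 hE
    have h9 := mul_nonneg hE h5
    exact ⟨by linarith, by linarith, by linarith⟩
  have hN1 : (0 : ℝ) < 2 * (N + 1) := by positivity
  refine ⟨fun q hq hq' => ?_, ?_, fun a ha ha' => ?_, fun a ha => ?_, ?_⟩
  · obtain ⟨c₁, hc₁, c, hc, h⟩ := exponential_complexity hB1 hq hq'
    -- Only the prefactor is enlarged: c₁ also stands in the exponent and is kept.
    refine ⟨c₁, hc₁, 2 * (N + 1) * (c₁ + c), by positivity, fun m hm ε hε hε' => ?_⟩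
    obtain ⟨hm0, h⟩ := h m hm
    obtain ⟨K, hK, hI, hO⟩ := h ε hε hε'
    have hε0 : 0 ≤ 1 / ε := by positivity
    have hcε := mul_nonneg hc.le hε0
    have hexp := mul_nonneg hc₁.le (Real.exp_pos (c₁ / ε * Real.log (1 / q))).le
    obtain ⟨-, h2, h3⟩ := hcost (c := c₁ + c) (m := m) (by positivity) hε0
      (Real.exp_pos (c₁ / ε * Real.log (1 / q))).le
      (hI.trans (by rw [div_eq_mul_one_div]; linarith)) (hO.trans (by linarith))
    exact hgrow m hm0 ε hε K hK _ _ _ hI h2 (h3.trans_eq (by ring))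
  · obtain ⟨c, hc, h⟩ := linear_complexity hB1
    refine ⟨2 * (N + 1) * c, by positivity, fun m hm ε hε hε' => ?_⟩
    obtain ⟨hm0, h⟩ := h m hm
    obtain ⟨K, hK, hI, hO⟩ := h ε hε hε'
    have hlog : 0 ≤ Real.log (1 / ε) :=
      Real.log_nonneg (by rw [le_div_iff₀ hε]; linarith)
    obtain ⟨h1, h2, h3⟩ := hcost hc (by positivity) (by positivity) hI hO
    exact hgrow m hm0 ε hε K hK _ _ _ h1 h2 (h3.trans_eq (by ring))
  · obtain ⟨c, hc, h⟩ := sublinear_complexity hB1 ha ha'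
    refine ⟨2 * (N + 1) * c, by positivity, fun m hm ε hε hε' => ?_⟩
    obtain ⟨hm0, h⟩ := h m hm
    obtain ⟨K, hK, hI, hO⟩ := h ε hε hε'
    obtain ⟨h1, h2, h3⟩ := hcost hc (by positivity) (by positivity) hI hO
    exact hgrow m hm0 ε hε K hK _ _ _ h1 h2 (h3.trans_eq (by ring))
  · obtain ⟨c, hc, h⟩ := superlinear_complexity hB1 ha
    refine ⟨2 * (N + 1) * c, by positivity, fun m hm ε hε hε' => ?_⟩
    obtain ⟨hm0, h⟩ := h m hm
    obtain ⟨K, hK, hI, hO⟩ := h ε hε hε'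
    obtain ⟨h1, h2, h3⟩ := hcost hc (by positivity) (by positivity) hI hO
    exact hgrow m hm0 ε hε K hK _ _ _ h1 h2 (h3.trans_eq (by ring))
  -- Once K + 1 ≥ B / ε, the constant C contributes at most ε / 2 to each average, and the noise at
  -- most half of its floor; nothing in this choice involves Q.
  · refine ⟨2 * (N + 1) * (B + 1), by positivity, fun Q hQ m hm ε hε hε' => ?_⟩
    obtain ⟨K, hK, hK'⟩ := exists_iterations (x := B / ε) ((one_le_div hε).2 (by linarith))
    have hK0 : (0 : ℝ) ≤ (K : ℝ) + 1 := by positivity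
    have hI : (K : ℝ) + 1 ≤ (B + 1) * (1 / ε) := by
      have : 1 ≤ 1 / ε := (one_le_div hε).2 (by linarith)
      rw [div_eq_mul_one_div] at hK'
      linarith
    have hO : ∑ k ∈ Finset.range (K + 1), (m k : ℝ) ≤ (B + 1) * (Q / ε) := by
      have h1 := mul_le_mul_of_nonneg_right hI (Nat.cast_nonneg' Q : (0 : ℝ) ≤ Q)
      simp only [hm, Finset.sum_const, Finset.card_range, nsmul_eq_mul]
      push_cast
      exact h1.trans_eq (by ring)
    obtain ⟨h1, h2, h3⟩ := hcost (by linarith) (by positivity) (by positivity) hI hO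
    obtain ⟨hint, hsum⟩ := hC m fun k => hm k ▸ hQ
    have hS : σ ^ 2 * ∑ k ∈ Finset.range (K + 1), (m k : ℝ)⁻¹
        = ((K : ℝ) + 1) * (σ ^ 2 * (Q : ℝ)⁻¹) := by
      simp only [hm, Finset.sum_const, Finset.card_range, nsmul_eq_mul]
      push_cast; ring
    have hv : 0 ≤ σ ^ 2 * (Q : ℝ)⁻¹ := by positivity
    have hf1 := htame.consensusFloor_ge hα hβ hLG hA σ Q
    have hf2 := htame.gradFloor_ge hα hβ hLG hA σ Q
    rw [hpα, hpβ] at hf1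
    have hf1' : 0 ≤ 2000 * (β / α) ^ 2 * (σ ^ 2 * (Q : ℝ)⁻¹) := by positivity
    have hg1 := mul_le_mul_of_nonneg_left hf1 hK0
    have hg2 := mul_le_mul_of_nonneg_left hf2 hK0
    rw [div_le_iff₀ hε] at hK
    have hV0 : 0 ≤ V := by linarith
    refine reachesWithin_of_sum_le 𝒢 t hint (by linarith) (by linarith) ((hsum K).2.trans ?_)
      ((hsum K).1.trans ?_) h1 h2 (h3.trans_eq (by ring))
    · rw [hS]; linarith
    · rw [hS]; linarith
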